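/- **Setting.** Let $M$ be a smooth (Hausdorff, second countable) manifold of dimension $n\ge 1$ with a fixed smooth positive density $\mu$; it is used to identify the densitized dual $\tilde V^*=V^*\otimes\Lambda^nM$ of a vector bundle $V\to M$ with $V^*$, and $(n-1)$-forms $\iota_X\mu$ with vector fields $X$, so that $d$ becomes the divergence. All vector bundles are smooth, real and of finite rank; $\Gamma(V)$ denotes the smooth sections. Differential operators have finite order and smooth coefficients (in the non-linear case: depend smoothly on the point and on finitely many derivatives). Formal adjoints $D^*$ are taken with respect to the pairings $\psi\cdot\tilde\alpha^*$: $D[\phi]\cdot\psi-\phi\cdot D^*[\psi]=dG[\phi,\psi]$ for a bilinear bidifferential operator $G$ (a *Green form* of $D$). A pair $V\xrightarrow{a}W\xrightarrow{b}X$ of linear differential operators is a *formally exact complex* if $b\circ a=0$ and, at each point and for every $s$, if the $s$-jet of $b\phi$ vanishes then $\phi$ agrees to order $s+l$ ($l$ an order of $b$) with some $a\psi$. Let $C\subset TM$ be a chronal cone bundle: a field of non-empty open convex salient cones $C_x\subset T_xM$ such that $C$ is open and the fibrewise closure is closed in $TM$. Let $I^\pm(N)$ be the set of points reached from (respectively,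 from which one reaches) a point of $N$ by smooth future-directed timelike curves, i.e. curves with velocity in $C$, and $I(N)=I^+(N)\cup I^-(N)\cup N$. Assume that there is a Cauchy surface $\Sigma$: a smooth embedded hypersurface that is acausal and is met exactly once by each inextensible causal curve (locally Lipschitz, with velocity almost everywhere in the closed cone and non-zero). $\Sigma$ is oriented towards the future. $\Gamma_0$, $\Gamma_\pm$, $\Gamma_{SC}$ denote the sections whose support is compact, respectively contained in $\overline{I^\pm(K)}$, respectively in $\overline{I(K)}$, for some compact $K$. A linear operator $f$ is *Green hyperbolic* if for each $\alpha\in\Gamma_\pm$ the equation $f[\psi]=\alpha$ has a unique solution $\mathrm G_\pm[\alpha]\in\Gamma_\pm$, with support in $\overline{I^\pm(\operatorname{supp}\alpha)}$; put $\mathrm G=\mathrm G_+-\mathrm G_-$. In what follows a *hyperbolic* operator $\Gamma(V)\to\Gamma(\tilde V^*)$ is a linear differential operator which, together with its formal adjoint, is Green hyperbolic with respect to $C$. **Variational system.** Let $F\to M$ be a vector bundle and let $L$, $\mathrm{EL}$, $\theta$ be local expressions (Lagrangian density, Euler–Lagrange operator $\Gamma(F)\to\Gamma(\tilde F^*)$,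 presymplectic potential current, an $(n-1)$-form linear in the variation) with $\delta_\psi L[\phi]=\mathrm{EL}[\phi]\cdot\psi+d\theta[\phi;\psi]$. Let $\phi$ be a solution, $\mathrm{EL}[\phi]=0$, let $\mathrm J\colon\Gamma(F)\to\Gamma(\tilde F^*)$ be the Jacobi operator (linearization of $\mathrm{EL}$ at $\phi$), and let $\omega[\psi,\xi]=\delta_\psi\theta[\phi;\xi]-\delta_\xi\theta[\phi;\psi]$. **Hyperbolization.** Assume that the Jacobi system is hyperbolizable at $\phi$, that is, there are given vector bundles $E',E,P,P',E_g$ and linear differential operators as follows. (a) Operators $f$, $h'$, $h$, $k$, $k'$ on $F$, $E'$, $E$, $P$, $P'$ that are hyperbolic, and $$\Gamma(E')\xrightarrow{c'}\Gamma(F)\xrightarrow{c}\Gamma(E),\quad \Gamma(\tilde E'^*)\xrightarrow{q'}\Gamma(\tilde F^*)\xrightarrow{q}\Gamma(\tilde E^*),\quad f c'=q'h',\ h c=q f,$$ $$\Gamma(P)\xrightarrow{g}\Gamma(F)\xrightarrow{g'}\Gamma(P'),\quad \Gamma(\tilde P^*)\xrightarrow{s}\Gamma(\tilde F^*)\xrightarrow{s'}\Gamma(\tilde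 P'^*),\quad f g=s k,\ k' g'=s' f,$$ where all four sequences and their four formally adjoint sequences are formally exact complexes ($c$: constraints; $g$: gauge transformations), and $\mathrm J\circ g=0$. (b) A gauge fixing $c_g\colon\Gamma(F)\to\Gamma(E_g)$ with $\mathrm J=rf+r_cc$, $c_g=r_gc$, $f=\bar r\mathrm J+\bar r_cc_g$, $c=\bar r_{\mathrm J}\mathrm J+\bar r_gc_g$, where $r\bar r+r_c\bar r_{\mathrm J}=\mathrm{id}+p_{\mathrm J}g^*$ and $q\bar r-h\bar r_{\mathrm J}=q_{\mathrm J}g^*$ for some differential operators $r,r_c,r_g,\bar r,\bar r_c,\bar r_{\mathrm J},\bar r_g,p_{\mathrm J},q_{\mathrm J}$. (c) The compatibility $s'\circ\bar r_c\circ c_g=0$. Assume moreover: - (*global parametrizability of the constraints*) for a Green form $G$ of $f$, the pairing $\int_\Sigma G[\psi,\xi]$ between $\{\psi\in\Gamma_{SC}(F): f\psi=0,\ c\psi=0\}\big/c'\{\zeta\in\Gamma_{SC}(E'):h'\zeta=0\}$ and $\{\xi\in\Gamma_{SC}(F): f^*\xi=0,\ q'^*\xi=0\}\big/q^*\{\zeta\in\Gamma_{SC}(E):h^*\zeta=0\}$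 is non-degenerate in both arguments; - (*global recognizability of the gauge transformations*) the pairing $\int_M\psi\cdot\tilde\alpha^*$ between $\{\psi\in\Gamma_{SC}(F):g'\psi=0\}/g\,\Gamma_{SC}(P)$ and $\{\tilde\alpha^*\in\Gamma_0(\tilde F^*):g^*\tilde\alpha^*=0\}/g'^*\Gamma_0(\tilde P'^*)$ is non-degenerate in both arguments. **Tangent and cotangent spaces.** $T_\phi\bar{\mathcal S}$ is the space of $\psi\in\Gamma_{SC}(F)$ with $f\psi=0$, $c\psi=0$, modulo those of the form $g\varepsilon$, $\varepsilon\in\Gamma_{SC}(P)$. $T^*_\phi\bar{\mathcal S}$ is the space of $\tilde\alpha^*\in\Gamma_0(\tilde F^*)$ with $g^*\tilde\alpha^*=g^*(f^*\xi+c^*\tilde\varepsilon^*)$ for some $\xi\in\Gamma_0(F)$, $\tilde\varepsilon^*\in\Gamma_0(\tilde E^*)$, modulo $f^*\Gamma_0(F)+c^*\Gamma_0(\tilde E^*)$. They are paired by $\langle[\psi],[\tilde\alpha^*]\rangle=\int_M\psi\cdot\tilde\alpha^*$. **Theorem.** Under these assumptions: 1. there is a unique linear map $\bar\Omega\colon T_\phi\bar{\mathcal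 S}\to T^*_\phi\bar{\mathcal S}$ (the reduced presymplectic form) with $\langle[\xi],\bar\Omega[\psi]\rangle=\int_\Sigma\omega[\xi,\psi]$ for all $[\xi],[\psi]\in T_\phi\bar{\mathcal S}$, where the value may be computed with any representatives; 2. there is a unique linear map $\Pi\colon T^*_\phi\bar{\mathcal S}\to T_\phi\bar{\mathcal S}$ (the Peierls bivector) with $\Pi[\tilde\alpha^*]=[\mathrm E\tilde\alpha^*]$, $\mathrm E=\mathrm G\circ\bar r$ ($\mathrm G$ the causal Green function of $f$), for all $\tilde\alpha^*\in\Gamma_0(\tilde F^*)$ with $g^*\tilde\alpha^*=0$ (in particular $\mathrm E\tilde\alpha^*$ is then a linearized solution in $\Gamma_{SC}(F)$); 3. they are two-sided inverses of each other: $\bar\Omega\,\Pi=\mathrm{id}$ on $T^*_\phi\bar{\mathcal S}$ and $\Pi\,\bar\Omega=\mathrm{id}$ on $T_\phi\bar{\mathcal S}$. -/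

import Mathlib

open Set Filter Topology Bundle Manifold MeasureTheory
open scoped ContDiff

universe u v w

namespace Peierls

/-- The model space of a spacetime of dimension `n = d + 1 ≥ 1`. -/
abbrev Model (d : ℕ) : Type := EuclideanSpace ℝ (Fin (d + 1))

/-! ### Vector bundles, sections, dual bundles -/

section Bundles

/-- A smooth real vector bundle of finite rank over the manifold `M`. -/
structure VB (d : ℕ) (M : Type u) [TopologicalSpace M] [ChartedSpace (Model d) M] where
  Fib : Type v
  Fiber : M → Type v
  [normedAddCommGroup : NormedAddCommGroup Fib]
  [normedSpace : NormedSpace ℝ Fib]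
  [finiteDimensional : FiniteDimensional ℝ Fib]
  [addCommGroup : ∀ x, AddCommGroup (Fiber x)]
  [module : ∀ x, Module ℝ (Fiber x)]
  [topologicalSpace : ∀ x, TopologicalSpace (Fiber x)]
  [isTopologicalAddGroup : ∀ x, IsTopologicalAddGroup (Fiber x)]
  [continuousSMul : ∀ x, ContinuousSMul ℝ (Fiber x)]
  [totalTopology : TopologicalSpace (TotalSpace Fib Fiber)]
  [fiberBundle : FiberBundle Fib Fiber]
  [vectorBundle : VectorBundle ℝ Fib Fiber]
  [smoothBundle : ContMDiffVectorBundle ∞ Fib Fiber 𝓘(ℝ, Model d)]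

attribute [instance] VB.normedAddCommGroup VB.normedSpace VB.finiteDimensional VB.addCommGroup
  VB.module VB.topologicalSpace VB.isTopologicalAddGroup VB.continuousSMul VB.totalTopology
  VB.fiberBundle VB.vectorBundle VB.smoothBundle

variable {d : ℕ} {M : Type u} [TopologicalSpace M] [ChartedSpace (Model d) M]

/-- The space `Γ(V)` of smooth sections. -/
abbrev Sec (V : VB.{u, v} d M) : Type (max u v) :=
  ContMDiffSection 𝓘(ℝ, Model d) V.Fib ∞ V.Fiber

/-- The densitized dual bundle.  A smooth positive density `μ` on `M` is fixed throughout, and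
`V^* ⊗ Λⁿ M` is identified with `V^*` by `α ⊗ μ ↔ α`; under this identification `V.dual` is the
densitized dual bundle of `V` and its sections are the dual densities. -/
@[reducible]
noncomputable def VB.dual (V : VB.{u, v} d M) : VB.{u, v} d M where
  Fib := V.Fib →L[ℝ] ℝ
  Fiber := fun x => V.Fiber x →L[ℝ] ℝ

/-- The trivial real line bundle. -/
@[reducible]
noncomputable def VB.line (d : ℕ) (M : Type u) [TopologicalSpace M] [ChartedSpace (Model d) M] :
    VB.{u, 0} d M where
  Fib := ℝ
  Fiber := Bundle.Trivial M ℝ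

/-- The tangent bundle.  With the density `μ` fixed, a vector field `X` stands for the
`(n-1)`-form `ι_X μ`. -/
@[reducible]
noncomputable def VB.tangent (d : ℕ) (M : Type u) [TopologicalSpace M] [ChartedSpace (Model d) M]
    [IsManifold 𝓘(ℝ, Model d) ∞ M] : VB.{u, 0} d M where
  Fib := Model d
  Fiber := fun x : M => TangentSpace 𝓘(ℝ, Model d) x
  smoothBundle := by
    have : IsManifold 𝓘(ℝ, Model d) (∞ + 1) M := by
      simpa using (inferInstance : IsManifold 𝓘(ℝ, Model d) ∞ M)
    exact TangentBundle.contMDiffVectorBundle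

/-- The pointwise pairing `ψ · α` of a section with a dual density (as a function times `μ`). -/
noncomputable def ev {V : VB.{u, v} d M} (s : Sec V) (a : Sec V.dual) : M → ℝ := fun x => a x (s x)

/-- The same pairing with the arguments exchanged. -/
noncomputable def ev' {V : VB.{u, v} d M} (a : Sec V.dual) (s : Sec V) : M → ℝ := fun x => a x (s x)

/-! ### Jets and differential operators -/

/-- The coordinate representation of a section near `x₀`, in the preferred chart and the preferred
trivialization at `x₀`. -/
noncomputable def locRep {V : VB.{u, v} d M} (x₀ : M) (s : Sec V) : Model d → V.Fib := fun y =>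
  (trivializationAt V.Fib V.Fiber x₀
    ⟨(chartAt (Model d) x₀).symm y, s ((chartAt (Model d) x₀).symm y)⟩).2

/-- The (open) coordinate domain at `x₀` on which the preferred trivialization of `V` is defined. -/
def locDom (V : VB.{u, v} d M) (x₀ : M) : Set (Model d) :=
  {y | y ∈ (chartAt (Model d) x₀).target ∧
    (chartAt (Model d) x₀).symm y ∈ (trivializationAt V.Fib V.Fiber x₀).baseSet}

/-- The fibre coordinates of the `k`-jets of functions with values in `A`. -/
abbrev JetFib (d k : ℕ) (A : Type v) [NormedAddCommGroup A] [NormedSpace ℝ A] : Type v :=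
  (i : Fin (k + 1)) → ContinuousMultilinearMap ℝ (fun _ : Fin (i : ℕ) => Model d) A

/-- The derivatives up to order `k` at `y` of a function `u`. -/
noncomputable def jetCoord {A : Type v} [NormedAddCommGroup A] [NormedSpace ℝ A] (k : ℕ)
    (u : Model d → A) (y : Model d) : JetFib d k A :=
  fun i => iteratedFDeriv ℝ (i : ℕ) u y

/-- The `k`-jet of the section `s` at `x` vanishes. -/
def JetZero {V : VB.{u, v} d M} (k : ℕ) (x : M) (s : Sec V) : Prop :=
  jetCoord k (locRep x s) (chartAt (Model d) x x) = 0

/-- `D` is a (possibly non-linear) differential operator of order at most `k`: in local coordinates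
`D[s]` is a smooth function of the point and of the derivatives of `s` up to order `k`. -/
def HasOrder {V : VB.{u, v} d M} {W : VB.{u, w} d M} (k : ℕ) (D : Sec V → Sec W) : Prop :=
  ∀ x₀ : M, ∃ ℓ : Model d × JetFib d k V.Fib → W.Fib,
    ContDiffOn ℝ ∞ ℓ ((locDom V x₀ ∩ locDom W x₀) ×ˢ univ) ∧
    ∀ s : Sec V, ∀ y ∈ locDom V x₀ ∩ locDom W x₀,
      locRep x₀ (D s) y = ℓ (y, jetCoord k (locRep x₀ s) y)

/-- `D` is a differential operator (of some finite order). -/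
def IsDiffOp {V : VB.{u, v} d M} {W : VB.{u, w} d M} (D : Sec V → Sec W) : Prop :=
  ∃ k, HasOrder k D

/-- `D` is a differential operator (of some finite order) in two arguments. -/
def IsBiDiffOp {V₁ : VB.{u, v} d M} {V₂ : VB.{u, w} d M} {W : VB.{u, 0} d M}
    (D : Sec V₁ → Sec V₂ → Sec W) : Prop :=
  ∃ k, ∀ x₀ : M, ∃ ℓ : Model d × JetFib d k V₁.Fib × JetFib d k V₂.Fib → W.Fib,
    ContDiffOn ℝ ∞ ℓ ((locDom V₁ x₀ ∩ locDom V₂ x₀ ∩ locDom W x₀) ×ˢ univ) ∧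
    ∀ (s : Sec V₁) (t : Sec V₂), ∀ y ∈ locDom V₁ x₀ ∩ locDom V₂ x₀ ∩ locDom W x₀,
      locRep x₀ (D s t) y = ℓ (y, jetCoord k (locRep x₀ s) y, jetCoord k (locRep x₀ t) y)

/-- The sequence `Γ(V) → Γ(W) → Γ(X)` of differential operators is a formally exact complex:
`b ∘ a = 0` and, with `l` the order of `b`, for all `s` and all points `x` the induced sequences
of jet spaces `J^{s+l+k}_x V → J^{s+l}_x W → J^s_x X` are exact. -/
def FormallyExact {V : VB.{u, v} d M} {W : VB.{u, v} d M} {X : VB.{u, v} d M}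
    (a : Sec V →ₗ[ℝ] Sec W) (b : Sec W →ₗ[ℝ] Sec X) : Prop :=
  b ∘ₗ a = 0 ∧ ∃ l, HasOrder l b ∧ ∀ (s : ℕ) (x : M) (φ : Sec W),
    JetZero s x (b φ) → ∃ ψ : Sec V, JetZero (s + l) x (φ - a ψ)

end Bundles

/-! ### Densities, divergence, flux through a hypersurface, formal adjoints -/

section Forms

variable {d : ℕ} {M : Type u} [TopologicalSpace M] [ChartedSpace (Model d) M]

/-- A smooth positive density on `M`: a measure which in each chart `e` of the smooth structure is
given by a smooth positive density `dens e` with respect to Lebesgue measure. -/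
structure SmoothDensity (d : ℕ) (M : Type u) [TopologicalSpace M] [ChartedSpace (Model d) M]
    [MeasurableSpace M] where
  meas : Measure M
  dens : OpenPartialHomeomorph M (Model d) → Model d → ℝ
  smooth : ∀ e ∈ IsManifold.maximalAtlas 𝓘(ℝ, Model d) ∞ M, ContDiffOn ℝ ∞ (dens e) e.target
  pos : ∀ e ∈ IsManifold.maximalAtlas 𝓘(ℝ, Model d) ∞ M, ∀ y ∈ e.target, 0 < dens e y
  map_eq : ∀ e ∈ IsManifold.maximalAtlas 𝓘(ℝ, Model d) ∞ M,
    (meas.restrict e.source).map e =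
      (volume.restrict e.target).withDensity (fun y => ENNReal.ofReal (dens e y))

/-- The components of a tangent vector at `p` in the chart `e`. -/
noncomputable def chartVec (e : OpenPartialHomeomorph M (Model d)) (p : M)
    (v : TangentSpace 𝓘(ℝ, Model d) p) : Model d :=
  mfderiv 𝓘(ℝ, Model d) 𝓘(ℝ, Model d) e p v

/-- The components of a vector field in the chart `e`, at the point with coordinates `y`. -/
noncomputable def vecComp (e : OpenPartialHomeomorph M (Model d))
    (X : (x : M) → TangentSpace 𝓘(ℝ, Model d) x) (y : Model d) : Model d :=
  chartVec e (e.symm y) (X (e.symm y))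

variable [MeasurableSpace M]

/-- `ρ` is the divergence of `X`, i.e. `d (ι_X μ) = ρ μ`; in each chart, with `m` the density of
`μ`, this reads `m ρ = ∑ᵢ ∂ᵢ (m Xⁱ)`. -/
def IsDivergence (μ : SmoothDensity d M) (X : (x : M) → TangentSpace 𝓘(ℝ, Model d) x)
    (ρ : M → ℝ) : Prop :=
  ∀ e ∈ IsManifold.maximalAtlas 𝓘(ℝ, Model d) ∞ M, ∀ p ∈ e.source,
    μ.dens e (e p) * ρ p =
      ∑ i : Fin (d + 1),
        fderiv ℝ (fun y => μ.dens e y * vecComp e X y i) (e p) (EuclideanSpace.single i 1)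

/-- `D` and `D'` are mutually (formally) adjoint with respect to the pairings `pV` and `pW`: there
is a Green form `G`, a bilinear bidifferential operator with values in `(n-1)`-forms, such that
`D[φ] · ψ - φ · D'[ψ] = d G[φ, ψ]`. -/
def IsGreenForm [IsManifold 𝓘(ℝ, Model d) ∞ M] (μ : SmoothDensity d M)
    {V V' : VB.{u, v} d M} {W W' : VB.{u, v} d M}
    (pV : Sec V → Sec V' → M → ℝ) (pW : Sec W → Sec W' → M → ℝ)
    (D : Sec V →ₗ[ℝ] Sec W) (D' : Sec W' →ₗ[ℝ] Sec V')
    (G : Sec V →ₗ[ℝ] Sec W' →ₗ[ℝ] Sec (VB.tangent d M)) : Prop :=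
  IsBiDiffOp (fun φ ψ => G φ ψ) ∧
  ∀ φ ψ, IsDivergence μ (fun x => G φ ψ x) (fun x => pW (D φ) ψ x - pV φ (D' ψ) x)

/-- `D` and `D'` are differential operators which are mutually adjoint with respect to the pairings
`pV` and `pW`. -/
def AreAdjoint [IsManifold 𝓘(ℝ, Model d) ∞ M] (μ : SmoothDensity d M)
    {V V' : VB.{u, v} d M} {W W' : VB.{u, v} d M}
    (pV : Sec V → Sec V' → M → ℝ) (pW : Sec W → Sec W' → M → ℝ)
    (D : Sec V →ₗ[ℝ] Sec W) (D' : Sec W' →ₗ[ℝ] Sec V') : Prop :=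
  IsDiffOp D ∧ IsDiffOp D' ∧ ∃ G, IsGreenForm μ pV pW D D' G

end Forms

/-! ### Conal causal structure -/

section Causal

variable {d : ℕ} {M : Type u} [TopologicalSpace M] [ChartedSpace (Model d) M]
  [IsManifold 𝓘(ℝ, Model d) ∞ M]

/-- A chronal cone bundle: a field of proper (non-empty, open, convex, salient) cones of future
directed timelike vectors, depending continuously on the point.  The last condition is equivalent
to the openness of the dual bundle of spacelike covectors. -/
structure ChronalCone (d : ℕ) (M : Type u) [TopologicalSpace M] [ChartedSpace (Model d) M]
    [IsManifold 𝓘(ℝ, Model d) ∞ M] where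
  cone : (x : M) → Set (TangentSpace 𝓘(ℝ, Model d) x)
  nonempty : ∀ x, (cone x).Nonempty
  convex : ∀ x, Convex ℝ (cone x)
  smul_mem : ∀ x, ∀ v ∈ cone x, ∀ a : ℝ, 0 < a → a • v ∈ cone x
  salient : ∀ x, ∀ v ∈ closure (cone x), -v ∈ closure (cone x) → v = 0
  isOpen : IsOpen {p : TangentBundle 𝓘(ℝ, Model d) M | p.2 ∈ cone p.1}
  isClosed_closure : IsClosed {p : TangentBundle 𝓘(ℝ, Model d) M | p.2 ∈ closure (cone p.1)}

/-- The velocity of a curve. -/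
noncomputable def velocity (γ : ℝ → M) (t : ℝ) : TangentSpace 𝓘(ℝ, Model d) (γ t) :=
  mfderiv 𝓘(ℝ, ℝ) 𝓘(ℝ, Model d) γ t (1 : ℝ)

/-- `x ≪ y`: there is a smooth future directed timelike curve from `x` to `y`. -/
def Chron (C : ChronalCone d M) (x y : M) : Prop :=
  ∃ γ : ℝ → M, ContMDiff 𝓘(ℝ, ℝ) 𝓘(ℝ, Model d) ∞ γ ∧
    (∀ t ∈ Icc (0 : ℝ) 1, velocity γ t ∈ C.cone (γ t)) ∧ γ 0 = x ∧ γ 1 = y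

/-- `I⁺(N)`. -/
def chronFuture (C : ChronalCone d M) (N : Set M) : Set M := {y | ∃ x ∈ N, Chron C x y}

/-- `I⁻(N)`. -/
def chronPast (C : ChronalCone d M) (N : Set M) : Set M := {y | ∃ x ∈ N, Chron C y x}

/-- `I(N) = I⁺(N) ∪ I⁻(N) ∪ N`. -/
def chronInfl (C : ChronalCone d M) (N : Set M) : Set M := chronFuture C N ∪ chronPast C N ∪ N

/-- `γ` is a future directed causal curve on the interval `J`: it is continuous, locally Lipschitz
in charts, and almost everywhere its velocity is a non-zero vector in the closed cone.  (As usual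
for limits of timelike curves, causal curves need not be `C¹`; smooth causal curves are included.)
-/
def IsCausalCurveOn (C : ChronalCone d M) (γ : ℝ → M) (J : Set ℝ) : Prop :=
  ContinuousOn γ J ∧
  (∀ t ∈ J, ∃ K, ∃ N ∈ 𝓝[J] t, LipschitzOnWith K (fun τ => chartAt (Model d) (γ t) (γ τ)) N) ∧
  ∀ᵐ t ∂(volume.restrict J), MDifferentiableAt 𝓘(ℝ, ℝ) 𝓘(ℝ, Model d) γ t ∧
    velocity (d := d) γ t ∈ closure (C.cone (γ t)) ∧ velocity (d := d) γ t ≠ 0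

/-- `e` is a slice chart for `S`: a chart in which `S` is the hyperplane `{y₀ = 0}`. -/
def IsSliceChart (S : Set M) (e : OpenPartialHomeomorph M (Model d)) : Prop :=
  e ∈ IsManifold.maximalAtlas 𝓘(ℝ, Model d) ∞ M ∧ ∀ p ∈ e.source, p ∈ S ↔ e p 0 = 0

/-- `S` is a Cauchy surface: a smooth codimension one submanifold which is acausal and meets every
inextensible causal curve exactly once.  (An inextensible curve is parametrized by `ℝ`.) -/
structure IsCauchySurface (C : ChronalCone d M) (S : Set M) : Prop where
  smooth : ∀ p ∈ S, ∃ e, IsSliceChart (d := d) S e ∧ p ∈ e.source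
  acausal : ∀ (γ : ℝ → M) (a b : ℝ), a < b → IsCausalCurveOn C γ (Icc a b) →
    ¬ (γ a ∈ S ∧ γ b ∈ S)
  meets : ∀ γ : ℝ → M, IsCausalCurveOn C γ univ → (∀ p, ¬ Tendsto γ atTop (𝓝 p)) →
    (∀ p, ¬ Tendsto γ atBot (𝓝 p)) → ∃! t, γ t ∈ S

/-- `e` is a slice chart for `S` whose coordinate `y₀` increases towards the future along `S`. -/
def IsFutureSliceChart (C : ChronalCone d M) (S : Set M) (e : OpenPartialHomeomorph M (Model d)) :
    Prop :=
  IsSliceChart S e ∧ ∀ p ∈ e.source, p ∈ S → ∀ v ∈ C.cone p,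
    0 < chartVec e p v 0

/-- The point `(0, y)` of the model space. -/
noncomputable def slicePt (y : Fin d → ℝ) : Model d := WithLp.toLp 2 (Fin.cons 0 y)

variable [MeasurableSpace M]

/-- `∫_S ι_X μ` for a field `X` supported in the domain of the slice chart `e`: since
`ι_X μ` restricts to `X⁰ m dy¹ ⋯ dy^d` on `{y₀ = 0}`, this is `∫ X⁰(0, y) m(0, y) dy`. -/
noncomputable def localFlux (μ : SmoothDensity d M) (e : OpenPartialHomeomorph M (Model d))
    (X : (x : M) → TangentSpace 𝓘(ℝ, Model d) x) : ℝ :=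
  ∫ y in {y : Fin d → ℝ | slicePt y ∈ e.target},
    vecComp e X (slicePt y) 0 * μ.dens e (slicePt y)

/-- The integral `∫_S ι_X μ` over the future oriented hypersurface `S` of the `(n-1)`-form `ι_X μ`,
whose restriction to `S` has compact support, has the value `a`: it is computed by a partition of
unity subordinate to slice charts. -/
def HasFlux (μ : SmoothDensity d M) (C : ChronalCone d M) (S : Set M)
    (X : (x : M) → TangentSpace 𝓘(ℝ, Model d) x) (a : ℝ) : Prop :=
  ∃ (N : ℕ) (e : Fin N → OpenPartialHomeomorph M (Model d)) (ρ : Fin N → M → ℝ),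
    (∀ i, IsFutureSliceChart C S (e i)) ∧
    (∀ i, ContMDiff 𝓘(ℝ, Model d) 𝓘(ℝ, ℝ) ∞ (ρ i)) ∧
    (∀ i, HasCompactSupport (ρ i)) ∧ (∀ i, tsupport (ρ i) ⊆ (e i).source) ∧
    (∀ p ∈ S, X p ≠ 0 → ∑ i, ρ i p = 1) ∧
    a = ∑ i, localFlux μ (e i) (fun x => ρ i x • X x)

end Causal

/-! ### Sections with restricted supports, Green hyperbolicity -/

section Supports

variable {d : ℕ} {M : Type u} [TopologicalSpace M] [ChartedSpace (Model d) M]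

/-- The support of a section. -/
def supp {V : VB.{u, v} d M} (s : Sec V) : Set M := closure {x | s x ≠ 0}

theorem supp_zero {V : VB.{u, v} d M} : supp (0 : Sec V) = ∅ := by
  simp [supp]

theorem supp_add {V : VB.{u, v} d M} (s t : Sec V) : supp (s + t) ⊆ supp s ∪ supp t := by
  unfold supp
  rw [← closure_union]
  refine closure_mono fun x hx => ?_
  by_contra h
  simp only [mem_union, mem_ofPred_eq, not_or, not_not] at h
  exact hx (by simp [h.1, h.2])

theorem supp_smul {V : VB.{u, v} d M} (c : ℝ) (s : Sec V) : supp (c • s) ⊆ supp s := by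
  refine closure_mono fun x hx => ?_
  intro h
  exact hx (by simp [h])

/-- The sections with compact support, `Γ₀(V)`. -/
def Sec₀ (V : VB.{u, v} d M) : Submodule ℝ (Sec V) where
  carrier := {s | ∃ K, IsCompact K ∧ supp s ⊆ K}
  zero_mem' := ⟨∅, isCompact_empty, by rw [supp_zero]⟩
  add_mem' := by
    rintro s t ⟨K, hK, hs⟩ ⟨L, hL, ht⟩
    exact ⟨K ∪ L, hK.union hL, (supp_add s t).trans (union_subset_union hs ht)⟩
  smul_mem' := by
    rintro c s ⟨K, hK, hs⟩
    exact ⟨K, hK, (supp_smul c s).trans hs⟩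

variable [IsManifold 𝓘(ℝ, Model d) ∞ M]

theorem chronFuture_mono (C : ChronalCone d M) : Monotone (chronFuture C) :=
  fun _ _ h _ ⟨x, hx, hxy⟩ => ⟨x, h hx, hxy⟩

theorem chronPast_mono (C : ChronalCone d M) : Monotone (chronPast C) :=
  fun _ _ h _ ⟨x, hx, hxy⟩ => ⟨x, h hx, hxy⟩

theorem chronInfl_mono (C : ChronalCone d M) : Monotone (chronInfl C) := fun _ _ h =>
  union_subset_union (union_subset_union (chronFuture_mono C h) (chronPast_mono C h)) h

/-- The sections whose support is contained in the closure of `T(K)` for some compact `K`. -/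
def SecWithin (T : Set M → Set M) (hT : Monotone T) (V : VB.{u, v} d M) :
    Submodule ℝ (Sec V) where
  carrier := {s | ∃ K, IsCompact K ∧ supp s ⊆ closure (T K)}
  zero_mem' := ⟨∅, isCompact_empty, by rw [supp_zero]; exact empty_subset _⟩
  add_mem' := by
    rintro s t ⟨K, hK, hs⟩ ⟨L, hL, ht⟩
    refine ⟨K ∪ L, hK.union hL, (supp_add s t).trans (union_subset ?_ ?_)⟩
    · exact hs.trans (closure_mono (hT subset_union_left))
    · exact ht.trans (closure_mono (hT subset_union_right))
  smul_mem' := by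
    rintro c s ⟨K, hK, hs⟩
    exact ⟨K, hK, (supp_smul c s).trans hs⟩

/-- The sections with retarded support, `Γ₊(V)`. -/
def SecRet (C : ChronalCone d M) (V : VB.{u, v} d M) : Submodule ℝ (Sec V) :=
  SecWithin (chronFuture C) (chronFuture_mono C) V

/-- The sections with advanced support, `Γ₋(V)`. -/
def SecAdv (C : ChronalCone d M) (V : VB.{u, v} d M) : Submodule ℝ (Sec V) :=
  SecWithin (chronPast C) (chronPast_mono C) V

/-- The sections with spacelike compact support, `Γ_SC(V)`. -/
def SecSC (C : ChronalCone d M) (V : VB.{u, v} d M) : Submodule ℝ (Sec V) :=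
  SecWithin (chronInfl C) (chronInfl_mono C) V

/-- Unique solvability of `f[φ] = α` with sources and solutions in the spaces `A` and `B`, and with
the support of the solution inside the closure of `T(supp α)`. -/
def UniquelySolvable {V W : VB.{u, v} d M} (f : Sec V →ₗ[ℝ] Sec W) (A : Submodule ℝ (Sec W))
    (B : Submodule ℝ (Sec V)) (T : Set M → Set M) : Prop :=
  ∀ α ∈ A, (∃ φ ∈ B, f φ = α ∧ supp φ ⊆ closure (T (supp α))) ∧
    ∀ φ ∈ B, ∀ ψ ∈ B, f φ = α → f ψ = α → φ = ψ

/-- `f` is Green hyperbolic with respect to the causal structure `C`. -/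
def GreenHyperbolic (C : ChronalCone d M) {V W : VB.{u, v} d M} (f : Sec V →ₗ[ℝ] Sec W) : Prop :=
  UniquelySolvable f (SecRet C W) (SecRet C V) (chronFuture C) ∧
  UniquelySolvable f (SecAdv C W) (SecAdv C V) (chronPast C)

open Classical in
/-- The solution in `B` of `f[φ] = α`. -/
noncomputable def solveIn {V W : VB.{u, v} d M} (f : Sec V →ₗ[ℝ] Sec W)
    (B : Submodule ℝ (Sec V)) (α : Sec W) : Sec V :=
  if h : ∃ φ ∈ B, f φ = α then h.choose else 0

/-- The causal Green function `G = G₊ - G₋`, with `G₊`, `G₋` the retarded and advanced ones. -/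
noncomputable def causalGreen (C : ChronalCone d M) {V W : VB.{u, v} d M}
    (f : Sec V →ₗ[ℝ] Sec W) (α : Sec W) : Sec V :=
  solveIn f (SecRet C V) α - solveIn f (SecAdv C V) α

end Supports

/-! ### Variational systems -/

section Variational

variable {d : ℕ} {M : Type u} [TopologicalSpace M] [ChartedSpace (Model d) M]
  [IsManifold 𝓘(ℝ, Model d) ∞ M] [MeasurableSpace M]

/-- A variational system on the field bundle `F`: a local Lagrangian density `L μ`, its
Euler-Lagrange operator `EL` and a presymplectic potential current density `θ`, related by the
first variation formula `δ_ψ L[φ] = EL[φ] · ψ + d θ[φ; ψ]`. -/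
structure VariationalSystem (μ : SmoothDensity d M) (F : VB.{u, v} d M) where
  L : Sec F → Sec (VB.line d M)
  EL : Sec F → Sec F.dual
  θ : Sec F → Sec F →ₗ[ℝ] Sec (VB.tangent d M)
  L_diffOp : IsDiffOp L
  EL_diffOp : IsDiffOp EL
  θ_diffOp : IsBiDiffOp (fun φ ψ => θ φ ψ)
  first_variation : ∀ φ ψ : Sec F, IsDivergence μ (fun x => θ φ ψ x)
    (fun x => deriv (fun t : ℝ => (L (φ + t • ψ) x : ℝ)) 0 - ev ψ (EL φ) x)

/-- `J` is the Jacobi operator at `φ`, the linearization of the Euler-Lagrange operator. -/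
def VariationalSystem.IsJacobi {μ : SmoothDensity d M} {F : VB.{u, v} d M}
    (S : VariationalSystem μ F) (φ : Sec F) (J : Sec F →ₗ[ℝ] Sec F.dual) : Prop :=
  ∀ (ψ ξ : Sec F) (x : M), HasDerivAt (fun t : ℝ => ev ξ (S.EL (φ + t • ψ)) x) (ev ξ (J ψ) x) 0

/-- The presymplectic current density `ω = d_v θ`, evaluated at the background `φ` on the linearized
fields `ψ`, `ξ`: `ω[ψ, ξ] = δ_ψ θ[φ; ξ] - δ_ξ θ[φ; ψ]`. -/
noncomputable def VariationalSystem.current {μ : SmoothDensity d M} {F : VB.{u, v} d M}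
    (S : VariationalSystem μ F) (φ ψ ξ : Sec F) (x : M) : TangentSpace 𝓘(ℝ, Model d) x :=
  deriv (fun t : ℝ => S.θ (φ + t • ψ) ξ x) 0 - deriv (fun t : ℝ => S.θ (φ + t • ξ) ψ x) 0

end Variational

/-! ### Hyperbolization -/

section Hyperbolization

variable {d : ℕ} {M : Type u} [TopologicalSpace M] [ChartedSpace (Model d) M]
  [IsManifold 𝓘(ℝ, Model d) ∞ M] [MeasurableSpace M]

/-- A linear hyperbolic differential operator `Γ(V) → Γ(Ṽ^*)` with its formal adjoint; both are
Green hyperbolic with respect to the causal structure `C`. -/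
structure HypOp (μ : SmoothDensity d M) (C : ChronalCone d M) (V : VB.{u, v} d M) where
  op : Sec V →ₗ[ℝ] Sec V.dual
  adj : Sec V →ₗ[ℝ] Sec V.dual
  adjoint : AreAdjoint μ ev ev' op adj
  green : GreenHyperbolic C op
  green_adj : GreenHyperbolic C adj

/-- A linear differential operator `Γ(V) → Γ(W)` with its formal adjoint. -/
structure FieldOp (μ : SmoothDensity d M) (V W : VB.{u, v} d M) where
  op : Sec V →ₗ[ℝ] Sec W
  adj : Sec W.dual →ₗ[ℝ] Sec V.dual
  adjoint : AreAdjoint μ ev ev op adj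

/-- A linear differential operator `Γ(Ṽ^*) → Γ(W̃^*)` with its formal adjoint `Γ(W) → Γ(V)`. -/
structure DensOp (μ : SmoothDensity d M) (V W : VB.{u, v} d M) where
  op : Sec V.dual →ₗ[ℝ] Sec W.dual
  adj : Sec W →ₗ[ℝ] Sec V
  adjoint : AreAdjoint μ ev' ev' op adj

/-- The commutative diagram of differential operators
with upper row `a : Γ(A) → Γ(F)`, `b : Γ(F) → Γ(B)`, lower row `s : Γ(Ã^*) → Γ(F̃^*)`,
`t : Γ(F̃^*) → Γ(B̃^*)`, and hyperbolic vertical maps `k`, `f`, `l` from the upper to the lower row,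
whose rows and whose adjoint rows are formally exact complexes. -/
structure HypDiagram (μ : SmoothDensity d M) (C : ChronalCone d M) {F : VB.{u, v} d M}
    (f : HypOp μ C F) (A B : VB.{u, v} d M) where
  a : FieldOp μ A F
  b : FieldOp μ F B
  s : DensOp μ A F
  t : DensOp μ F B
  k : HypOp μ C A
  l : HypOp μ C B
  comm_left : f.op ∘ₗ a.op = s.op ∘ₗ k.op
  comm_right : l.op ∘ₗ b.op = t.op ∘ₗ f.op
  exact_field : FormallyExact a.op b.op
  exact_dens : FormallyExact s.op t.op
  exact_field_adj : FormallyExact b.adj a.adj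
  exact_dens_adj : FormallyExact t.adj s.adj

/-- A hyperbolization of the Jacobi system `J` with linearized gauge transformations: a gauge fixing
`c_g` such that the gauge fixed system `J ⊕ c_g` is equivalent to a hyperbolic system `f ⊕ c` with
parametrizable constraints `c`, with respect to which the gauge transformations `g` are
recognizable, and such that the gauge fixing compatibility condition holds.

In `constr` the row `Γ(E') → Γ(F) → Γ(E)` consists of `c'`, `c`, and `Γ(Ẽ'^*) → Γ(F̃^*) → Γ(Ẽ^*)`
of `q'`, `q`, with vertical maps `h'`, `f`, `h`; in `gauge` the row `Γ(P) → Γ(F) → Γ(P')` consists of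
`g`, `g'`, and `Γ(P̃^*) → Γ(F̃^*) → Γ(P̃'^*)` of `s`, `s'`, with vertical maps `k`, `f`, `k'`. -/
structure Hyperbolization (μ : SmoothDensity d M) (C : ChronalCone d M) {F : VB.{u, v} d M}
    (J : Sec F →ₗ[ℝ] Sec F.dual) where
  (E' E P P' Eg : VB.{u, v} d M)
  f : HypOp μ C F
  constr : HypDiagram μ C f E' E
  gauge : HypDiagram μ C f P P'
  gauge_invariance : J ∘ₗ gauge.a.op = 0
  /-- the gauge fixing operator -/
  cg : Sec F →ₗ[ℝ] Sec Eg
  (r rbar : Sec F.dual →ₗ[ℝ] Sec F.dual)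
  rc : Sec E →ₗ[ℝ] Sec F.dual
  rg : Sec E →ₗ[ℝ] Sec Eg
  rbarc : Sec Eg →ₗ[ℝ] Sec F.dual
  rbarJ : Sec F.dual →ₗ[ℝ] Sec E
  rbarg : Sec Eg →ₗ[ℝ] Sec E
  pJ : Sec P.dual →ₗ[ℝ] Sec F.dual
  qJ : Sec P.dual →ₗ[ℝ] Sec E.dual
  cg_diffOp : IsDiffOp cg
  r_diffOp : IsDiffOp r
  rbar_diffOp : IsDiffOp rbar
  rc_diffOp : IsDiffOp rc
  rg_diffOp : IsDiffOp rg
  rbarc_diffOp : IsDiffOp rbarc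
  rbarJ_diffOp : IsDiffOp rbarJ
  rbarg_diffOp : IsDiffOp rbarg
  pJ_diffOp : IsDiffOp pJ
  qJ_diffOp : IsDiffOp qJ
  /-- equivalence of `J ⊕ c_g` with `f ⊕ c` -/
  J_eq : J = r ∘ₗ f.op + rc ∘ₗ constr.b.op
  cg_eq : cg = rg ∘ₗ constr.b.op
  f_eq : f.op = rbar ∘ₗ J + rbarc ∘ₗ cg
  c_eq : constr.b.op = rbarJ ∘ₗ J + rbarg ∘ₗ cg
  /-- the operators effecting the equivalence are inverse up to the identity `g^* ∘ J = 0` -/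
  inverse : r ∘ₗ rbar + rc ∘ₗ rbarJ = LinearMap.id + pJ ∘ₗ gauge.a.adj
  /-- consistency of the identity `q ∘ f - h ∘ c = 0` with `g^* ∘ J = 0` -/
  consistency : constr.t.op ∘ₗ rbar - constr.l.op ∘ₗ rbarJ = qJ ∘ₗ gauge.a.adj
  /-- gauge fixing compatibility `s' ∘ r̄_c ∘ c_g = 0` -/
  compatibility : gauge.t.op ∘ₗ rbarc ∘ₗ cg = 0

namespace Hyperbolization

variable {μ : SmoothDensity d M} {C : ChronalCone d M} {F : VB.{u, v} d M}
  {J : Sec F →ₗ[ℝ] Sec F.dual} (H : Hyperbolization μ C J)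

/-- The constraints are globally parametrizable: the Green pairing `∫_S G[ψ, ξ]` between the
cohomologies in solutions
`{ψ ∈ Γ_SC(F) | f ψ = 0, c ψ = 0} / c' {ζ ∈ Γ_SC(E') | h' ζ = 0}` and
`{ξ ∈ Γ_SC(F) | f^* ξ = 0, q'^* ξ = 0} / q^* {ζ ∈ Γ_SC(E) | h^* ζ = 0}` is non-degenerate. -/
def GloballyParametrizable (S : Set M) : Prop :=
  ∃ G, IsGreenForm μ ev ev' H.f.op H.f.adj G ∧
    (∀ ψ ∈ SecSC C F, H.f.op ψ = 0 → H.constr.b.op ψ = 0 →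
      (∀ ξ ∈ SecSC C F, H.f.adj ξ = 0 → H.constr.s.adj ξ = 0 →
        HasFlux μ C S (fun x => G ψ ξ x) 0) →
      ∃ ζ ∈ SecSC C H.E', H.constr.k.op ζ = 0 ∧ ψ = H.constr.a.op ζ) ∧
    (∀ ξ ∈ SecSC C F, H.f.adj ξ = 0 → H.constr.s.adj ξ = 0 →
      (∀ ψ ∈ SecSC C F, H.f.op ψ = 0 → H.constr.b.op ψ = 0 →
        HasFlux μ C S (fun x => G ψ ξ x) 0) →
      ∃ ζ ∈ SecSC C H.E, H.constr.l.adj ζ = 0 ∧ ξ = H.constr.t.adj ζ)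

/-- The gauge transformations are globally recognizable: the natural pairing `∫_M ψ · α` between the
cohomologies `{ψ ∈ Γ_SC(F) | g' ψ = 0} / g Γ_SC(P)` and
`{α ∈ Γ₀(F̃^*) | g^* α = 0} / g'^* Γ₀(P̃'^*)` is non-degenerate. -/
def GloballyRecognizable : Prop :=
  (∀ ψ ∈ SecSC C F, H.gauge.b.op ψ = 0 →
    (∀ α ∈ Sec₀ F.dual, H.gauge.a.adj α = 0 → ∫ x, ev ψ α x ∂μ.meas = 0) →
    ∃ ε ∈ SecSC C H.P, ψ = H.gauge.a.op ε) ∧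
  (∀ α ∈ Sec₀ F.dual, H.gauge.a.adj α = 0 →
    (∀ ψ ∈ SecSC C F, H.gauge.b.op ψ = 0 → ∫ x, ev ψ α x ∂μ.meas = 0) →
    ∃ β ∈ Sec₀ H.P'.dual, α = H.gauge.b.adj β)

/-- The linearized solutions `{ψ ∈ Γ_SC(F) | f ψ = 0, c ψ = 0}`. -/
noncomputable def Sol : Submodule ℝ (Sec F) :=
  SecSC C F ⊓ LinearMap.ker H.f.op ⊓ LinearMap.ker H.constr.b.op

/-- The pure gauge sections `g ε`, `ε ∈ Γ_SC(P)`. -/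
noncomputable def PureGauge : Submodule ℝ (Sec F) := (SecSC C H.P).map H.gauge.a.op

/-- The formal gauge invariant solutions tangent space: linearized solutions modulo those of the
form `g ε` with `ε ∈ Γ_SC(P)`. -/
abbrev Tangent : Type (max u v) := ↥H.Sol ⧸ H.PureGauge.submoduleOf H.Sol

/-- The dual densities `f^* ξ + c^* ε` with `ξ ∈ Γ₀(F)`, `ε ∈ Γ₀(Ẽ^*)`. -/
noncomputable def Trivial : Submodule ℝ (Sec F.dual) :=
  (Sec₀ F).map H.f.adj ⊔ (Sec₀ H.E.dual).map H.constr.b.adj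

/-- The dual densities `α ∈ Γ₀(F̃^*)` with `g^* α = g^* (f^* ξ + c^* ε)` for some `ξ ∈ Γ₀(F)`,
`ε ∈ Γ₀(Ẽ^*)`. -/
noncomputable def GaugeInv : Submodule ℝ (Sec F.dual) :=
  Sec₀ F.dual ⊓ (H.Trivial.map H.gauge.a.adj).comap H.gauge.a.adj

/-- The formal gauge invariant solutions cotangent space. -/
abbrev Cotangent : Type (max u v) := ↥H.GaugeInv ⧸ H.Trivial.submoduleOf H.GaugeInv

/-- The Peierls causal Green function `E = G ∘ r̄`, with `G = G₊ - G₋` the causal Green function of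
`f`. -/
noncomputable def peierls (α : Sec F.dual) : Sec F := causalGreen C H.f.op (H.rbar α)

/-- The map `Π : [α] ↦ [E α]`, for representatives with `g^* α = 0`. -/
def IsPeierlsBivector (Pb : H.Cotangent →ₗ[ℝ] H.Tangent) : Prop :=
  ∀ α : H.GaugeInv, H.gauge.a.adj α = 0 → ∃ h : H.peierls α ∈ H.Sol,
    Pb (Submodule.Quotient.mk α) = Submodule.Quotient.mk ⟨H.peierls α, h⟩

/-- The linear map `Ω` from the tangent to the cotangent space represents the reduced presymplectic
form: `⟨[ξ], Ω [ψ]⟩ = ∫_S ω[ξ, ψ]`, where the left side is `∫_M ξ · α` for any representative `α` of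
`Ω [ψ]`. -/
def RepresentsSymplecticForm (V : VariationalSystem μ F) (φ : Sec F) (S : Set M)
    (Ω : H.Tangent →ₗ[ℝ] H.Cotangent) : Prop :=
  ∀ (ξ ψ : H.Sol) (α : H.GaugeInv),
    Ω (Submodule.Quotient.mk ψ) = Submodule.Quotient.mk α →
    HasFlux μ C S (V.current φ ξ ψ) (∫ x, ev (ξ : Sec F) (α : Sec F.dual) x ∂μ.meas)

end Hyperbolization

end Hyperbolization

end Peierls

open Peierls

/-!
The proof follows the geometry of the covariant phase space. Write `J` for the Jacobi operator and
`S` for the Cauchy surface; `C` is the cone field.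

*Causality.* The manifold is the disjoint union of `S`, its open future and its open past
(`IsCauchySurface.mem_cases`, `isOpen_pastOf`), and the part of the closed future of a compact set
which does not lie to the future of `S` is compact (`isCompact_closure_chronFuture_inter`). Both
facts are limit arguments for causal curves. The curves are normalized by a `1`-form which is
positive on the cones and dominates the differential of a proper function (`Clock`). The condition
`Clock.IsNormal` expresses causality through inequalities for smooth functions, so that pointwise
ultralimits of normalized curves are again normalized (`Clock.exists_ultralimit`), and normalized
curves are causal in the sense of Lipschitz curves (`Clock.IsNormal.isCausalCurveOn`). Consequently
a section with spacelike compact support is the sum of a retarded section and of an advanced one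
which vanishes to the future of `S` (`IsCauchySurface.exists_split`), and overlaps of retarded with
advanced supports are compact, so that adjoints may be integrated by parts there.

*Stokes.* The flux through `S` of a vector field whose support meets the closed past of `S` in a
compact set is the integral of its divergence over the past (`IsCauchySurface.hasFlux_iff`).

*The presymplectic form.* Differentiating the first variation formula once more shows that the
current `ω[ψ, ξ]` has divergence `ψ · J ξ - ξ · J ψ` (`VariationalSystem.exists_current`). Hence
`J` is formally self-adjoint, and `g^* J = 0` by gauge invariance. If `ψ₊` is the retarded part of
a linearized solution `ψ`, then `J ψ₊` has compact support, and Stokes gives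
`∫_S ω[ξ, ψ] = ∫ ξ · J ψ₊` for linearized solutions `ξ`. So the reduced form is `[ψ] ↦ [J ψ₊]`. It
is determined by its values because a compactly supported dual density `α` annihilating all
linearized solutions is trivial (`mem_Trivial_of_pairing`). Indeed, for the causal Green function
of `f^*`, the section `G α` pairs to zero with all solutions, whence `G α = q^* ζ` by
parametrizability of the constraints, and the retarded part of `ζ` turns the retarded solution of
`f^* ξ = α` into compactly supported data exhibiting `α` as trivial.

*The Peierls bivector.* If `g^* α = 0`, then the retarded and the advanced solution `χ₊`, `χ₋` of
`f χ = r̄ α` both solve `J χ = α` (`exists_peierls_parts`), so that `E α = χ₊ - χ₋` is a linearized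
solution. As `J` is self-adjoint, `E` is antisymmetric (`pairing_peierls`), hence `E α` pairs to
zero with gauge invariant densities if `α` is trivial, and recognizability of the gauge
transformations makes it a pure gauge section (`peierls_mem_PureGauge`).

*Inversion.* The decomposition `E α = χ₊ - χ₋` is one into a retarded and an advanced part, so the
reduced form maps `[E α]` to `[J χ₊] = [α]`. Conversely, `ψ - E J ψ₊` is annihilated by `g'`, by
the compatibility of the gauge fixing with `s'`, and pairs to zero with the kernel of `g^*`; by
recognizability it is a pure gauge section (`sub_peierls_mem_PureGauge`).
-/

namespace Peierls

variable {d : ℕ} {M : Type u} [TopologicalSpace M] [ChartedSpace (Model d) M]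
  [IsManifold 𝓘(ℝ, Model d) ∞ M]

set_option linter.unusedSectionVars false

/-! ### Cones and clocks -/

section
theorem exists_sec_eq [T2Space M] [SigmaCompactSpace M]
    (V : VB.{u, v} d M) (x : M) (v : V.Fiber x) : ∃ s : Sec V, s x = v := by
  classical
  obtain ⟨s, hs⟩ := exists_contMDiffSection_forall_mem_convex_of_local 𝓘(ℝ, Model d) (n := ⊤)
    (F_fiber := V.Fib) V.Fiber (fun y => {w | ∀ h : x = y, w = h ▸ v}) (fun y => by
      intro a ha b hb p q hp hq hpq
      rintro rfl
      rw [ha rfl, hb rfl, ← add_smul, hpq, one_smul]) (fun x₀ => by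
      by_cases h : x = x₀
      · subst h
        obtain ⟨U, hU, hs⟩ := FiberBundle.exists_contMDiffOn_extend (k := ∞) 𝓘(ℝ, Model d) V.Fib v
        refine ⟨U, hU, _, hs, ?_⟩
        rintro y hy rfl
        simp
      · refine ⟨{x}ᶜ, isOpen_compl_singleton.mem_nhds (by simpa using Ne.symm h), fun y => 0,
          ?_, ?_⟩
        · exact (Bundle.contMDiff_zeroSection ℝ V.Fiber).contMDiffOn
        · rintro y hy rfl
          exact absurd rfl hy)
  exact ⟨s, hs x rfl⟩

theorem contMDiff_ev {V : VB.{u, v} d M} (s : Sec V) (a : Sec V.dual) :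
    ContMDiff 𝓘(ℝ, Model d) 𝓘(ℝ, ℝ) ∞ (fun x => a x (s x)) := by
  have := ContMDiff.clm_bundle_apply (E₂ := Bundle.Trivial M ℝ) (F₂ := ℝ)
    (IB := 𝓘(ℝ, Model d)) a.contMDiff s.contMDiff
  intro x
  exact (Bundle.contMDiffAt_section x).1 (this x)

theorem continuous_sec_apply (l : Sec (VB.tangent d M).dual) :
    Continuous (fun p : TangentBundle 𝓘(ℝ, Model d) M => (l p.1 p.2 : ℝ)) := by
  have h0 : IsManifold 𝓘(ℝ, Model d) (∞ + 1) M := by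
      simpa using (inferInstance : IsManifold 𝓘(ℝ, Model d) ∞ M)
  have : ContMDiffVectorBundle ∞ (Model d) (fun x : M => TangentSpace 𝓘(ℝ, Model d) x) 𝓘(ℝ,
    Model d) := TangentBundle.contMDiffVectorBundle
  have h1 : ContMDiff (𝓘(ℝ, Model d).prod 𝓘(ℝ, Model d))
    (𝓘(ℝ, Model d).prod 𝓘(ℝ, Model d →L[ℝ] ℝ)) ∞
     (fun p : TangentBundle 𝓘(ℝ, Model d) M =>
       (⟨p.1, l p.1⟩ : TotalSpace (Model d →L[ℝ] ℝ)
         (fun x : M => TangentSpace 𝓘(ℝ, Model d) x →L[ℝ] Bundle.Trivial M ℝ x))) :=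
    l.contMDiff.comp (Bundle.contMDiff_proj _)
  have := ContMDiff.clm_bundle_apply (E₁ := fun x : M => TangentSpace 𝓘(ℝ, Model d) x)
    (E₂ := Bundle.Trivial M ℝ) (F₂ := ℝ) (b := fun p : TangentBundle 𝓘(ℝ, Model d) M => p.1)
    (v := fun p => p.2) h1 contMDiff_id
  have h3 := this.continuous
  have h4 : Continuous fun p : TotalSpace ℝ (Bundle.Trivial M ℝ) => p.2 := by
    exact continuous_snd.comp (Bundle.Trivial.homeomorphProd M ℝ).continuous
  exact h4.comp h3

/-- A continuous function on the tangent bundle which is positively homogeneous on the fibres and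
positive on the closed cone at `p` is positive on the closed cones near `p`: the unit sphere is
compact and the closed cone bundle is closed. -/
theorem eventually_pos_on_cone (C : ChronalCone d M) (Φ : TangentBundle 𝓘(ℝ, Model d) M → ℝ)
    (hΦ : Continuous Φ)
    (hom : ∀ (x : M) (a : ℝ) (v : TangentSpace 𝓘(ℝ, Model d) x), 0 < a → Φ ⟨x, a • v⟩ =
      a * Φ ⟨x, v⟩)
    (p : M) (hp : ∀ v ∈ closure (C.cone p), v ≠ 0 → 0 < Φ ⟨p, v⟩) :
    ∀ᶠ q in 𝓝 p, ∀ v ∈ closure (C.cone q), v ≠ 0 → 0 < Φ ⟨q, v⟩ := by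
  set e := trivializationAt (Model d) (fun x : M => TangentSpace 𝓘(ℝ, Model d) x) p with he
  have key : ∀ᶠ q in 𝓝 p, ∀ u ∈ Metric.sphere (0 : Model d) 1,
      (e.symm q u ∈ closure (C.cone q) → 0 < Φ ⟨q, e.symm q u⟩) := by
    refine (isCompact_sphere (0 : Model d) 1).eventually_forall_of_forall_eventually fun u hu => ?_
    have hpe : p ∈ e.baseSet := FiberBundle.mem_baseSet_trivializationAt' p
    have hc : ContinuousAt (fun z : M × Model d =>
      (⟨z.1, e.symm z.1 z.2⟩ : TangentBundle 𝓘(ℝ, Model d) M)) (p, u) := by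
      have : ContinuousOn (fun z : M × Model d => TotalSpace.mk' (Model d) z.1 (e.symm z.1 z.2))
        (e.baseSet ×ˢ univ) := e.continuousOn_symm
      exact this.continuousAt ((e.open_baseSet.prod isOpen_univ).mem_nhds ⟨hpe, mem_univ _⟩)
    by_cases hmem : e.symm p u ∈ closure (C.cone p)
    · have hne : e.symm p u ≠ 0 := by
        intro h0
        have h1 := e.apply_mk_symm hpe u
        rw [h0] at h1
        have h2 := e.zeroSection ℝ hpe
        rw [zeroSection] at h2
        erw [h1] at h2
        have : u = 0 := (Prod.ext_iff.1 h2).2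
        rw [this] at hu
        simp at hu
      have := (hΦ.continuousAt.comp hc).eventually_const_lt (hp _ hmem hne)
      filter_upwards [this] with z hz _ using hz
    · have := hc.eventually (C.isClosed_closure.isOpen_compl.mem_nhds hmem)
      filter_upwards [this] with z hz h using absurd h hz
  have hb : ∀ᶠ q in 𝓝 p, q ∈ e.baseSet := e.open_baseSet.mem_nhds
    (FiberBundle.mem_baseSet_trivializationAt' p)
  filter_upwards [key, hb] with q hq hqb v hv hv0
  set w := e.continuousLinearEquivAt ℝ q hqb v with hw
  have hw0 : w ≠ 0 := fun h => hv0 ((e.continuousLinearEquivAt ℝ q hqb).map_eq_zero_iff.1 h)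
  have hsymm : ∀ u, e.symm q u = (e.continuousLinearEquivAt ℝ q hqb).symm u := fun u => rfl
  have hvw : e.symm q (‖w‖⁻¹ • w) = ‖w‖⁻¹ • v := by
    rw [hsymm, map_smul, hw, ContinuousLinearEquiv.symm_apply_apply]
  have hpos : 0 < ‖w‖⁻¹ := inv_pos.2 (norm_pos_iff.2 hw0)
  have h1 := hq (‖w‖⁻¹ • w) (by simp [norm_smul, hw0])
  rw [hvw, hom _ _ _ hpos] at h1
  refine pos_of_mul_pos_right (h1 ?_) hpos.le
  have : v ∈ closure (C.cone q) → ‖w‖⁻¹ • v ∈ closure (C.cone q) := by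
    intro h
    have := map_mem_closure (continuous_const_smul (‖w‖⁻¹)) h (fun v hv => C.smul_mem q v hv _ hpos)
    exact this
  exact this hv

/-- A closed salient convex cone lies in a half space on which a linear functional bounds the norm.
Each `-v` with `v` in the cone is separated from the cone, and finitely many of the separating
functionals suffice by compactness of the set of unit vectors in the cone. -/
theorem exists_linear_ge_norm_of_salient {E : Type*} [NormedAddCommGroup E] [NormedSpace ℝ E]
    [FiniteDimensional ℝ E] {D : Set E} (hD : IsClosed D) (hconv : Convex ℝ D)
    (hsmul : ∀ v ∈ D, ∀ a : ℝ, 0 < a → a • v ∈ D) (hsal : ∀ v ∈ D, -v ∈ D → v = 0) :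
    ∃ (τ : E →L[ℝ] ℝ) (c : ℝ), 0 < c ∧ ∀ v ∈ D, c * ‖v‖ ≤ τ v := by
  have hsep : ∀ v ∈ D ∩ Metric.sphere 0 1, ∃ f : E →L[ℝ] ℝ, (∀ w ∈ D, 0 ≤ f w) ∧ 0 < f v := by
    rintro v ⟨hv, hv1⟩
    have hv0 : v ≠ 0 := by
      rintro rfl
      simp at hv1
    obtain ⟨f, u, hfu, hfD⟩ := geometric_hahn_banach_point_closed hconv hD
      (fun h => hv0 (hsal v hv h))
    have hscale : ∀ w ∈ D, ∀ a : ℝ, 0 < a → u < a * f w := fun w hw a ha => by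
      simpa using hfD _ (hsmul w hw a ha)
    have hu : u ≤ 0 := by
      have : Tendsto (fun a : ℝ => a * f v) (𝓝[>] 0) (𝓝 (0 * f v)) :=
        (tendsto_id.mul_const _).mono_left nhdsWithin_le_nhds
      rw [zero_mul] at this
      exact ge_of_tendsto this (eventually_mem_nhdsWithin.mono fun a ha => (hscale v hv a ha).le)
    refine ⟨f, fun w hw => ?_, ?_⟩
    · by_contra! hneg
      have := hscale w hw ((u - 1) / f w) (div_pos_of_neg_of_neg (by linarith) hneg)
      rw [div_mul_cancel₀ _ hneg.ne] at this
      linarith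
    · rw [map_neg] at hfu
      linarith
  choose! f hfD hfv using hsep
  have hcpt : IsCompact (D ∩ Metric.sphere 0 1) := (isCompact_sphere _ _).inter_left hD
  obtain ⟨t, htD, ht⟩ := hcpt.elim_nhds_subcover (fun v => {w | 0 < f v w}) (fun v hv =>
    (isOpen_lt continuous_const (f v).continuous).mem_nhds (hfv v hv))
  have hpos : ∀ w ∈ D ∩ Metric.sphere 0 1, 0 < (∑ v ∈ t, f v) w := by
    intro w hw
    obtain ⟨v, hv, hvw⟩ := mem_iUnion₂.1 (ht hw)
    rw [_root_.sum_apply]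
    exact Finset.sum_pos' (fun i hi => hfD i (htD i hi) w hw.1) ⟨v, hv, hvw⟩
  obtain ⟨c, hc, hcw⟩ := hcpt.exists_forall_le' (∑ v ∈ t, f v).continuous.continuousOn hpos
  refine ⟨∑ v ∈ t, f v, c, hc, fun v hv => ?_⟩
  rcases eq_or_ne v 0 with rfl | hv0
  · simp
  have hn : 0 < ‖v‖ := norm_pos_iff.2 hv0
  have := hcw (‖v‖⁻¹ • v) ⟨hsmul v hv _ (inv_pos.2 hn), by simp [norm_smul, hn.ne']⟩
  rwa [map_smul, smul_eq_mul, inv_mul_eq_div, le_div_iff₀ hn] at this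

theorem ChronalCone.smul_mem_closure (C : ChronalCone d M) {x : M}
    {v : TangentSpace 𝓘(ℝ, Model d) x}
    (hv : v ∈ closure (C.cone x)) {a : ℝ} (ha : 0 < a) : a • v ∈ closure (C.cone x) :=
  map_mem_closure (continuous_const_smul a) hv (fun v hv => C.smul_mem x v hv _ ha)

theorem ChronalCone.exists_functional (C : ChronalCone d M) (x : M) :
    ∃ (τ : Model d →L[ℝ] ℝ) (c : ℝ), 0 < c ∧
      ∀ v : Model d, v ∈ closure (C.cone x) → c * ‖v‖ ≤ τ v := by
  have h := exists_linear_ge_norm_of_salient (E := Model d) (D := closure (C.cone x))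
    (_root_.isClosed_closure (X := TangentSpace 𝓘(ℝ, Model d) x))
    (C.convex x).closure (fun _ hv _ ha => C.smul_mem_closure hv ha) (C.salient x)
  exact h

/-- The differential of a real function. -/
noncomputable def differential (f : M → ℝ) (x : M) : TangentSpace 𝓘(ℝ, Model d) x →L[ℝ] ℝ :=
  mfderiv 𝓘(ℝ, Model d) 𝓘(ℝ, ℝ) f x

theorem continuous_differential_apply {f : M → ℝ} (hf : ContMDiff 𝓘(ℝ, Model d) 𝓘(ℝ, ℝ) ∞ f) :
    Continuous (fun p : TangentBundle 𝓘(ℝ, Model d) M => differential f p.1 p.2) := by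
  have h1 : Continuous (tangentMap 𝓘(ℝ, Model d) 𝓘(ℝ, ℝ) f) := hf.continuous_tangentMap (by simp)
  exact (contMDiff_snd_tangentBundle_modelSpace ℝ 𝓘(ℝ, ℝ) (n := 0)).continuous.comp h1

theorem continuous_neg_tangentBundle : Continuous
    (fun p : TangentBundle 𝓘(ℝ, Model d) M => (⟨p.1, -p.2⟩ : TangentBundle 𝓘(ℝ, Model d) M)) := by
  refine continuous_iff_continuousAt.2 fun p => ?_
  have hproj : Continuous (fun p : TangentBundle 𝓘(ℝ, Model d) M => p.1) :=
    FiberBundle.continuous_proj (Model d) (fun x : M => TangentSpace 𝓘(ℝ, Model d) x)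
  rw [FiberBundle.continuousAt_totalSpace]
  refine ⟨hproj.continuousAt, ?_⟩
  set e := trivializationAt (Model d) (fun x : M => TangentSpace 𝓘(ℝ, Model d) x) p.1
  have hp : p.1 ∈ e.baseSet := FiberBundle.mem_baseSet_trivializationAt' p.1
  have h1 : ContinuousAt (fun q : TangentBundle 𝓘(ℝ, Model d) M => -(e q).2) p :=
    (continuousAt_snd.comp (e.continuousAt (e.mem_source.2 hp))).neg
  refine h1.congr ?_
  filter_upwards [hproj.continuousAt.eventually (e.open_baseSet.mem_nhds hp)] with q hq
  exact ((e.linear ℝ hq).map_neg q.2).symm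

/-- The opposite cone field, exchanging future and past. -/
def ChronalCone.opp (C : ChronalCone d M) : ChronalCone d M where
  cone x := -C.cone x
  nonempty x := (C.nonempty x).neg
  convex x := (C.convex x).neg
  smul_mem x v hv a ha := by
    have := C.smul_mem x _ hv a ha
    rwa [smul_neg] at this
  salient x v hv hv' := by
    rw [← neg_closure] at hv hv'
    have := C.salient x _ hv hv'
    rwa [neg_eq_zero] at this
  isOpen := C.isOpen.preimage continuous_neg_tangentBundle
  isClosed_closure := by
    have := C.isClosed_closure.preimage (continuous_neg_tangentBundle (d := d) (M := M))
    convert this using 3 with p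
    simp only [← neg_closure]
    rfl

variable [T2Space M] [SigmaCompactSpace M]

/-- Auxiliary data used to parametrize causal curves: a smooth proper function `height` and a
`1`-form `lam` which dominates the differential of `height` on causal vectors.  Curves on which
`lam` of the velocity is `1` have `height` of bounded slope, so that they cannot escape to infinity
in finite time. -/
structure Clock (C : ChronalCone d M) where
  height : M → ℝ
  lam : Sec (VB.tangent d M).dual
  smooth_height : ContMDiff 𝓘(ℝ, Model d) 𝓘(ℝ, ℝ) ∞ height
  isCompact_le : ∀ B, IsCompact {x | height x ≤ B}
  abs_lt : ∀ x, ∀ v ∈ closure (C.cone x), v ≠ 0 →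
    |differential height x v| < lam x v

/-- There is a smooth function with compact sublevel sets. -/
theorem exists_smooth_exhaustion : ∃ h : M → ℝ, ContMDiff 𝓘(ℝ, Model d) 𝓘(ℝ, ℝ) ∞ h ∧
    ∀ B, IsCompact {x | h x ≤ B} := by
  have : LocallyCompactSpace M := ChartedSpace.locallyCompactSpace (Model d) M
  let K : CompactExhaustion M := default
  obtain ⟨h, hh⟩ := exists_contMDiffMap_forall_mem_convex_of_local_const 𝓘(ℝ, Model d) (n := ⊤)
    (t := fun x => {r : ℝ | (K.find x : ℝ) ≤ r}) (fun x => convex_Ici _) (fun x => by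
      refine ⟨K.find x + 1, ?_⟩
      have : K (K.find x + 1) ∈ 𝓝 x :=
        mem_of_superset (isOpen_interior.mem_nhds
          (K.subset_interior_succ _ (K.mem_find x))) interior_subset
      filter_upwards [this] with y hy
      have := K.mem_iff_find_le.1 hy
      exact_mod_cast this)
  refine ⟨h, h.contMDiff, fun B => ?_⟩
  refine (K.isCompact ⌈B⌉₊).of_isClosed_subset
    (isClosed_le h.contMDiff.continuous continuous_const) ?_
  intro x hx
  refine K.mem_iff_find_le.2 ?_
  have h1 : (K.find x : ℝ) ≤ B := (hh x).trans hx
  exact_mod_cast h1.trans (Nat.le_ceil B)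

/-- Clocks exist. Near a point, a large multiple of any form extending a functional positive on the
closed cone there is suitable; as the condition on the form is convex, the local forms can be glued
by a partition of unity. -/
theorem exists_clock (C : ChronalCone d M) : Nonempty (Clock C) := by
  obtain ⟨h, hh, hc⟩ := exists_smooth_exhaustion (d := d) (M := M)
  have key := exists_contMDiffSection_forall_mem_convex_of_local 𝓘(ℝ, Model d) (n := ⊤)
    (F_fiber := (VB.tangent d M).dual.Fib) (VB.tangent d M).dual.Fiber
    (fun x => {l | ∀ v ∈ closure (C.cone x), v ≠ 0 →
      |differential h x v| < l v}) (fun x => by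
      intro p hp q hq a b ha hb hab v hv hv0
      have h1 := hp v hv hv0
      have h2 := hq v hv hv0
      have : |differential h x v| < a * p v + b * q v := by
        rcases ha.eq_or_lt with rfl | ha
        · simp only [zero_add] at hab
          subst hab
          simpa using h2
        · have hb' : b = 1 - a := by linarith
          subst hb'
          nlinarith
      exact this) (fun x₀ => by
      obtain ⟨τ, c, hc0, hτ⟩ := C.exists_functional x₀
      obtain ⟨s, hs⟩ := exists_sec_eq (VB.tangent d M).dual x₀ τ
      set D : Model d →L[ℝ] ℝ := differential h x₀ with hD
      set A : ℝ := (‖D‖ + 1) / c with hA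
      have hcont : Continuous (fun p : TangentBundle 𝓘(ℝ, Model d) M =>
          A * (s p.1 p.2 : ℝ) - |differential h p.1 p.2|) :=
        (continuous_const.mul (continuous_sec_apply s)).sub (continuous_differential_apply hh).abs
      have := eventually_pos_on_cone C _ hcont (fun x a v ha => by
        have h1 : s x (a • v) = a * s x v := map_smul _ _ _
        have h2 : differential h x (a • v) = a * differential h x v := map_smul _ _ _
        simp only [h1, h2, abs_mul, abs_of_pos ha]
        ring) x₀ (fun v' hv hv0 => by
        let v : Model d := v'
        have h1 := hτ v hv
        have h2 := D.le_opNorm v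
        have hn : 0 < ‖v‖ := norm_pos_iff.2 hv0
        have h3 : A * (c * ‖v‖) = (‖D‖ + 1) * ‖v‖ := by
          rw [hA]; field_simp
        have hA0 : 0 < A := by positivity
        have h4 := mul_le_mul_of_nonneg_left h1 hA0.le
        show 0 < A * (s x₀ v : ℝ) - |D v|
        rw [hs]
        rw [Real.norm_eq_abs] at h2
        have h5 : (‖D‖ + 1) * ‖v‖ = ‖D‖ * ‖v‖ + ‖v‖ := by ring
        change 0 < A * τ v - |D v|
        linarith)
      refine ⟨_, this, fun y => (A • s) y, (A • s).contMDiff.contMDiffOn, fun y hy v hv hv0 => ?_⟩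
      have := hy v hv hv0
      exact sub_pos.1 this)
  obtain ⟨l, hl⟩ := key
  exact ⟨⟨h, l, hh, hc, hl⟩⟩

end

/-! ### Normalized curves -/

section
/-- Smooth real functions on `M`. -/
abbrev SmoothFun (f : M → ℝ) : Prop := ContMDiff 𝓘(ℝ, Model d) 𝓘(ℝ, ℝ) ∞ f

theorem differential_congr {f g : M → ℝ} {x : M} (h : f =ᶠ[𝓝 x] g) :
    differential (d := d) f x = differential g x := by
  unfold differential
  rw [h.mfderiv_eq]

theorem differential_const (c : ℝ) (x : M) : differential (d := d) (fun _ => c) x = 0 := by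
  unfold differential
  exact mfderiv_const

theorem differential_add_const (f : M → ℝ) (hf : SmoothFun (d := d) f) (c : ℝ) (x : M) :
    differential (d := d) (fun y => f y + c) x = differential f x := by
  have h1 := (hf.mdifferentiableAt (x := x) (by simp)).hasMFDerivAt
  have h2 : HasMFDerivAt 𝓘(ℝ, Model d) 𝓘(ℝ, ℝ) (fun _ => c) x 0 := hasMFDerivAt_const c x
  exact (h1.add h2).mfderiv.trans (add_zero (differential f x))

theorem differential_neg (f : M → ℝ) (x : M) :
    differential (d := d) (fun y => -f y) x = -differential f x :=
  mfderiv_neg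

theorem hasDerivAt_comp_curve {f : M → ℝ} (hf : SmoothFun (d := d) f) {γ : ℝ → M} {t : ℝ}
    (hγ : MDifferentiableAt 𝓘(ℝ, ℝ) 𝓘(ℝ, Model d) γ t) :
    HasDerivAt (fun t => f (γ t)) (differential f (γ t) (velocity (d := d) γ t)) t := by
  have h := (hf.mdifferentiableAt (x := γ t) (by simp)).hasMFDerivAt.comp t hγ.hasMFDerivAt
  have h2 : HasFDerivAt (fun t => f (γ t))
    ((differential f (γ t)).comp (mfderiv 𝓘(ℝ, ℝ) 𝓘(ℝ, Model d) γ t) : ℝ →L[ℝ] ℝ) t := h.hasFDerivAt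
  exact h2.hasDerivAt

theorem differential_chart (p : M) (ℓ : Model d →L[ℝ] ℝ) {f : M → ℝ}
    (h : f =ᶠ[𝓝 p] fun x => ℓ (chartAt (Model d) p x)) (v : Model d) :
    differential f p v = ℓ v := by
  rw [differential_congr h]
  have hc : MDifferentiableAt 𝓘(ℝ, Model d) 𝓘(ℝ, Model d) (chartAt (Model d) p) p :=
    mdifferentiableAt_atlas (chart_mem_atlas _ p) (mem_chart_source _ p)
  have hl : MDifferentiableAt 𝓘(ℝ, Model d) 𝓘(ℝ, ℝ) ℓ (chartAt (Model d) p p) :=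
    ℓ.differentiableAt.mdifferentiableAt
  have h1 := mfderiv_comp p hl hc
  have h2 : mfderiv 𝓘(ℝ, Model d) 𝓘(ℝ, Model d) (chartAt (Model d) p) p v = v := by
    have := mfderiv_chartAt_eq_tangentCoordChange (I := 𝓘(ℝ, Model d)) (x := p) (y := p)
      (mem_chart_source _ p)
    have h3 := tangentCoordChange_self (I := 𝓘(ℝ, Model d)) (x := p) (z := p) (v := v)
      (mem_extChartAt_source p)
    exact (DFunLike.congr_fun this v).trans h3
  unfold differential
  have h3 := DFunLike.congr_fun h1 v
  refine h3.trans ((congrArg (mfderiv 𝓘(ℝ, Model d) 𝓘(ℝ, ℝ) ℓ (chartAt (Model d) p p)) h2).trans ?_)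
  rw [mfderiv_eq_fderiv]
  exact DFunLike.congr_fun ℓ.hasFDerivAt.fderiv v

variable [T2Space M] [SigmaCompactSpace M] {C : ChronalCone d M}

namespace Clock

/-- The differential of `f` is at most `g` times the clock form on causal vectors. -/
def Dom (T : Clock C) (f g : M → ℝ) : Prop :=
  ∀ x, ∀ v ∈ closure (C.cone x), differential f x v ≤ g x * T.lam x v

variable (T : Clock C)

theorem lam_pos {x : M} {v : TangentSpace 𝓘(ℝ, Model d) x} (hv : v ∈ closure (C.cone x))
    (h0 : v ≠ 0) : 0 < T.lam x v :=
  (abs_nonneg _).trans_lt (T.abs_lt x v hv h0)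

theorem lam_nonneg {x : M} {v : TangentSpace 𝓘(ℝ, Model d) x} (hv : v ∈ closure (C.cone x)) :
    0 ≤ T.lam x v := by
  rcases eq_or_ne v 0 with rfl | h
  · exact (map_zero (T.lam x)).ge
  · exact (T.lam_pos hv h).le

theorem exists_norm_le_lam (p : M) : ∃ c : ℝ, 0 < c ∧
    ∀ v : Model d, v ∈ closure (C.cone p) → c * ‖v‖ ≤ T.lam p v := by
  have hcl : IsClosed (closure (C.cone p)) := _root_.isClosed_closure
  let D : Set (Model d) := closure (C.cone p)
  have hD : IsClosed D := hcl
  have hcpt : IsCompact (D ∩ Metric.sphere 0 1) := (isCompact_sphere _ _).inter_left hD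
  let l : Model d →L[ℝ] ℝ := T.lam p
  obtain ⟨c, hc, hcw⟩ := hcpt.exists_forall_le' (f := l) (a := 0) l.continuous.continuousOn (by
    rintro v ⟨hv, hv1⟩
    refine T.lam_pos hv ?_
    intro h0
    have : ‖v‖ = 1 := by simpa using hv1
    have h1 : ‖v‖ = 0 := norm_eq_zero.2 h0
    linarith)
  refine ⟨c, hc, fun v hv => ?_⟩
  rcases eq_or_ne v 0 with rfl | hv0
  · simp only [norm_zero, mul_zero]
    exact (map_zero l).ge
  have hn : 0 < ‖v‖ := norm_pos_iff.2 hv0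
  have := hcw (‖v‖⁻¹ • v) ⟨C.smul_mem_closure hv (inv_pos.2 hn), by simp [norm_smul, hn.ne']⟩
  rwa [map_smul, smul_eq_mul, inv_mul_eq_div, le_div_iff₀ hn] at this

/-- A strict bound for a differential at a point persists nearby. -/
theorem eventually_differential_le {f : M → ℝ} (hf : SmoothFun (d := d) f) {p : M} {a : ℝ}
    (h : ∀ v ∈ closure (C.cone p), v ≠ 0 → differential f p v < a * T.lam p v) :
    ∀ᶠ q in 𝓝 p, ∀ v ∈ closure (C.cone q), differential f q v ≤ a * T.lam q v := by
  have hcont : Continuous (fun q : TangentBundle 𝓘(ℝ, Model d) M =>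
      a * T.lam q.1 q.2 - differential f q.1 q.2) :=
    (continuous_const.mul (continuous_sec_apply T.lam)).sub (continuous_differential_apply hf)
  filter_upwards [eventually_pos_on_cone C _ hcont (fun x b v hb => by
      have h1 : T.lam x (b • v) = b * T.lam x v := map_smul _ _ _
      have h2 : differential f x (b • v) = b * differential f x v := map_smul _ _ _
      simp only [h1, h2]
      ring) p (fun v hv hv0 => sub_pos.2 (h v hv hv0))] with q hq v hv
  rcases eq_or_ne v 0 with rfl | hv0
  · have h1 : T.lam q 0 = 0 := map_zero (T.lam q)
    have h2 : differential (d := d) f q 0 = 0 := map_zero _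
    rw [h1, h2, mul_zero]
  · exact (sub_pos.1 (hq v hv hv0)).le

theorem exists_bound_on_compact {f : M → ℝ} (hf : SmoothFun (d := d) f) {K : Set M}
    (hK : IsCompact K) : ∃ L : ℝ, 0 ≤ L ∧ ∀ x ∈ K, ∀ v ∈ closure (C.cone x),
      differential f x v ≤ L * T.lam x v := by
  refine hK.induction_on (p := fun K => ∃ L : ℝ, 0 ≤ L ∧ ∀ x ∈ K, ∀ v ∈ closure (C.cone x),
      differential f x v ≤ L * T.lam x v) ⟨0, le_rfl, by simp⟩ ?_ ?_ ?_
  · rintro s t hst ⟨L, hL, h⟩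
    exact ⟨L, hL, fun x hx => h x (hst hx)⟩
  · rintro s t ⟨L, hL, h⟩ ⟨L', hL', h'⟩
    refine ⟨max L L', hL.trans (le_max_left _ _), ?_⟩
    rintro x (hx | hx) v hv
    · exact (h x hx v hv).trans (mul_le_mul_of_nonneg_right (le_max_left _ _) (T.lam_nonneg hv))
    · exact (h' x hx v hv).trans (mul_le_mul_of_nonneg_right (le_max_right _ _) (T.lam_nonneg hv))
  · intro p _
    obtain ⟨c, hc, hcv⟩ := T.exists_norm_le_lam p
    let D : Model d →L[ℝ] ℝ := differential f p
    refine ⟨_, nhdsWithin_le_nhds (T.eventually_differential_le hf (p := p)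
      (a := (‖D‖ + 1) / c) fun v' hv hv0 => ?_), (‖D‖ + 1) / c, by positivity, fun q hq => hq⟩
    let v : Model d := v'
    have hn : 0 < ‖v‖ := norm_pos_iff.2 hv0
    have h1 : D v ≤ ‖D‖ * ‖v‖ := (le_abs_self _).trans (D.le_opNorm v)
    have h2 := mul_le_mul_of_nonneg_left (hcv v hv) (a := (‖D‖ + 1) / c) (by positivity)
    have h3 : (‖D‖ + 1) / c * (c * ‖v‖) = ‖D‖ * ‖v‖ + ‖v‖ := by field_simp
    change D v < (‖D‖ + 1) / c * T.lam p v
    linarith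

theorem exists_dom_of_hasCompactSupport {f : M → ℝ} (hf : SmoothFun (d := d) f)
    (hc : HasCompactSupport f) : ∃ L : ℝ, 0 ≤ L ∧ T.Dom f (fun _ => L) := by
  obtain ⟨L, hL, h⟩ := T.exists_bound_on_compact hf hc.isCompact
  refine ⟨L, hL, fun x v hv => ?_⟩
  by_cases hx : x ∈ tsupport f
  · exact h x hx v hv
  · have : f =ᶠ[𝓝 x] fun _ => 0 := notMem_tsupport_iff_eventuallyEq.1 hx
    rw [differential_congr this, differential_const]
    exact mul_nonneg hL (T.lam_nonneg hv)

/-- A linear function on the tangent space at `p` extends to a smooth function whose differential is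
controlled, near `p` with almost the constant valid at `p`, and globally by a function with bounded
differential. -/
theorem exists_local_dom (p : M) (ℓ : Model d →L[ℝ] ℝ) {a : ℝ}
    (h : ∀ v : Model d, v ∈ closure (C.cone p) → ℓ v ≤ a * T.lam p v) {ε : ℝ} (hε : 0 < ε) :
    ∃ (f g : M → ℝ) (L : ℝ), SmoothFun (d := d) f ∧ SmoothFun (d := d) g ∧ 0 ≤ L ∧ T.Dom f g ∧
      T.Dom g (fun _ => L) ∧ (f =ᶠ[𝓝 p] fun x => ℓ (chartAt (Model d) p x)) ∧
      g =ᶠ[𝓝 p] fun _ => a + ε := by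
  obtain ⟨η⟩ : Nonempty (SmoothBumpFunction 𝓘(ℝ, Model d) p) := inferInstance
  set f : M → ℝ := fun x => η x • ℓ (chartAt (Model d) p x) with hf
  have hfs : SmoothFun (d := d) f := by
    refine η.contMDiff_smul ?_
    exact ℓ.contMDiff.comp_contMDiffOn (contMDiffOn_chart (x := p))
  have hfc : HasCompactSupport f := η.hasCompactSupport.smul_right
  have hfe : f =ᶠ[𝓝 p] fun x => ℓ (chartAt (Model d) p x) := by
    filter_upwards [η.eventuallyEq_one] with x hx
    simp [hf, hx]
  obtain ⟨B, hB, hfB⟩ := T.exists_dom_of_hasCompactSupport hfs hfc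
  have hev := T.eventually_differential_le hfs (p := p) (a := a + ε) (fun v hv hv0 => by
    have e : differential f p v = ℓ v := differential_chart p ℓ hfe v
    have := h v hv
    rw [e]
    have := mul_pos hε (T.lam_pos hv hv0)
    linarith)
  obtain ⟨ρ, -, hρ⟩ := (SmoothBumpFunction.nhds_basis_tsupport (I := 𝓘(ℝ, Model d)) p).mem_iff.1 hev
  -- `g` interpolates between the value `a + ε` near `p` and the global bound `B` elsewhere
  set g : M → ℝ := fun x => (a + ε - B) * ρ x + B with hg
  have hρs : SmoothFun (d := d) (fun x => (a + ε - B) * ρ x) := contMDiff_const.mul ρ.contMDiff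
  obtain ⟨L, hL, hgL⟩ := T.exists_dom_of_hasCompactSupport hρs ρ.hasCompactSupport.mul_left
  refine ⟨f, g, L, hfs, hρs.add contMDiff_const, hL, fun x v hv => ?_, fun x v hv => ?_, hfe, ?_⟩
  · by_cases hx : x ∈ tsupport ρ
    · have h1 := hρ hx v hv
      have h2 := hfB x v hv
      have h3 := ρ.nonneg (x := x)
      have h4 := ρ.le_one (x := x)
      have h5 : g x * T.lam x v = ρ x * ((a + ε) * T.lam x v) + (1 - ρ x) * (B * T.lam x v) := by
        rw [hg]; ring
      rw [h5]
      nlinarith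
    · have : ρ x = 0 := image_eq_zero_of_notMem_tsupport hx
      have h5 : g x = B := by simp [hg, this]
      rw [h5]
      exact hfB x v hv
  · rw [hg, differential_add_const _ hρs]
    exact hgL x v hv
  · filter_upwards [ρ.eventuallyEq_one] with x hx
    simp [hg, hx]

/-- A weak form of "causal and parametrized so that `lam` of the velocity is `1`": a Taylor
inequality for all smooth functions.  It is stable under pointwise limits. -/
def IsNormal (γ : ℝ → M) (J : Set ℝ) : Prop :=
  ∀ (f g : M → ℝ) (L : ℝ), SmoothFun (d := d) f → SmoothFun (d := d) g → 0 ≤ L → T.Dom f g →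
    T.Dom g (fun _ => L) → ∀ s ∈ J, ∀ t ∈ J, s ≤ t →
      f (γ t) - f (γ s) ≤ (t - s) * g (γ s) + L * (t - s) ^ 2

variable {T}

theorem IsNormal.mono {γ : ℝ → M} {J J' : Set ℝ} (h : T.IsNormal γ J) (hJ : J' ⊆ J) :
    T.IsNormal γ J' :=
  fun f g L hf hg hL hfg hgL s hs t ht => h f g L hf hg hL hfg hgL s (hJ hs) t (hJ ht)

theorem IsNormal.congr {γ σ : ℝ → M} {J : Set ℝ} (h : T.IsNormal γ J) (hJ : EqOn σ γ J) :
    T.IsNormal σ J := by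
  intro f g L hf hg hL hfg hgL s hs t ht
  rw [hJ hs, hJ ht]
  exact h f g L hf hg hL hfg hgL s hs t ht

theorem IsNormal.comp_add {γ : ℝ → M} {J : Set ℝ} (h : T.IsNormal γ J) (a : ℝ) :
    T.IsNormal (fun t => γ (t + a)) ((· + a) ⁻¹' J) := by
  intro f g L hf hg hL hfg hgL s hs t ht hst
  have := h f g L hf hg hL hfg hgL _ hs _ ht (by linarith)
  simpa using this

/-- A function whose differential is bounded by `L` times the clock form grows at most at the rate
`L` along normalized curves. -/
theorem IsNormal.sub_le {γ : ℝ → M} {J : Set ℝ} (h : T.IsNormal γ J) {f : M → ℝ}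
    (hf : SmoothFun (d := d) f) {L : ℝ} (hL : T.Dom f (fun _ => L)) {s t : ℝ} (hs : s ∈ J)
    (ht : t ∈ J) (hst : s ≤ t) : f (γ t) - f (γ s) ≤ L * (t - s) := by
  have := h f (fun _ => L) 0 hf contMDiff_const le_rfl hL (fun x v hv => by
    rw [differential_const]; simp) s hs t ht hst
  linarith

theorem dom_height : T.Dom T.height (fun _ => 1) := by
  intro x v hv
  rcases eq_or_ne v 0 with rfl | h0
  · have h1 : T.lam x 0 = 0 := map_zero (T.lam x)
    have h2 : differential (d := d) T.height x 0 = 0 := map_zero _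
    rw [h1, h2, mul_zero]
  · rw [one_mul]
    exact (le_abs_self _).trans (T.abs_lt x v hv h0).le

theorem dom_neg_height : T.Dom (fun x => -T.height x) (fun _ => 1) := by
  intro x v hv
  rw [differential_neg, one_mul]
  rcases eq_or_ne v 0 with rfl | h0
  · have h1 : T.lam x 0 = 0 := map_zero (T.lam x)
    have h2 : (-differential (d := d) T.height x) 0 = 0 := map_zero _
    rw [h1, h2]
  · exact (neg_le_abs _).trans (T.abs_lt x v hv h0).le

theorem IsNormal.abs_height_le {γ : ℝ → M} {J : Set ℝ} (h : T.IsNormal γ J) {s t : ℝ}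
    (hs : s ∈ J) (ht : t ∈ J) (hst : s ≤ t) : |T.height (γ t) - T.height (γ s)| ≤ t - s := by
  have h1 := h.sub_le T.smooth_height dom_height hs ht hst
  have h2 := h.sub_le T.smooth_height.neg dom_neg_height hs ht hst
  rw [abs_le]
  constructor <;> linarith

/-- Normalized curves can be concatenated. -/
theorem IsNormal.union {γ : ℝ → M} {J : Set ℝ} {m : ℝ} (h₁ : T.IsNormal γ (J ∩ Iic m))
    (h₂ : T.IsNormal γ (J ∩ Ici m)) (hm : m ∈ J) : T.IsNormal γ J := by
  intro f g L hf hg hL hfg hgL s hs t ht hst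
  rcases le_total t m with htm | hmt
  · exact h₁ f g L hf hg hL hfg hgL s ⟨hs, hst.trans htm⟩ t ⟨ht, htm⟩ hst
  rcases le_total m s with hms | hsm
  · exact h₂ f g L hf hg hL hfg hgL s ⟨hs, hms⟩ t ⟨ht, hmt⟩ hst
  have e1 := h₁ f g L hf hg hL hfg hgL s ⟨hs, hsm⟩ m ⟨hm, le_refl m⟩ hsm
  have e2 := h₂ f g L hf hg hL hfg hgL m ⟨hm, le_refl m⟩ t ⟨ht, hmt⟩ hmt
  have e3 := h₁.sub_le hg hgL ⟨hs, hsm⟩ ⟨hm, le_refl m⟩ hsm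
  have e4 : (t - m) * g (γ m) ≤ (t - m) * (g (γ s) + L * (m - s)) :=
    mul_le_mul_of_nonneg_left (by linarith) (by linarith)
  have e5 : 0 ≤ L * ((t - m) * (m - s)) := mul_nonneg hL (mul_nonneg (by linarith) (by linarith))
  nlinarith

/-- Pointwise limits of reparametrized normalized curves are normalized. -/
theorem IsNormal.of_tendsto {ι : Type*} {l : Filter ι} [l.NeBot] {γ : ι → ℝ → M} {J' : ι → Set ℝ}
    {θ : ι → ℝ → ℝ} {σ : ℝ → M} {J : Set ℝ} (h : ∀ᶠ n in l, T.IsNormal (γ n) (J' n))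
    (hθ : ∀ n, Monotone (θ n)) (hJ : ∀ t ∈ J, ∀ᶠ n in l, θ n t ∈ J' n)
    (hlim : ∀ t ∈ J, Tendsto (fun n => θ n t) l (𝓝 t))
    (hσ : ∀ t ∈ J, Tendsto (fun n => γ n (θ n t)) l (𝓝 (σ t))) : T.IsNormal σ J := by
  intro f g L hf hg hL hfg hgL s hs t ht hst
  have hf' := fun t ht => (hf.continuous.tendsto _).comp (hσ t ht)
  have hg' := (hg.continuous.tendsto _).comp (hσ s hs)
  have hts := (hlim t ht).sub (hlim s hs)
  refine le_of_tendsto_of_tendsto ((hf' t ht).sub (hf' s hs))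
    ((hts.mul hg').add ((hts.pow 2).const_mul L)) ?_
  filter_upwards [h, hJ s hs, hJ t ht] with n h hns hnt
  exact h f g L hf hg hL hfg hgL _ hns _ hnt (hθ n hst)
end Clock

end

/-! ### Timelike curves -/

section
theorem continuousOn_tangent_pushforward {E : Type*} [NormedAddCommGroup E] [NormedSpace ℝ E]
    {F : E → M} {U : Set E} (hU : IsOpen U) (hF : ContMDiffOn 𝓘(ℝ, E) 𝓘(ℝ, Model d) ∞ F U) (w : E) :
    ContinuousOn (fun y => (⟨F y, mfderiv 𝓘(ℝ, E) 𝓘(ℝ, Model d) F y w⟩ :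
      TangentBundle 𝓘(ℝ, Model d) M)) U := by
  have h1 := hF.continuousOn_tangentMapWithin (by simp) hU.uniqueMDiffOn
  have h2 : Continuous (fun y : E => (⟨y, w⟩ : TangentBundle 𝓘(ℝ, E) E)) :=
    (tangentBundleModelSpaceHomeomorph 𝓘(ℝ, E)).symm.continuous.comp
      (continuous_id.prodMk continuous_const)
  have h3 := h1.comp h2.continuousOn (s := U) (fun y hy => hy)
  refine h3.congr fun y hy => ?_
  have := tangentMapWithin_eq_tangentMap (I := 𝓘(ℝ, E)) (I' := 𝓘(ℝ, Model d)) (f := F)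
    (p := (⟨y, w⟩ : TangentBundle 𝓘(ℝ, E) E)) (hU.uniqueMDiffWithinAt hy)
    ((hF.contMDiffAt (hU.mem_nhds hy)).mdifferentiableAt (by simp))
  exact this.symm

/-- A smooth function with values in `[-δ, 1 + δ]` which is the identity near `[0, 1]`. -/
theorem exists_smooth_retract {δ : ℝ} (hδ : 0 < δ) : ∃ φ : ℝ → ℝ, ContDiff ℝ ∞ φ ∧
    (∀ t, φ t ∈ Icc (-δ) (1 + δ)) ∧ ∀ t ∈ Icc (0 : ℝ) 1, φ =ᶠ[𝓝 t] id := by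
  let b : ContDiffBump (1 / 2 : ℝ) := ⟨1 / 2 + δ / 2, 1 / 2 + δ, by linarith, by linarith⟩
  refine ⟨fun t => b t * t, b.contDiff.mul contDiff_id, fun t => ?_, fun t ht => ?_⟩
  · have h0 := b.nonneg (x := t)
    have h1 := b.le_one (x := t)
    by_cases ht : b t = 0
    · simp only [ht, zero_mul]
      constructor <;> linarith
    · have : t ∈ Function.support b := ht
      rw [b.support_eq, Metric.mem_ball, Real.dist_eq, abs_lt] at this
      change -(1 / 2 + δ) < _ ∧ _ < 1 / 2 + δ at this
      constructor <;> nlinarith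
  · have : Metric.ball (1 / 2 : ℝ) (1 / 2 + δ / 2) ∈ 𝓝 t := by
      refine Metric.isOpen_ball.mem_nhds ?_
      rw [Metric.mem_ball, Real.dist_eq, abs_lt]
      constructor <;> linarith [ht.1, ht.2]
    filter_upwards [this] with s hs
    rw [b.one_of_mem_closedBall (Metric.ball_subset_closedBall hs), one_mul, id]

theorem mdifferentiable_of_mem_maximalAtlas {e : OpenPartialHomeomorph M (Model d)}
    (he : e ∈ IsManifold.maximalAtlas 𝓘(ℝ, Model d) ∞ M) :
    e.MDifferentiable 𝓘(ℝ, Model d) 𝓘(ℝ, Model d) :=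
  ⟨(contMDiffOn_of_mem_maximalAtlas he).mdifferentiableOn (by simp),
    (contMDiffOn_symm_of_mem_maximalAtlas he).mdifferentiableOn (by simp)⟩

theorem mfderiv_symm_chartVec {e : OpenPartialHomeomorph M (Model d)}
    (he : e ∈ IsManifold.maximalAtlas 𝓘(ℝ, Model d) ∞ M) {p : M} (hp : p ∈ e.source)
    (v : TangentSpace 𝓘(ℝ, Model d) p) :
    mfderiv 𝓘(ℝ, Model d) 𝓘(ℝ, Model d) e.symm (e p) (chartVec e p v) = v :=
  DFunLike.congr_fun ((mdifferentiable_of_mem_maximalAtlas he).symm_comp_deriv hp) v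

theorem chartVec_mfderiv_symm {e : OpenPartialHomeomorph M (Model d)}
    (he : e ∈ IsManifold.maximalAtlas 𝓘(ℝ, Model d) ∞ M) {y : Model d} (hy : y ∈ e.target)
    (w : Model d) :
    chartVec e (e.symm y) (mfderiv 𝓘(ℝ, Model d) 𝓘(ℝ, Model d) e.symm y w) = w :=
  DFunLike.congr_fun ((mdifferentiable_of_mem_maximalAtlas he).comp_symm_deriv hy) w

/-- The points of the chart `e` at which the constant vector field `w` is timelike. -/
def timelikeDom (C : ChronalCone d M) (e : OpenPartialHomeomorph M (Model d)) (w : Model d) :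
    Set (Model d) :=
  {y | y ∈ e.target ∧ (mfderiv 𝓘(ℝ, Model d) 𝓘(ℝ, Model d) e.symm y w :
    TangentSpace 𝓘(ℝ, Model d) (e.symm y)) ∈ C.cone (e.symm y)}

theorem isOpen_timelikeDom (C : ChronalCone d M) {e : OpenPartialHomeomorph M (Model d)}
    (he : e ∈ IsManifold.maximalAtlas 𝓘(ℝ, Model d) ∞ M) (w : Model d) :
    IsOpen (timelikeDom C e w) :=
  (continuousOn_tangent_pushforward e.open_target
    (contMDiffOn_symm_of_mem_maximalAtlas he) w).isOpen_inter_preimage e.open_target C.isOpen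

theorem mem_timelikeDom {C : ChronalCone d M} {e : OpenPartialHomeomorph M (Model d)}
    (he : e ∈ IsManifold.maximalAtlas 𝓘(ℝ, Model d) ∞ M) {p : M} (hp : p ∈ e.source)
    {v : TangentSpace 𝓘(ℝ, Model d) p} (hv : v ∈ C.cone p) :
    e p ∈ timelikeDom C e (chartVec e p v) := by
  refine ⟨e.map_source hp, ?_⟩
  have h1 := mfderiv_symm_chartVec he hp v
  have h2 := e.left_inv hp
  have key : ∀ q : M, q = p → ∀ z : Model d, z = v →
    (z : TangentSpace 𝓘(ℝ, Model d) q) ∈ C.cone q := by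
    rintro q rfl z rfl
    exact hv
  exact key _ h2 _ h1

/-- Straight coordinate segments in a constant direction which stays timelike are timelike. -/
theorem chron_segment (C : ChronalCone d M) {e : OpenPartialHomeomorph M (Model d)}
    (he : e ∈ IsManifold.maximalAtlas 𝓘(ℝ, Model d) ∞ M) {w y : Model d} {a : ℝ} (ha : 0 < a)
    (h : ∀ t ∈ Icc (0 : ℝ) 1, y + (t * a) • w ∈ timelikeDom C e w) :
    Chron C (e.symm y) (e.symm (y + a • w)) := by
  have hO := isOpen_timelikeDom C he w
  have hlin : Continuous (fun t : ℝ => y + (t * a) • w) := by fun_prop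
  -- a timelike curve has to be defined on the whole line: the segment is prolonged a little, and
  -- its parameter retracted smoothly to the prolonged interval
  obtain ⟨δ, hδ, hδO⟩ : ∃ δ > 0, ∀ t ∈ Icc (-δ) (1 + δ), y + (t * a) • w ∈ timelikeDom C e w := by
    have hopen := hO.preimage hlin
    obtain ⟨δ, hδ, hsub⟩ := (isCompact_Icc (a := (0 : ℝ)) (b := 1)).exists_cthickening_subset_open
      hopen (fun t ht => h t ht)
    refine ⟨δ, hδ, fun t ht => hsub ?_⟩
    rcases le_total t 0 with h0 | h0
    · refine Metric.mem_cthickening_of_dist_le t 0 δ _ (by simp) ?_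
      rw [Real.dist_eq, sub_zero, abs_of_nonpos h0]
      linarith [ht.1]
    rcases le_total 1 t with h1 | h1
    · refine Metric.mem_cthickening_of_dist_le t 1 δ _ (by simp) ?_
      rw [Real.dist_eq, abs_of_nonneg (by linarith)]
      linarith [ht.2]
    · exact Metric.self_subset_cthickening _ ⟨h0, h1⟩
  obtain ⟨φ, hφ, hφr, hφi⟩ := exists_smooth_retract hδ
  set c : ℝ → Model d := fun t => y + (φ t * a) • w with hc
  have hcs : ContDiff ℝ ∞ c := by fun_prop
  have hct : ∀ t, c t ∈ e.target := fun t => (hδO _ (hφr t)).1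
  refine ⟨fun t => e.symm (c t), ?_, fun t ht => ?_, ?_, ?_⟩
  · exact (contMDiffOn_symm_of_mem_maximalAtlas he).comp_contMDiff hcs.contMDiff hct
  · have hct' : c t = y + (t * a) • w := by
      simp only [hc]
      rw [(hφi t ht).eq_of_nhds, id]
    have hder : HasDerivAt c (a • w) t := by
      have h1 : HasDerivAt (fun t : ℝ => y + (t * a) • w) (a • w) t := by
        have := (((hasDerivAt_id t).mul_const a).smul_const w).const_add y
        simpa using this
      refine h1.congr_of_eventuallyEq ?_
      filter_upwards [hφi t ht] with s hs
      simp only [hc, hs, id]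
    have hsymm : MDifferentiableAt 𝓘(ℝ, Model d) 𝓘(ℝ, Model d) e.symm (c t) :=
      (mdifferentiable_of_mem_maximalAtlas he).mdifferentiableAt_symm (hct t)
    have hcm : HasMFDerivAt 𝓘(ℝ, ℝ) 𝓘(ℝ, Model d) c t
      (ContinuousLinearMap.toSpanSingleton ℝ (a • w)) :=
      hder.hasFDerivAt.hasMFDerivAt
    have hcomp := (hsymm.hasMFDerivAt.comp t hcm).mfderiv
    have hv : velocity (d := d) (fun t => e.symm (c t)) t =
        a • (mfderiv 𝓘(ℝ, Model d) 𝓘(ℝ, Model d) e.symm (c t) w) := by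
      refine (DFunLike.congr_fun hcomp (1 : ℝ)).trans ?_
      have : ContinuousLinearMap.toSpanSingleton ℝ (a • w) (1 : ℝ) = a • w := by simp
      refine (congrArg (mfderiv 𝓘(ℝ, Model d) 𝓘(ℝ, Model d) e.symm (c t)) this).trans ?_
      exact map_smul (mfderiv 𝓘(ℝ, Model d) 𝓘(ℝ, Model d) e.symm (c t)) a w
    have hmem : c t ∈ timelikeDom C e w := hδO _ (hφr t)
    rw [hv]
    exact C.smul_mem _ _ hmem.2 a ha
  · simp only [hc]
    rw [(hφi 0 (by simp)).eq_of_nhds]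
    simp
  · simp only [hc]
    rw [(hφi 1 (by simp)).eq_of_nhds]
    simp

/-- In a chart, points near `p` can be moved along a timelike coordinate direction. -/
theorem exists_chron_ball (C : ChronalCone d M) {e : OpenPartialHomeomorph M (Model d)}
    (he : e ∈ IsManifold.maximalAtlas 𝓘(ℝ, Model d) ∞ M) {p : M} (hp : p ∈ e.source)
    {v : TangentSpace 𝓘(ℝ, Model d) p} (hv : v ∈ C.cone p) :
    ∃ R > 0, Metric.ball (e p) R ⊆ timelikeDom C e (chartVec e p v) ∧
      ∀ y ∈ Metric.ball (e p) R, ∀ a : ℝ, 0 < a → y + a • chartVec e p v ∈ Metric.ball (e p) R →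
        Chron C (e.symm y) (e.symm (y + a • chartVec e p v)) := by
  obtain ⟨R, hR, hsub⟩ := Metric.isOpen_iff.1 (isOpen_timelikeDom C he _) _
    (mem_timelikeDom he hp hv)
  refine ⟨R, hR, hsub, fun y hy a ha hya => chron_segment C he ha fun t ht => hsub ?_⟩
  have := (convex_ball (e p) R) hy hya (sub_nonneg.2 ht.2) ht.1 (by ring)
  convert this using 1
  module

theorem ChronalCone.isOpen_cone (C : ChronalCone d M) (x : M) : IsOpen (C.cone x) :=
  C.isOpen.preimage (FiberBundle.continuous_totalSpaceMk (Model d)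
    (fun x : M => TangentSpace 𝓘(ℝ, Model d) x) x)

theorem ChronalCone.zero_notMem (C : ChronalCone d M) (x : M) :
    (0 : TangentSpace 𝓘(ℝ, Model d) x) ∉ C.cone x := by
  intro h
  let u : TangentSpace 𝓘(ℝ, Model d) x := EuclideanSpace.single (0 : Fin (d + 1)) (1 : ℝ)
  have hcone : ∀ v : TangentSpace 𝓘(ℝ, Model d) x, v ∈ C.cone x := by
    intro v
    have hc : Tendsto (fun a : ℝ => a • v) (𝓝[>] 0) (𝓝 ((0 : ℝ) • v)) :=
      ((continuous_id.smul continuous_const).tendsto (0 : ℝ)).mono_left nhdsWithin_le_nhds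
    rw [zero_smul] at hc
    obtain ⟨a, ha, hav⟩ := ((hc.eventually ((C.isOpen_cone x).mem_nhds h)).and
      self_mem_nhdsWithin).exists
    have := C.smul_mem x _ ha a⁻¹ (inv_pos.2 hav)
    rwa [smul_smul, inv_mul_cancel₀ (ne_of_gt hav), one_smul] at this
  have h0 := C.salient x u (subset_closure (hcone _)) (subset_closure (hcone _))
  have h1 : (EuclideanSpace.single (0 : Fin (d + 1)) (1 : ℝ) : Model d) 0 = 0 := by
    have : (EuclideanSpace.single (0 : Fin (d + 1)) (1 : ℝ) : Model d) = 0 := h0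
    rw [this]
    rfl
  simp at h1

variable [T2Space M] [SigmaCompactSpace M] {C : ChronalCone d M}

namespace Clock
variable (T : Clock C)

/-- A timelike curve can be reparametrized by the clock. -/
theorem exists_isNormal_of_chron {x y : M} (h : Chron C x y) : ∃ b : ℝ, 0 < b ∧ ∃ σ : ℝ → M,
    T.IsNormal σ (Icc 0 b) ∧ σ 0 = x ∧ σ b = y := by
  obtain ⟨γ, hγ, hcone, hx, hy⟩ := h
  set w : ℝ → ℝ := fun t => T.lam (γ t) (velocity (d := d) γ t) with hw
  have hwc : Continuous w := by
    have h1 := continuousOn_tangent_pushforward isOpen_univ hγ.contMDiffOn (1 : ℝ)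
    exact (continuous_sec_apply T.lam).comp (continuousOn_univ.1 h1)
  -- the clock time elapsed along the curve
  set s : ℝ → ℝ := fun t => ∫ τ in (0 : ℝ)..t, w τ with hs
  have hsd : ∀ t, HasDerivAt s (w t) t := fun t => (hwc.integral_hasStrictDerivAt 0 t).hasDerivAt
  have hsc : Continuous s := continuous_iff_continuousAt.2 fun t => (hsd t).continuousAt
  have hcl : ∀ t ∈ Icc (0 : ℝ) 1, velocity γ t ∈ closure (C.cone (γ t)) :=
    fun t ht => subset_closure (hcone t ht)
  have hwpos : ∀ t ∈ Icc (0 : ℝ) 1, 0 < w t := fun t ht => by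
    refine T.lam_pos (hcl t ht) fun h0 => ?_
    have := hcone t ht
    rw [h0] at this
    exact C.zero_notMem _ this
  have hmono : StrictMonoOn s (Icc 0 1) := by
    refine strictMonoOn_of_deriv_pos (convex_Icc 0 1) hsc.continuousOn fun t ht => ?_
    rw [interior_Icc] at ht
    rw [(hsd t).deriv]
    exact hwpos t ⟨ht.1.le, ht.2.le⟩
  have hs0 : s 0 = 0 := by simp [hs]
  have hs1 : 0 < s 1 := by
    have := hmono (left_mem_Icc.2 zero_le_one) (right_mem_Icc.2 zero_le_one) zero_lt_one
    rwa [hs0] at this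
  have hivt : ∀ u ∈ Icc 0 (s 1), ∃ t ∈ Icc (0 : ℝ) 1, s t = u := by
    have := intermediate_value_Icc (zero_le_one (α := ℝ)) hsc.continuousOn
    rw [hs0] at this
    exact this
  choose! inv hinv hsinv using hivt
  refine ⟨s 1, hs1, fun u => γ (inv u), ?_, ?_, ?_⟩
  · intro f g L hf hg hL hfg hgL u hu u' hu' huu
    have hle : inv u ≤ inv u' := by
      rw [← hmono.le_iff_le (hinv u hu) (hinv u' hu'), hsinv u hu, hsinv u' hu']
      exact huu
    set a := inv u
    set b := inv u'
    have hsub : Icc a b ⊆ Icc 0 1 := Icc_subset_Icc (hinv u hu).1 (hinv u' hu').2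
    have hmd : ∀ t, MDifferentiableAt 𝓘(ℝ, ℝ) 𝓘(ℝ, Model d) γ t := fun t =>
      hγ.mdifferentiableAt (by simp)
    have hfd := fun t => hasDerivAt_comp_curve hf (hmd t)
    have hgd := fun t => hasDerivAt_comp_curve hg (hmd t)
    -- first order estimate for `g`
    have hgle : ∀ r ∈ Icc a b, g (γ r) ≤ g (γ a) + L * (s r - s a) := by
      have : MonotoneOn (fun r => L * s r - g (γ r)) (Icc a b) := by
        have hd : ∀ r, HasDerivAt (fun r => L * s r - g (γ r))
          (L * w r - differential g (γ r) (velocity γ r)) r := fun r =>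
            ((hsd r).const_mul L).sub (hgd r)
        refine monotoneOn_of_deriv_nonneg (convex_Icc a b)
          (fun r _ => (hd r).continuousAt.continuousWithinAt)
          (fun r _ => (hd r).differentiableAt.differentiableWithinAt) fun r hr => ?_
        rw [(hd r).deriv]
        rw [interior_Icc] at hr
        exact sub_nonneg.2 (hgL _ _ (hcl r (hsub ⟨hr.1.le, hr.2.le⟩)))
      intro r hr
      have := this (left_mem_Icc.2 hle) hr hr.1
      simp only at this
      linarith
    -- the first order estimate for `g` integrates to a second order estimate for `f`
    have : MonotoneOn (fun r => (s r - s a) * g (γ a) + L * (s r - s a) ^ 2 - f (γ r))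
      (Icc a b) := by
      have hd : ∀ r, HasDerivAt (fun r => (s r - s a) * g (γ a) + L * (s r - s a) ^ 2 - f (γ r))
          (w r * g (γ a) + L * (2 * (s r - s a) * w r) - differential f (γ r) (velocity γ r)) r :=
            fun r => by
        have h1 := (hsd r).sub_const (s a)
        have h2 := ((h1.mul_const (g (γ a))).add ((h1.pow 2).const_mul L)).sub (hfd r)
        refine h2.congr_deriv ?_
        norm_num
        rfl
      refine monotoneOn_of_deriv_nonneg (convex_Icc a b)
        (fun r _ => (hd r).continuousAt.continuousWithinAt)
        (fun r _ => (hd r).differentiableAt.differentiableWithinAt) fun r hr => ?_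
      rw [(hd r).deriv]
      rw [interior_Icc] at hr
      have hr' : r ∈ Icc a b := ⟨hr.1.le, hr.2.le⟩
      have h1 := hfg _ _ (hcl r (hsub hr'))
      have h2 := mul_le_mul_of_nonneg_right (hgle r hr') (hwpos r (hsub hr')).le
      have h3 : 0 ≤ s r - s a := sub_nonneg.2
        (hmono.monotoneOn (hsub (left_mem_Icc.2 hle)) (hsub hr') hr'.1)
      have h4 : 0 ≤ L * (s r - s a) * w r := mul_nonneg (mul_nonneg hL h3) (hwpos r (hsub hr')).le
      change differential f (γ r) (velocity γ r) ≤ g (γ r) * w r at h1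
      linarith
    have := this (left_mem_Icc.2 hle) (right_mem_Icc.2 hle) hle
    simp only [sub_self, a, b, hsinv u hu, hsinv u' hu'] at this
    simp only [zero_mul, mul_zero, ne_eq, OfNat.ofNat_ne_zero, not_false_eq_true, zero_pow] at this
    linarith
  · have h0 : (0 : ℝ) ∈ Icc 0 (s 1) := ⟨le_rfl, hs1.le⟩
    have : inv 0 = 0 := hmono.injOn (hinv 0 h0) (by simp) (by rw [hsinv 0 h0, hs0])
    simp only [this, hx]
  · have h0 : s 1 ∈ Icc 0 (s 1) := ⟨hs1.le, le_rfl⟩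
    have : inv (s 1) = 1 := hmono.injOn (hinv _ h0) (by simp) (by rw [hsinv _ h0])
    simp only [this, hy]

end Clock

end

/-! ### Normalized curves are causal -/

section
variable [T2Space M] [SigmaCompactSpace M] {C : ChronalCone d M}

namespace Clock
variable {T : Clock C}

/-- Compactly supported smooth functions are Lipschitz along normalized curves. -/
theorem IsNormal.exists_lipschitz {γ : ℝ → M} {J : Set ℝ} (h : T.IsNormal γ J) {f : M → ℝ}
    (hf : SmoothFun (d := d) f) (hc : HasCompactSupport f) :
    ∃ L : ℝ, 0 ≤ L ∧ ∀ s ∈ J, ∀ t ∈ J, |f (γ s) - f (γ t)| ≤ L * |s - t| := by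
  obtain ⟨L₁, hL₁, h₁⟩ := T.exists_dom_of_hasCompactSupport hf hc
  obtain ⟨L₂, hL₂, h₂⟩ := T.exists_dom_of_hasCompactSupport hf.neg hc.neg
  have key : ∀ s ∈ J, ∀ t ∈ J, s ≤ t → |f (γ s) - f (γ t)| ≤ (L₁ + L₂) * |s - t| := by
    intro s hs t ht hst
    have e₁ := h.sub_le hf h₁ hs ht hst
    have e₂ := h.sub_le hf.neg h₂ hs ht hst
    change -f (γ t) - -f (γ s) ≤ _ at e₂
    rw [abs_sub_comm s t, abs_of_nonneg (sub_nonneg.2 hst), abs_le]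
    have := mul_nonneg hL₁ (sub_nonneg.2 hst)
    have := mul_nonneg hL₂ (sub_nonneg.2 hst)
    constructor <;> linarith
  refine ⟨L₁ + L₂, by positivity, fun s hs t ht => ?_⟩
  rcases le_total s t with hst | hst
  · exact key s hs t ht hst
  · rw [abs_sub_comm, abs_sub_comm s]
    exact key t ht s hs hst

theorem IsNormal.continuousOn {γ : ℝ → M} {J : Set ℝ} (h : T.IsNormal γ J) :
    ContinuousOn γ J := by
  intro t ht
  rw [ContinuousWithinAt, (SmoothBumpFunction.nhds_basis_tsupport (I := 𝓘(ℝ, Model d))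
    (γ t)).tendsto_right_iff]
  intro η _
  obtain ⟨L, hL, hlip⟩ := h.exists_lipschitz η.contMDiff η.hasCompactSupport
  have hlim : Tendsto (fun s => 1 - L * |s - t|) (𝓝[J] t) (𝓝 (1 - L * |t - t|)) :=
    (Continuous.tendsto (by fun_prop) t).mono_left nhdsWithin_le_nhds
  simp only [sub_self, abs_zero, mul_zero, sub_zero] at hlim
  filter_upwards [hlim.eventually_const_lt zero_lt_one, self_mem_nhdsWithin] with s hs hsJ
  have h1 := hlip s hsJ t ht
  have h2 : η (γ t) = 1 := η.eq_one
  rw [h2, abs_le] at h1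
  refine subset_tsupport _ ?_
  have : 0 < η (γ s) := by linarith
  exact this.ne'

theorem norm_le_sum_abs (x : Model d) : ‖x‖ ≤ ∑ i, |x i| := by
  have h : x = ∑ i, (x i) • EuclideanSpace.single i (1 : ℝ) := by
    ext j
    simp [Pi.single_apply]
  calc ‖x‖ = ‖∑ i, (x i) • EuclideanSpace.single i (1 : ℝ)‖ := by rw [← h]
    _ ≤ ∑ i, ‖(x i) • EuclideanSpace.single i (1 : ℝ)‖ := norm_sum_le _ _
    _ = ∑ i, |x i| := by simp [norm_smul]

/-- Normalized curves are locally Lipschitz: the coordinates of a chart, multiplied by a bump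
function, are compactly supported smooth functions. -/
theorem IsNormal.exists_lipschitzOnWith {γ : ℝ → M} {J : Set ℝ} (h : T.IsNormal γ J) {t : ℝ}
    (ht : t ∈ J) : ∃ K, ∃ N ∈ 𝓝[J] t,
      LipschitzOnWith K (fun τ => chartAt (Model d) (γ t) (γ τ)) N ∧
      ∀ τ ∈ N, γ τ ∈ (chartAt (Model d) (γ t)).source := by
  obtain ⟨η⟩ : Nonempty (SmoothBumpFunction 𝓘(ℝ, Model d) (γ t)) := inferInstance
  set p := γ t with hp
  have hlip : ∀ i : Fin (d + 1), ∃ L : ℝ, 0 ≤ L ∧ ∀ s ∈ J, ∀ τ ∈ J,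
      |η (γ s) • (chartAt (Model d) p (γ s) i) - η (γ τ) • (chartAt (Model d) p (γ τ) i)| ≤
        L * |s - τ| := by
    intro i
    have hsm : SmoothFun (d := d) (fun x => η x • (chartAt (Model d) p x i)) := by
      refine η.contMDiff_smul ?_
      exact (EuclideanSpace.proj i : Model d →L[ℝ] ℝ).contMDiff.comp_contMDiffOn
        (contMDiffOn_chart (x := p))
    exact h.exists_lipschitz hsm η.hasCompactSupport.smul_right
  choose L hL hLip using hlip
  refine ⟨Real.toNNReal (∑ i, L i),
    {τ | τ ∈ J ∧ η (γ τ) = 1 ∧ γ τ ∈ (chartAt (Model d) p).source}, ?_, ?_, fun τ hτ => hτ.2.2⟩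
  · have h1 := (h.continuousOn t ht).eventually (η.eventuallyEq_one)
    have h2 := (h.continuousOn t ht).eventually (chart_source_mem_nhds (Model d) (γ t))
    filter_upwards [h1, h2, self_mem_nhdsWithin] with τ h1 h2 h3 using ⟨h3, h1, h2⟩
  · refine LipschitzOnWith.of_dist_le_mul ?_
    rintro s ⟨hs, hs1, -⟩ τ ⟨hτ, hτ1, -⟩
    rw [dist_eq_norm, Real.dist_eq]
    refine (norm_le_sum_abs _).trans ?_
    rw [Real.coe_toNNReal _ (Finset.sum_nonneg fun i _ => hL i), Finset.sum_mul]
    refine Finset.sum_le_sum fun i _ => ?_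
    have := hLip i s hs τ hτ
    rwa [hs1, hτ1, one_smul, one_smul] at this

/-- A linear functional bounded on the closed cone by `a` times the clock form is at most `a` on the
velocity. This is the derivative at zero of the Taylor inequality for the extension of the
functional given by `exists_local_dom`. -/
theorem IsNormal.linear_velocity_le {γ : ℝ → M} {J : Set ℝ} (h : T.IsNormal γ J) {t : ℝ}
    (ht : t ∈ interior J) (hd : MDifferentiableAt 𝓘(ℝ, ℝ) 𝓘(ℝ, Model d) γ t)
    (ℓ : Model d →L[ℝ] ℝ) {a : ℝ}
    (hℓ : ∀ v : Model d, v ∈ closure (C.cone (γ t)) → ℓ v ≤ a * T.lam (γ t) v) :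
    ℓ (velocity (d := d) γ t) ≤ a := by
  refine le_of_forall_pos_le_add fun ε hε => ?_
  obtain ⟨f, g, L, hf, hg, hL, hfg, hgL, hfe, hge⟩ := T.exists_local_dom (γ t) ℓ hℓ hε
  have h1 := (hasDerivAt_comp_curve hf hd).tendsto_slope_zero_right
  have e : differential f (γ t) (velocity (d := d) γ t) = ℓ (velocity (d := d) γ t) :=
    differential_chart (γ t) ℓ hfe _
  rw [e] at h1
  have h2 : Tendsto (fun δ : ℝ => a + ε + L * δ) (𝓝[>] 0) (𝓝 (a + ε + L * 0)) :=
    (Continuous.tendsto (by fun_prop) (0 : ℝ)).mono_left nhdsWithin_le_nhds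
  rw [mul_zero, add_zero] at h2
  refine le_of_tendsto_of_tendsto h1 h2 ?_
  have h3 : ∀ᶠ δ in 𝓝[>] (0 : ℝ), t + δ ∈ J := by
    have : Tendsto (fun δ : ℝ => t + δ) (𝓝[>] 0) (𝓝 (t + 0)) :=
      (Continuous.tendsto (by fun_prop) (0 : ℝ)).mono_left nhdsWithin_le_nhds
    rw [add_zero] at this
    exact this.eventually (mem_interior_iff_mem_nhds.1 ht)
  filter_upwards [h3, self_mem_nhdsWithin] with δ hδ hδ0
  have hδ0 : 0 < δ := hδ0
  have := h f g L hf hg hL hfg hgL t (interior_subset ht) (t + δ) hδ (by linarith)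
  rw [hge.eq_of_nhds, add_sub_cancel_left] at this
  rw [smul_eq_mul, inv_mul_eq_div, div_le_iff₀ hδ0]
  linarith

theorem _root_.Peierls.ChronalCone.zero_mem_closure (C : ChronalCone d M) (x : M) :
    (0 : TangentSpace 𝓘(ℝ, Model d) x) ∈ closure (C.cone x) := by
  obtain ⟨v, hv⟩ := C.nonempty x
  have hc : Tendsto (fun a : ℝ => a • v) (𝓝[>] 0) (𝓝 ((0 : ℝ) • v)) :=
    ((continuous_id.smul continuous_const).tendsto (0 : ℝ)).mono_left nhdsWithin_le_nhds
  rw [zero_smul] at hc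
  exact mem_closure_of_tendsto hc (eventually_mem_nhdsWithin.mono fun a ha =>
    C.smul_mem x v hv a ha)

/-- Where it exists, the velocity of a normalized curve lies in the closed cone by the Hahn-Banach
theorem, and it is non-zero as the clock form is at least `1` on it. -/
theorem IsNormal.velocity_mem {γ : ℝ → M} {J : Set ℝ} (h : T.IsNormal γ J) {t : ℝ}
    (ht : t ∈ interior J) (hd : MDifferentiableAt 𝓘(ℝ, ℝ) 𝓘(ℝ, Model d) γ t) :
    velocity (d := d) γ t ∈ closure (C.cone (γ t)) ∧ velocity (d := d) γ t ≠ 0 := by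
  constructor
  · by_contra hv
    let D : Set (Model d) := closure (C.cone (γ t))
    have hDc : IsClosed D := _root_.isClosed_closure (X := TangentSpace 𝓘(ℝ, Model d) (γ t))
    have hDconv : Convex ℝ D := (C.convex (γ t)).closure
    let w₀ : Model d := velocity (d := d) γ t
    have hw₀ : w₀ ∉ D := hv
    obtain ⟨ℓ, u, hℓ, hu⟩ := geometric_hahn_banach_closed_point hDconv hDc hw₀
    have hu0 : 0 < u := by simpa using hℓ 0 (C.zero_mem_closure (γ t))
    have hneg : ∀ w ∈ D, ℓ w ≤ 0 := by
      intro w hw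
      by_contra! hpos
      have := hℓ _ (C.smul_mem_closure hw (div_pos hu0 hpos))
      have h2 : ℓ ((u / ℓ w) • w) = u := by
        rw [map_smul, smul_eq_mul, div_mul_cancel₀ _ hpos.ne']
      exact absurd h2 this.ne
    have h1 : ℓ w₀ ≤ 0 :=
      h.linear_velocity_le ht hd ℓ (a := 0) (fun w hw => by simpa using hneg w hw)
    linarith
  · intro h0
    let l : Model d →L[ℝ] ℝ := T.lam (γ t)
    have := h.linear_velocity_le ht hd (-l) (a := -1) (fun w hw => by
      rw [neg_one_mul]; exact le_refl _)
    have h1 : (-l) (velocity (d := d) γ t) = 0 := (congrArg (-l) h0).trans (map_zero (-l))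
    rw [h1] at this
    linarith

/-- Normalized curves are causal: by Rademacher's theorem they are differentiable almost everywhere.
-/
theorem IsNormal.isCausalCurveOn {γ : ℝ → M} {J : Set ℝ} (h : T.IsNormal γ J)
    (hJ : J.OrdConnected) : IsCausalCurveOn C γ J := by
  refine ⟨h.continuousOn, fun t ht => ?_, ?_⟩
  · obtain ⟨K, N, hN, hK, -⟩ := h.exists_lipschitzOnWith ht
    exact ⟨K, N, hN, hK⟩
  rw [ae_restrict_iff' hJ.measurableSet]
  have hfr : ∀ᵐ t : ℝ, t ∉ frontier J := by
    have : volume (frontier J) = 0 := hJ.convex.addHaar_frontier volume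
    exact measure_eq_zero_iff_ae_notMem.1 this
  have hdiff : ∀ᵐ t : ℝ, t ∉ {t | t ∈ interior J ∧
    ¬ MDifferentiableAt 𝓘(ℝ, ℝ) 𝓘(ℝ, Model d) γ t} := by
    refine measure_eq_zero_iff_ae_notMem.1 (measure_null_of_locally_null _ fun t ht => ?_)
    obtain ⟨K, N, hN, hK, hsrc⟩ := h.exists_lipschitzOnWith (interior_subset ht.1)
    have hN' : N ∩ interior J ∈ 𝓝 t := by
      have h1 : 𝓝[J] t = 𝓝 t := nhdsWithin_eq_nhds.2 (mem_interior_iff_mem_nhds.1 ht.1)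
      rw [h1] at hN
      exact inter_mem hN (isOpen_interior.mem_nhds ht.1)
    obtain ⟨O, hON, hO, htO⟩ := mem_nhds_iff.1 hN'
    refine ⟨_, inter_mem_nhdsWithin _ (hO.mem_nhds htO), ?_⟩
    have hae := (hK.mono (hON.trans inter_subset_left)).ae_differentiableWithinAt_of_mem_real
    rw [measure_eq_zero_iff_ae_notMem]
    filter_upwards [hae] with τ hτ hmem
    obtain ⟨⟨hτJ, hnd⟩, hτO⟩ := hmem
    refine hnd ?_
    have hd := (hτ hτO).differentiableAt (hO.mem_nhds hτO)
    have hs : γ τ ∈ (chartAt (Model d) (γ t)).source := hsrc τ (hON hτO).1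
    have h1 := ((mdifferentiable_chart (I := 𝓘(ℝ, Model d)) (γ t)).mdifferentiableAt_symm
      ((chartAt (Model d) (γ t)).map_source hs)).comp τ hd.mdifferentiableAt
    refine h1.congr_of_eventuallyEq ?_
    filter_upwards [hO.mem_nhds hτO] with s hsO
    exact ((chartAt (Model d) (γ t)).left_inv (hsrc s (hON hsO).1)).symm
  filter_upwards [hfr, hdiff] with t h1 h2 htJ
  have hint : t ∈ interior J := by
    by_contra hcon
    exact h1 ⟨subset_closure htJ, hcon⟩
  have hd : MDifferentiableAt 𝓘(ℝ, ℝ) 𝓘(ℝ, Model d) γ t := by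
    by_contra hcon
    exact h2 ⟨hint, hcon⟩
  exact ⟨hd, h.velocity_mem hint hd⟩

/-- Normalized rays have no endpoint: near a limit point, a local primitive of minus the clock form
(to first order) would decrease at a definite rate along the ray. -/
theorem IsNormal.not_tendsto_atTop {γ : ℝ → M} {a : ℝ} (h : T.IsNormal γ (Ici a)) (p : M) :
    ¬ Tendsto γ atTop (𝓝 p) := by
  intro hlim
  let l : Model d →L[ℝ] ℝ := T.lam p
  obtain ⟨f, g, L, hf, hg, hL, hfg, hgL, hfe, hge⟩ := T.exists_local_dom p (-l) (a := -1)
    (fun w hw => by rw [neg_one_mul]; exact le_refl _) (ε := 1 / 2) (by norm_num)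
  obtain ⟨δ, hδ, hδL⟩ : ∃ δ : ℝ, 0 < δ ∧ L * δ ≤ 1 / 4 := by
    refine ⟨1 / (4 * (L + 1)), by positivity, ?_⟩
    rw [mul_one_div, div_le_iff₀ (by positivity)]
    linarith
  have h1 : Tendsto (fun t => f (γ t)) atTop (𝓝 (f p)) := (hf.continuous.tendsto p).comp hlim
  have h2 : Tendsto (fun t => f (γ (t + δ)) - f (γ t)) atTop (𝓝 (f p - f p)) :=
    (h1.comp (tendsto_atTop_add_const_right _ δ tendsto_id)).sub h1
  rw [sub_self] at h2
  have h3 : ∀ᶠ t in atTop, f (γ (t + δ)) - f (γ t) ≤ -(δ / 4) := by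
    filter_upwards [hlim.eventually hge, eventually_ge_atTop a] with t ht hta
    have := h f g L hf hg hL hfg hgL t hta (t + δ) (by simp only [mem_Ici] at *; linarith)
      (by linarith)
    rw [ht, add_sub_cancel_left] at this
    nlinarith
  have := le_of_tendsto h2 h3
  linarith

end Clock
end

/-! ### Concatenation and reversal of causal curves -/

section
variable {C : ChronalCone d M}

/-- `γ` is differentiable at `t` with non-zero velocity in the closed cone. -/
def CausalAt (C : ChronalCone d M) (γ : ℝ → M) (t : ℝ) : Prop :=
  MDifferentiableAt 𝓘(ℝ, ℝ) 𝓘(ℝ, Model d) γ t ∧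
    velocity (d := d) γ t ∈ closure (C.cone (γ t)) ∧ velocity (d := d) γ t ≠ 0

theorem CausalAt.congr {γ σ : ℝ → M} {t : ℝ} (h : CausalAt C γ t) (he : σ =ᶠ[𝓝 t] γ) :
    CausalAt C σ t := by
  obtain ⟨h1, h2, h3⟩ := h
  have hv : (velocity (d := d) σ t : Model d) = velocity (d := d) γ t :=
    DFunLike.congr_fun (he.mfderiv_eq (I := 𝓘(ℝ, ℝ)) (I' := 𝓘(ℝ, Model d))) (1 : ℝ)
  have key : ∀ q : M, q = γ t → ∀ z : Model d, z = velocity (d := d) γ t →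
      (z : TangentSpace 𝓘(ℝ, Model d) q) ∈ closure (C.cone q) ∧
      (z : TangentSpace 𝓘(ℝ, Model d) q) ≠ 0 := by
    rintro q rfl z rfl
    exact ⟨h2, h3⟩
  exact ⟨h1.congr_of_eventuallyEq he, key _ he.eq_of_nhds _ hv⟩

theorem lipschitzOnWith_union_of_le {E : Type*} [PseudoMetricSpace E] {f : ℝ → E} {K : NNReal}
    {m : ℝ}
    {N₁ N₂ : Set ℝ} (h₁ : LipschitzOnWith K f N₁) (h₂ : LipschitzOnWith K f N₂) (hm₁ : m ∈ N₁)
    (hm₂ : m ∈ N₂) (hN₁ : N₁ ⊆ Iic m) (hN₂ : N₂ ⊆ Ici m) : LipschitzOnWith K f (N₁ ∪ N₂) := by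
  have key : ∀ s ∈ N₁, ∀ t ∈ N₂, dist (f s) (f t) ≤ K * dist s t := by
    intro s hs t ht
    have e1 := h₁.dist_le_mul s hs m hm₁
    have e2 := h₂.dist_le_mul m hm₂ t ht
    have e3 : dist s t = dist s m + dist m t := by
      have := hN₁ hs
      have := hN₂ ht
      simp only [mem_Iic, mem_Ici, Real.dist_eq] at *
      rw [abs_of_nonpos, abs_of_nonpos, abs_of_nonpos] <;> linarith
    rw [e3, mul_add]
    exact (dist_triangle _ _ _).trans (add_le_add e1 e2)
  refine LipschitzOnWith.of_dist_le_mul ?_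
  rintro s (hs | hs) t (ht | ht)
  · exact h₁.dist_le_mul s hs t ht
  · exact key s hs t ht
  · rw [dist_comm, dist_comm s]
    exact key t ht s hs
  · exact h₂.dist_le_mul s hs t ht

/-- Two causal curves meeting at the parameter `m` can be joined. -/
theorem IsCausalCurveOn.glue {γ₁ γ₂ : ℝ → M} {J : Set ℝ} {m : ℝ}
    (h₁ : IsCausalCurveOn C γ₁ (J ∩ Iic m)) (h₂ : IsCausalCurveOn C γ₂ (J ∩ Ici m)) (hm : m ∈ J)
    (hJ : MeasurableSet J) (he : γ₁ m = γ₂ m) :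
    IsCausalCurveOn C (fun t => if t ≤ m then γ₁ t else γ₂ t) J := by
  set γ : ℝ → M := fun t => if t ≤ m then γ₁ t else γ₂ t with hγ
  have e₁ : EqOn γ γ₁ (Iic m) := fun t ht => if_pos ht
  have e₂ : EqOn γ γ₂ (Ici m) := fun t ht => by
    rcases (mem_Ici.1 ht).eq_or_lt with rfl | hlt
    · rw [e₁ (le_refl m : m ∈ Iic m), he]
    · exact if_neg (not_le.2 hlt)
  have hunion : J = (J ∩ Iic m) ∪ (J ∩ Ici m) := by
    rw [← inter_union_distrib_left, Iic_union_Ici, inter_univ]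
  have c₁ : ContinuousOn γ (J ∩ Iic m) := h₁.1.congr (e₁.mono inter_subset_right)
  have c₂ : ContinuousOn γ (J ∩ Ici m) := h₂.1.congr (e₂.mono inter_subset_right)
  have l₁ : ∀ t ∈ J ∩ Iic m, ∃ K, ∃ N ∈ 𝓝[J ∩ Iic m] t, N ⊆ Iic m ∧
      LipschitzOnWith K (fun τ => chartAt (Model d) (γ t) (γ τ)) N := by
    intro t ht
    obtain ⟨K, N, hN, hK⟩ := h₁.2.1 t ht
    refine ⟨K, N ∩ (J ∩ Iic m), inter_mem hN self_mem_nhdsWithin,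
      inter_subset_right.trans inter_subset_right, ?_⟩
    rw [e₁ ht.2]
    intro a ha b hb
    simp only [e₁ ha.2.2, e₁ hb.2.2]
    exact hK ha.1 hb.1
  have l₂ : ∀ t ∈ J ∩ Ici m, ∃ K, ∃ N ∈ 𝓝[J ∩ Ici m] t, N ⊆ Ici m ∧
      LipschitzOnWith K (fun τ => chartAt (Model d) (γ t) (γ τ)) N := by
    intro t ht
    obtain ⟨K, N, hN, hK⟩ := h₂.2.1 t ht
    refine ⟨K, N ∩ (J ∩ Ici m), inter_mem hN self_mem_nhdsWithin,
      inter_subset_right.trans inter_subset_right, ?_⟩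
    rw [e₂ ht.2]
    intro a ha b hb
    simp only [e₂ ha.2.2, e₂ hb.2.2]
    exact hK ha.1 hb.1
  refine ⟨?_, fun t ht => ?_, ?_⟩
  · intro t ht
    rw [hunion]
    refine ContinuousWithinAt.union ?_ ?_
    · rcases le_or_gt t m with htm | htm
      · exact c₁ t ⟨ht, htm⟩
      · refine continuousWithinAt_of_notMem_closure fun h => ?_
        have := closure_mono (inter_subset_right (s := J)) h
        rw [isClosed_Iic.closure_eq] at this
        exact absurd this (not_le.2 htm)
    · rcases le_or_gt m t with htm | htm
      · exact c₂ t ⟨ht, htm⟩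
      · refine continuousWithinAt_of_notMem_closure fun h => ?_
        have := closure_mono (inter_subset_right (s := J)) h
        rw [isClosed_Ici.closure_eq] at this
        exact absurd this (not_le.2 htm)
  · rcases lt_trichotomy t m with htm | rfl | htm
    · obtain ⟨K, N, hN, -, hK⟩ := l₁ t ⟨ht, htm.le⟩
      refine ⟨K, N, ?_, hK⟩
      rwa [nhdsWithin_inter_of_mem' (mem_nhdsWithin_of_mem_nhds (Iic_mem_nhds htm))] at hN
    · obtain ⟨K₁, N₁, hN₁, hm₁, hK₁⟩ := l₁ t ⟨ht, le_refl t⟩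
      obtain ⟨K₂, N₂, hN₂, hm₂, hK₂⟩ := l₂ t ⟨ht, le_refl t⟩
      refine ⟨max K₁ K₂, N₁ ∪ N₂, ?_, lipschitzOnWith_union_of_le
        (hK₁.weaken (le_max_left _ _)) (hK₂.weaken (le_max_right _ _))
        (mem_of_mem_nhdsWithin (s := J ∩ Iic t) ⟨ht, le_refl t⟩ hN₁)
        (mem_of_mem_nhdsWithin (s := J ∩ Ici t) ⟨ht, le_refl t⟩ hN₂) hm₁ hm₂⟩
      rw [hunion, nhdsWithin_union]
      exact ⟨mem_of_superset hN₁ subset_union_left, mem_of_superset hN₂ subset_union_right⟩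
    · obtain ⟨K, N, hN, -, hK⟩ := l₂ t ⟨ht, htm.le⟩
      refine ⟨K, N, ?_, hK⟩
      rwa [nhdsWithin_inter_of_mem' (mem_nhdsWithin_of_mem_nhds (Ici_mem_nhds htm))] at hN
  · have a₁ := (ae_restrict_iff' (hJ.inter measurableSet_Iic)).1 h₁.2.2
    have a₂ := (ae_restrict_iff' (hJ.inter measurableSet_Ici)).1 h₂.2.2
    rw [ae_restrict_iff' hJ]
    filter_upwards [a₁, a₂, measure_eq_zero_iff_ae_notMem.1
      (measure_singleton m)] with t h1 h2 h3 ht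
    rcases lt_trichotomy t m with htm | rfl | htm
    · refine CausalAt.congr (C := C) (h1 ⟨ht, htm.le⟩) ?_
      filter_upwards [Iic_mem_nhds htm] with s hs using e₁ hs
    · exact absurd rfl h3
    · refine CausalAt.congr (C := C) (h2 ⟨ht, htm.le⟩) ?_
      filter_upwards [Ici_mem_nhds htm] with s hs using e₂ hs

theorem IsCausalCurveOn.mono {γ : ℝ → M} {J J' : Set ℝ} (h : IsCausalCurveOn C γ J) (hJ : J' ⊆ J) :
    IsCausalCurveOn C γ J' := by
  refine ⟨h.1.mono hJ, fun t ht => ?_, ae_restrict_of_ae_restrict_of_subset hJ h.2.2⟩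
  obtain ⟨K, N, hN, hK⟩ := h.2.1 t (hJ ht)
  exact ⟨K, N, nhdsWithin_mono t hJ hN, hK⟩

theorem CausalAt.comp_affine {γ : ℝ → M} {a t : ℝ} (h : CausalAt C γ (t + a)) :
    CausalAt C (fun t => γ (t + a)) t := by
  obtain ⟨h1, h2, h3⟩ := h
  have hd : HasMFDerivAt 𝓘(ℝ, ℝ) 𝓘(ℝ, ℝ) (fun t : ℝ => t + a) t (ContinuousLinearMap.id ℝ ℝ) :=
    ((hasFDerivAt_id t).add_const a).hasMFDerivAt
  have hc := h1.hasMFDerivAt.comp t hd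
  have hv : (velocity (d := d) (fun t => γ (t + a)) t : Model d) = velocity (d := d) γ (t + a) :=
    DFunLike.congr_fun hc.mfderiv (1 : ℝ)
  refine ⟨hc.mdifferentiableAt, ?_⟩
  rw [show velocity (d := d) (fun t => γ (t + a)) t = _ from hv]
  exact ⟨h2, h3⟩

theorem IsCausalCurveOn.comp_add {γ : ℝ → M} {J : Set ℝ} (h : IsCausalCurveOn C γ J)
    (hJ : MeasurableSet J) (a : ℝ) : IsCausalCurveOn C (fun t => γ (t + a)) ((· + a) ⁻¹' J) := by
  have hmaps : MapsTo (· + a) ((· + a) ⁻¹' J) J := fun t ht => ht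
  refine ⟨h.1.comp (by fun_prop) hmaps, fun t ht => ?_, ?_⟩
  · obtain ⟨K, N, hN, hK⟩ := h.2.1 (t + a) ht
    refine ⟨K, (· + a) ⁻¹' N, ?_, ?_⟩
    · exact (((continuous_add_const a).continuousWithinAt).tendsto_nhdsWithin hmaps) hN
    · intro x hx y hy
      have := hK hx hy
      rwa [edist_add_right] at this
  · rw [ae_restrict_iff' (measurable_add_const a hJ)]
    have h1 := (ae_restrict_iff' hJ).1 h.2.2
    filter_upwards [(measurePreserving_add_right volume a).quasiMeasurePreserving.ae h1]
      with t ht htJ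
    exact CausalAt.comp_affine (C := C) (ht htJ)

theorem CausalAt.comp_neg {γ : ℝ → M} {t : ℝ} (h : CausalAt C γ (-t)) :
    CausalAt C.opp (fun t => γ (-t)) t := by
  obtain ⟨h1, h2, h3⟩ := h
  have hd : HasMFDerivAt 𝓘(ℝ, ℝ) 𝓘(ℝ, ℝ) (fun t : ℝ => -t) t (-ContinuousLinearMap.id ℝ ℝ) :=
    ((hasFDerivAt_id t).neg).hasMFDerivAt
  have hc := h1.hasMFDerivAt.comp t hd
  have hv : (velocity (d := d) (fun t => γ (-t)) t : TangentSpace 𝓘(ℝ, Model d) (γ (-t))) =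
      -velocity (d := d) γ (-t) :=
    (DFunLike.congr_fun hc.mfderiv (1 : ℝ)).trans
      (map_neg (mfderiv 𝓘(ℝ, ℝ) 𝓘(ℝ, Model d) γ (-t)) (1 : ℝ))
  refine ⟨hc.mdifferentiableAt, ?_, ?_⟩
  · rw [hv]
    change _ ∈ closure (-(C.cone (γ (-t))))
    rw [← neg_closure]
    simpa using h2
  · rw [hv]
    simpa using h3

theorem IsCausalCurveOn.comp_neg {γ : ℝ → M} {J : Set ℝ} (h : IsCausalCurveOn C γ J)
    (hJ : MeasurableSet J) : IsCausalCurveOn C.opp (fun t => γ (-t)) ((fun t => -t) ⁻¹' J) := by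
  have hmaps : MapsTo (fun t : ℝ => -t) ((fun t => -t) ⁻¹' J) J := fun t ht => ht
  refine ⟨h.1.comp (by fun_prop) hmaps, fun t ht => ?_, ?_⟩
  · obtain ⟨K, N, hN, hK⟩ := h.2.1 (-t) ht
    refine ⟨K, (fun t => -t) ⁻¹' N, ?_, ?_⟩
    · exact ((continuous_neg.continuousWithinAt).tendsto_nhdsWithin hmaps) hN
    · intro x hx y hy
      have := hK hx hy
      rwa [edist_neg_neg] at this
  · rw [ae_restrict_iff' (measurable_neg hJ)]
    have h1 := (ae_restrict_iff' hJ).1 h.2.2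
    filter_upwards [(Measure.measurePreserving_neg volume).quasiMeasurePreserving.ae h1]
      with t ht htJ
    exact CausalAt.comp_neg (C := C) (ht htJ)

theorem ChronalCone.opp_opp (C : ChronalCone d M) : C.opp.opp = C := by
  cases C
  simp only [ChronalCone.opp]
  congr 1
  funext x
  exact neg_neg _

/-- `y` can be reached from `x` by a causal curve. -/
def Caus (C : ChronalCone d M) (x y : M) : Prop :=
  ∃ (γ : ℝ → M) (a b : ℝ), a < b ∧ IsCausalCurveOn C γ (Icc a b) ∧ γ a = x ∧ γ b = y

theorem Caus.trans {x y z : M} (h₁ : Caus C x y) (h₂ : Caus C y z) : Caus C x z := by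
  obtain ⟨γ₁, a, b, hab, hγ₁, rfl, rfl⟩ := h₁
  obtain ⟨γ₂, b', c, hbc, hγ₂, he, rfl⟩ := h₂
  have h3 := hγ₂.comp_add measurableSet_Icc (b' - b)
  have hpre : (· + (b' - b)) ⁻¹' Icc b' c = Icc b (c - b' + b) := by
    rw [preimage_add_const_Icc]; congr 1 <;> ring
  rw [hpre] at h3
  have hbc' : b < c - b' + b := by linarith
  have := IsCausalCurveOn.glue (J := Icc a (c - b' + b)) (m := b)
    (hγ₁.mono (fun t ht => ⟨ht.1.1, ht.2⟩)) (h3.mono fun t ht => ⟨ht.2, ht.1.2⟩)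
    ⟨hab.le, hbc'.le⟩ measurableSet_Icc (by simp [he])
  refine ⟨_, a, c - b' + b, hab.trans hbc', this, if_pos hab.le, ?_⟩
  refine (if_neg (not_le.2 hbc')).trans ?_
  congr 1
  ring

theorem Caus.opp {x y : M} (h : Caus C x y) : Caus C.opp y x := by
  obtain ⟨γ, a, b, hab, hγ, rfl, rfl⟩ := h
  refine ⟨fun t => γ (-t), -b, -a, by linarith, ?_, by simp, by simp⟩
  have := hγ.comp_neg measurableSet_Icc
  have hpre : (fun t : ℝ => -t) ⁻¹' Icc a b = Icc (-b) (-a) := by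
    ext t; simp only [mem_preimage, mem_Icc]; constructor <;> rintro
      ⟨h1, h2⟩ <;> constructor <;> linarith
  rwa [hpre] at this

theorem caus_opp_iff {x y : M} : Caus C.opp x y ↔ Caus C y x := by
  refine ⟨fun h => ?_, Caus.opp⟩
  have := h.opp
  rwa [C.opp_opp] at this

theorem Chron.opp {x y : M} (h : Chron C x y) : Chron C.opp y x := by
  obtain ⟨γ, hγ, hc, rfl, rfl⟩ := h
  refine ⟨fun t => γ (1 - t), ?_, fun t ht => ?_, by simp, by simp⟩
  · exact hγ.comp (contDiff_const.sub contDiff_id).contMDiff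
  · have hd : HasMFDerivAt 𝓘(ℝ, ℝ) 𝓘(ℝ, ℝ) (fun t : ℝ => 1 - t) t (-ContinuousLinearMap.id ℝ ℝ) :=
      ((hasFDerivAt_id t).const_sub 1).hasMFDerivAt
    have hcomp := (hγ.mdifferentiableAt (x := 1 - t) (by simp)).hasMFDerivAt.comp t hd
    have hv : (velocity (d := d) (fun t => γ (1 - t)) t : TangentSpace 𝓘(ℝ, Model d) (γ (1 - t))) =
        -velocity (d := d) γ (1 - t) :=
      (DFunLike.congr_fun hcomp.mfderiv (1 : ℝ)).trans
        (map_neg (mfderiv 𝓘(ℝ, ℝ) 𝓘(ℝ, Model d) γ (1 - t)) (1 : ℝ))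
    rw [hv]
    change -(-velocity (d := d) γ (1 - t)) ∈ C.cone (γ (1 - t))
    rw [neg_neg]
    exact hc _ ⟨by linarith [ht.2], by linarith [ht.1]⟩

theorem chron_opp_iff {x y : M} : Chron C.opp x y ↔ Chron C y x := by
  refine ⟨fun h => ?_, Chron.opp⟩
  have := h.opp
  rwa [C.opp_opp] at this

theorem chronFuture_opp (N : Set M) : chronFuture C.opp N = chronPast C N := by
  ext y
  simp only [chronFuture, chronPast, chron_opp_iff]

theorem IsCauchySurface.not_caus {S : Set M} (hS : IsCauchySurface C S) {x y : M} (hx : x ∈ S)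
    (hy : y ∈ S) : ¬ Caus C x y := by
  rintro ⟨γ, a, b, hab, hγ, rfl, rfl⟩
  exact hS.acausal γ a b hab hγ ⟨hx, hy⟩

theorem IsCauchySurface.opp {S : Set M} (hS : IsCauchySurface C S) : IsCauchySurface C.opp S where
  smooth := hS.smooth
  acausal γ a b hab hγ h :=
    hS.not_caus h.2 h.1 (caus_opp_iff.1 ⟨γ, a, b, hab, hγ, rfl, rfl⟩)
  meets γ hγ htop hbot := by
    have h1 := hγ.comp_neg MeasurableSet.univ
    rw [C.opp_opp] at h1
    obtain ⟨t, ht, huniq⟩ := hS.meets _ h1 (fun p hp => hbot p (by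
      simpa [Function.comp_def] using hp.comp tendsto_neg_atBot_atTop)) (fun p hp => htop p (by
      simpa [Function.comp_def] using hp.comp tendsto_neg_atTop_atBot))
    exact ⟨-t, ht, fun s hs => by
      have := huniq (-s) (by simpa using hs)
      linarith⟩

end

/-! ### Limits of curves, future and past of a Cauchy surface -/

section
variable {C : ChronalCone d M}

theorem exists_chron (C : ChronalCone d M) (p : M) : ∃ q, Chron C p q := by
  obtain ⟨v, hv⟩ := C.nonempty p
  obtain ⟨R, hR, -, h⟩ := exists_chron_ball C (IsManifold.chart_mem_maximalAtlas p)
    (mem_chart_source (Model d) p) hv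
  have hc : Tendsto (fun a : ℝ => chartAt (Model d) p p + a • chartVec (chartAt (Model d) p) p v)
      (𝓝[>] 0) (𝓝 (chartAt (Model d) p p + (0 : ℝ) • chartVec (chartAt (Model d) p) p v)) :=
    (Continuous.tendsto (by fun_prop) (0 : ℝ)).mono_left nhdsWithin_le_nhds
  rw [zero_smul, add_zero] at hc
  obtain ⟨a, ha, ha0⟩ := ((hc.eventually (Metric.ball_mem_nhds _ hR)).and
    self_mem_nhdsWithin).exists
  have := h _ (Metric.mem_ball_self hR) a ha0 ha
  rw [(chartAt (Model d) p).left_inv (mem_chart_source _ p)] at this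
  exact ⟨_, this⟩

variable [T2Space M] [SigmaCompactSpace M]

theorem Clock.IsNormal.caus {T : Clock C} {γ : ℝ → M} {J : Set ℝ} (h : T.IsNormal γ J)
    (hJ : J.OrdConnected) {s t : ℝ} (hs : s ∈ J) (ht : t ∈ J) (hst : s < t) :
    Caus C (γ s) (γ t) :=
  ⟨γ, s, t, hst, (h.mono (hJ.out hs ht)).isCausalCurveOn ordConnected_Icc, rfl, rfl⟩

theorem Chron.caus {x y : M} (h : Chron C x y) : Caus C x y := by
  obtain ⟨T⟩ := exists_clock C
  obtain ⟨b, hb, σ, hσ, rfl, rfl⟩ := T.exists_isNormal_of_chron h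
  exact hσ.caus ordConnected_Icc ⟨le_rfl, hb.le⟩ ⟨hb.le, le_rfl⟩ hb

namespace Clock
variable (T : Clock C)

/-- Ultralimits of normalized curves with bounded initial height exist. -/
theorem exists_ultralimit {ι : Type*} (l : Ultrafilter ι) {γ : ι → ℝ → M} {J' : ι → Set ℝ}
    {θ : ι → ℝ → ℝ} {J : Set ℝ} {B : ℝ}
    (h : ∀ᶠ n in l, T.IsNormal (γ n) (J' n) ∧ (0 : ℝ) ∈ J' n ∧ T.height (γ n 0) ≤ B)
    (hθ : ∀ n, Monotone (θ n)) (hJ : ∀ t ∈ J, ∀ᶠ n in l, θ n t ∈ J' n ∧ 0 ≤ θ n t ∧ θ n t ≤ t)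
    (hlim : ∀ t ∈ J, Tendsto (fun n => θ n t) l (𝓝 t)) :
    ∃ σ : ℝ → M, T.IsNormal σ J ∧ ∀ t ∈ J, Tendsto (fun n => γ n (θ n t)) l (𝓝 (σ t)) := by
  have key : ∀ t ∈ J, ∃ x, Tendsto (fun n => γ n (θ n t)) l (𝓝 x) := by
    intro t ht
    have hmem : ∀ᶠ n in l, γ n (θ n t) ∈ {x | T.height x ≤ B + t} := by
      filter_upwards [h, hJ t ht] with n h1 h2
      have := (abs_le.1 (h1.1.abs_height_le h1.2.1 h2.1 h2.2.1)).2
      change T.height (γ n (θ n t)) ≤ B + t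
      linarith [h1.2.2, h2.2.2]
    obtain ⟨x, -, hx⟩ := (T.isCompact_le (B + t)).ultrafilter_le_nhds
      (l.map (fun n => γ n (θ n t))) (by
        rw [Ultrafilter.coe_map, le_principal_iff]
        exact hmem)
    exact ⟨x, hx⟩
  obtain ⟨n₀, -⟩ := h.exists
  have : Nonempty M := ⟨γ n₀ 0⟩
  choose! σ hσ using key
  exact ⟨σ, IsNormal.of_tendsto (h.mono fun n hn => hn.1) hθ
    (fun t ht => (hJ t ht).mono fun n hn => hn.1) hlim hσ, hσ⟩

/-- Through each point there is a normalized curve defined for all future times. -/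
theorem exists_ray (x : M) : ∃ γ : ℝ → M, T.IsNormal γ (Ici 0) ∧ γ 0 = x := by
  -- the lengths of normalized curves starting at `x`
  set A : Set ℝ := {b | 0 ≤ b ∧ ∃ γ : ℝ → M, T.IsNormal γ (Icc 0 b) ∧ γ 0 = x} with hA
  have h0A : (0 : ℝ) ∈ A := by
    refine ⟨le_rfl, fun _ => x, ?_, rfl⟩
    intro f g L hf hg hL hfg hgL s hs t ht hst
    have : t = s := by
      have h1 := hs.1; have h2 := hs.2; have h3 := ht.1; have h4 := ht.2
      linarith
    subst this
    simp
  let l : Ultrafilter ℕ := hyperfilter ℕ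
  have hl : (l : Filter ℕ) ≤ atTop := by
    rw [← Nat.cofinite_eq_atTop]
    exact hyperfilter_le_cofinite
  -- lengths converging to the parameters in `J` produce, in the ultralimit, a curve defined on `J`
  have hclosure : ∀ (b : ℕ → ℝ) (J : Set ℝ), (∀ n, b n ∈ A) → (0 : ℝ) ∈ J → J ⊆ Ici 0 →
      (∀ t ∈ J, Tendsto (fun n => min t (b n)) l (𝓝 t)) →
      ∃ γ : ℝ → M, T.IsNormal γ J ∧ γ 0 = x := by
    intro b J hb h0 hJ hlim
    choose hb0 γ hγ hγ0 using hb
    obtain ⟨σ, hσ, hσl⟩ := T.exists_ultralimit l (γ := γ) (J' := fun n => Icc 0 (b n))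
      (θ := fun n t => min t (b n)) (J := J) (B := T.height x)
      (Eventually.of_forall fun n => ⟨hγ n, ⟨le_rfl, hb0 n⟩, by rw [hγ0]⟩)
      (fun n a c hac => min_le_min_right _ hac)
      (fun t ht => Eventually.of_forall fun n => ⟨⟨le_min (hJ ht) (hb0 n), min_le_right _ _⟩,
        le_min (hJ ht) (hb0 n), min_le_left _ _⟩) hlim
    refine ⟨σ, hσ, tendsto_nhds_unique (hσl 0 h0) ?_⟩
    refine tendsto_const_nhds.congr fun n => ?_
    rw [min_eq_left (hb0 n), hγ0]
  by_cases hbdd : BddAbove A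
  · exfalso
    obtain ⟨b, -, hbt, hbA⟩ := exists_seq_tendsto_sSup ⟨0, h0A⟩ hbdd
    set s := sSup A with hs
    have hs0 : 0 ≤ s := le_csSup hbdd h0A
    obtain ⟨γ, hγ, hγ0⟩ := hclosure b (Icc 0 s) hbA ⟨le_rfl, hs0⟩ (fun t ht => ht.1) (fun t ht => by
      have : Tendsto (fun n => min t (b n)) l (𝓝 (min t s)) :=
        tendsto_const_nhds.min (hbt.mono_left hl)
      rwa [min_eq_left ht.2] at this)
    -- a curve of maximal length could be prolonged by a timelike curve from its endpoint
    obtain ⟨q, hq⟩ := exists_chron C (γ s)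
    obtain ⟨c, hc, σ, hσ, hσ0, -⟩ := T.exists_isNormal_of_chron hq
    have hmem : s + c ∈ A := by
      refine ⟨by positivity, fun t => if t ≤ s then γ t else σ (t + -s), ?_, by simp [hs0, hγ0]⟩
      refine IsNormal.union (m := s) ?_ ?_ ⟨hs0, by linarith⟩
      · refine (hγ.mono (fun t ht => ⟨ht.1.1, ht.2⟩)).congr fun t ht => if_pos ht.2
      · refine ((hσ.comp_add (-s)).mono fun t ht => ?_).congr fun t ht => ?_
        · obtain ⟨⟨h1, h2⟩, h3⟩ := ht
          simp only [mem_Ici, mem_preimage, mem_Icc] at *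
          constructor <;> linarith
        · rcases (mem_Ici.1 ht.2).eq_or_lt with h | h
          · subst h
            simp [hσ0]
          · simp [not_le.2 h]
    have := le_csSup hbdd hmem
    linarith
  · have : ∀ n : ℕ, ∃ b ∈ A, (n : ℝ) ≤ b := by
      intro n
      by_contra! hcon
      exact hbdd ⟨n, fun b hb => (hcon b hb).le⟩
    choose b hbA hbn using this
    refine hclosure b (Ici 0) hbA (le_refl (0 : ℝ)) subset_rfl fun t ht => ?_
    refine tendsto_const_nhds.congr' ?_
    have : ∀ᶠ n in atTop, t ≤ b n := by
      filter_upwards [eventually_ge_atTop ⌈t⌉₊] with n hn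
      exact (Nat.le_ceil t).trans ((Nat.cast_le.2 hn).trans (hbn n))
    filter_upwards [hl this] with n hn
    exact (min_eq_left hn).symm

variable {T}

/-- A normalized future ray is part of an inextensible causal curve, whose past half is a ray of the
opposite cone field. -/
theorem IsNormal.exists_inextensible {γ : ℝ → M} (h : T.IsNormal γ (Ici 0)) :
    ∃ Γ : ℝ → M, IsCausalCurveOn C Γ univ ∧ EqOn Γ γ (Ici 0) ∧
      (∀ p, ¬ Tendsto Γ atTop (𝓝 p)) ∧ ∀ p, ¬ Tendsto Γ atBot (𝓝 p) := by
  obtain ⟨T'⟩ := exists_clock C.opp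
  obtain ⟨σ, hσ, hσ0⟩ := T'.exists_ray (γ 0)
  have h1 := (hσ.isCausalCurveOn ordConnected_Ici).comp_neg measurableSet_Ici
  rw [C.opp_opp] at h1
  have h2 := IsCausalCurveOn.glue (J := univ) (m := 0) (γ₂ := γ)
    (h1.mono (fun t ht => by
      have := ht.2
      simp only [mem_Iic, mem_preimage, mem_Ici] at *
      linarith))
    ((h.isCausalCurveOn ordConnected_Ici).mono inter_subset_right) (mem_univ _)
    MeasurableSet.univ (by simp [hσ0])
  have heq : EqOn (fun t => if t ≤ 0 then σ (-t) else γ t) γ (Ici 0) := by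
    intro t ht
    rcases (mem_Ici.1 ht).eq_or_lt with h | h
    · subst h
      simp [hσ0]
    · simp [not_le.2 h]
  refine ⟨_, h2, heq, fun p hp => ?_, fun p hp => ?_⟩
  · refine h.not_tendsto_atTop p (hp.congr' ?_)
    filter_upwards [eventually_ge_atTop 0] with t ht using heq ht
  · refine hσ.not_tendsto_atTop p ((hp.comp tendsto_neg_atTop_atBot).congr' ?_)
    filter_upwards [eventually_ge_atTop 0] with t ht
    simp only [Function.comp_apply, Left.neg_nonpos_iff, neg_neg]
    rw [if_pos ht]

end Clock

/-- The points to the future of the hypersurface `S`. -/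
def futureOf (C : ChronalCone d M) (S : Set M) : Set M := {x | ∃ s ∈ S, Caus C s x}

/-- The points to the past of the hypersurface `S`. -/
def pastOf (C : ChronalCone d M) (S : Set M) : Set M := {x | ∃ s ∈ S, Caus C x s}

theorem pastOf_opp (S : Set M) : pastOf C.opp S = futureOf C S := by
  ext x
  simp only [pastOf, futureOf, caus_opp_iff]

theorem futureOf_opp (S : Set M) : futureOf C.opp S = pastOf C S := by
  ext x
  simp only [pastOf, futureOf, caus_opp_iff]

namespace IsCauchySurface
variable {S : Set M} (hS : IsCauchySurface C S)
include hS

theorem disjoint_pastOf : Disjoint (pastOf C S) S :=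
  disjoint_left.2 fun _ ⟨_, hs, h⟩ hx => hS.not_caus hx hs h

theorem disjoint_futureOf : Disjoint (futureOf C S) S :=
  disjoint_left.2 fun _ ⟨_, hs, h⟩ hx => hS.not_caus hs hx h

theorem disjoint_pastOf_futureOf : Disjoint (pastOf C S) (futureOf C S) :=
  disjoint_left.2 fun _ ⟨_, hs, h⟩ ⟨_, hs', h'⟩ => hS.not_caus hs' hs (h'.trans h)

/-- The causal curve extending a normalized ray meets `S`. -/
theorem exists_mem_of_ray {T : Clock C} {γ : ℝ → M} (h : T.IsNormal γ (Ici 0)) :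
    γ 0 ∈ S ∨ γ 0 ∈ futureOf C S ∨ ∃ t > 0, γ t ∈ S := by
  obtain ⟨Γ, hΓ, heq, htop, hbot⟩ := h.exists_inextensible
  obtain ⟨t, ht, -⟩ := hS.meets Γ hΓ htop hbot
  rcases lt_trichotomy t 0 with h0 | rfl | h0
  · refine Or.inr (Or.inl ⟨_, ht, Γ, t, 0, h0, hΓ.mono (subset_univ _), rfl, ?_⟩)
    exact heq (le_refl (0 : ℝ))
  · exact Or.inl (by rwa [heq (le_refl (0 : ℝ))] at ht)
  · exact Or.inr (Or.inr ⟨t, h0, by rwa [heq h0.le] at ht⟩)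

/-- The manifold is the union of `S`, its future and its past. -/
theorem mem_cases (x : M) : x ∈ S ∨ x ∈ futureOf C S ∨ x ∈ pastOf C S := by
  obtain ⟨T⟩ := exists_clock C
  obtain ⟨γ, hγ, rfl⟩ := T.exists_ray x
  refine (hS.exists_mem_of_ray hγ).imp_right (Or.imp_right ?_)
  rintro ⟨t, ht, hts⟩
  exact ⟨_, hts, hγ.caus ordConnected_Ici (le_refl (0 : ℝ)) ht.le ht⟩

end IsCauchySurface
end

/-! ### Slice charts of a Cauchy surface -/

section
variable {C : ChronalCone d M}

theorem chartVec_combo (e : OpenPartialHomeomorph M (Model d)) (p : M) (a b : ℝ)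
    (v w : TangentSpace 𝓘(ℝ, Model d) p) (i : Fin (d + 1)) :
    chartVec e p (a • v + b • w) i = a * chartVec e p v i + b * chartVec e p w i := by
  have h1 : chartVec e p (a • v + b • w) = a • chartVec e p v + b • chartVec e p w := by
    unfold chartVec
    refine (map_add _ _ _).trans ?_
    exact congrArg₂ (· + ·) (map_smul _ a v) (map_smul _ b w)
  rw [h1]
  simp

theorem neg_mem_contDiffGroupoid :
    (Homeomorph.neg (Model d)).toOpenPartialHomeomorph ∈ contDiffGroupoid ∞ 𝓘(ℝ, Model d) := by
  rw [contDiffGroupoid, mem_groupoid_of_pregroupoid]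
  constructor
  · exact contDiff_neg.contDiffOn
  · exact contDiff_neg.contDiffOn

theorem trans_neg_mem_maximalAtlas {e : OpenPartialHomeomorph M (Model d)}
    (he : e ∈ IsManifold.maximalAtlas 𝓘(ℝ, Model d) ∞ M) :
    e.trans (Homeomorph.neg (Model d)).toOpenPartialHomeomorph ∈
      IsManifold.maximalAtlas 𝓘(ℝ, Model d) ∞ M := by
  intro e' he'
  obtain ⟨h1, h2⟩ := he e' he'
  constructor
  · rw [OpenPartialHomeomorph.trans_symm_eq_symm_trans_symm, OpenPartialHomeomorph.trans_assoc]
    exact StructureGroupoid.trans _ (StructureGroupoid.symm _ neg_mem_contDiffGroupoid) h1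
  · rw [← OpenPartialHomeomorph.trans_assoc]
    exact StructureGroupoid.trans _ h2 neg_mem_contDiffGroupoid

section
variable [T2Space M] [SigmaCompactSpace M]

namespace IsCauchySurface
variable {S : Set M} (hS : IsCauchySurface C S)
include hS

/-- Timelike vectors are transversal to `S`: otherwise a short coordinate segment inside `S` would
be timelike, which contradicts acausality. -/
theorem chartVec_ne_zero {e : OpenPartialHomeomorph M (Model d)} (he : IsSliceChart S e) {p : M}
    (hp : p ∈ e.source) (hpS : p ∈ S) {v : TangentSpace 𝓘(ℝ, Model d) p} (hv : v ∈ C.cone p) :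
    chartVec e p v 0 ≠ 0 := by
  intro h0
  obtain ⟨R, hR, hsub, h⟩ := exists_chron_ball C he.1 hp hv
  have hc : Tendsto (fun a : ℝ => e p + a • chartVec e p v) (𝓝[>] 0)
      (𝓝 (e p + (0 : ℝ) • chartVec e p v)) :=
    (Continuous.tendsto (by fun_prop) (0 : ℝ)).mono_left nhdsWithin_le_nhds
  rw [zero_smul, add_zero] at hc
  obtain ⟨a, ha, ha0⟩ := ((hc.eventually (Metric.ball_mem_nhds _ hR)).and
    self_mem_nhdsWithin).exists
  have hch := h _ (Metric.mem_ball_self hR) a ha0 ha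
  rw [e.left_inv hp] at hch
  have hyt := (hsub ha).1
  refine hS.not_caus hpS ((he.2 _ (e.map_target hyt)).2 ?_) hch.caus
  rw [e.right_inv hyt]
  simp [h0, (he.2 p hp).1 hpS]

/-- All timelike vectors at a point of `S` point to the same side of `S`: otherwise a convex
combination of two of them would be tangent to `S`. -/
theorem chartVec_pos_of_pos {e : OpenPartialHomeomorph M (Model d)} (he : IsSliceChart S e) {p : M}
    (hp : p ∈ e.source) (hpS : p ∈ S) {v w : TangentSpace 𝓘(ℝ, Model d) p} (hv : v ∈ C.cone p)
    (hw : w ∈ C.cone p) (h : 0 < chartVec e p w 0) : 0 < chartVec e p v 0 := by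
  by_contra! hv0
  set a := chartVec e p w 0
  set b := chartVec e p v 0 with hb
  have hab : 0 < a - b := by linarith
  have hmem := C.convex p hv hw (div_nonneg h.le hab.le) (div_nonneg (neg_nonneg.2 hv0) hab.le)
    (by field_simp; ring)
  refine hS.chartVec_ne_zero he hp hpS hmem ?_
  rw [chartVec_combo]
  field_simp
  ring

/-- Future oriented slice charts exist around each point of `S`: reflect a slice chart if necessary,
and restrict it to the points where some constant vector field is timelike. -/
theorem exists_futureSliceChart {s : M} (hs : s ∈ S) :
    ∃ e, IsFutureSliceChart C S e ∧ s ∈ e.source := by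
  obtain ⟨e, he, hse⟩ := hS.smooth s hs
  obtain ⟨v, hv⟩ := C.nonempty s
  obtain ⟨e₁, he₁, hse₁, hpos⟩ : ∃ e₁ : OpenPartialHomeomorph M (Model d), IsSliceChart S e₁ ∧
      s ∈ e₁.source ∧ 0 < chartVec e₁ s v 0 := by
    rcases (hS.chartVec_ne_zero he hse hs hv).lt_or_gt with h | h
    · refine ⟨_, ⟨trans_neg_mem_maximalAtlas he.1, fun p hp => ?_⟩, by simpa using hse, ?_⟩
      · have := he.2 p (by simpa using hp)
        rw [this]
        simp
      · have hm : chartVec (e.trans (Homeomorph.neg (Model d)).toOpenPartialHomeomorph) s v =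
            -chartVec e s v :=
          DFunLike.congr_fun (mfderiv_neg (I := 𝓘(ℝ, Model d)) (f := ⇑e) (x := s)) v
        rw [hm]
        simpa using h
    · exact ⟨e, he, hse, h⟩
  set O : Set M := e₁.source ∩ e₁ ⁻¹' timelikeDom C e₁ (chartVec e₁ s v) with hO
  have hOo : IsOpen O := e₁.isOpen_inter_preimage (isOpen_timelikeDom C he₁.1 _)
  have hsub : (e₁.restr O).source ⊆ O := fun p hp => by
    rw [e₁.restr_source, hOo.interior_eq] at hp
    exact hp.2
  refine ⟨e₁.restr O, ⟨⟨restr_mem_maximalAtlas _ he₁.1 hOo, fun p hp => he₁.2 p (hsub hp).1⟩,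
    fun p hp hpS => ?_⟩, ?_⟩
  · obtain ⟨hp1, hp2⟩ := hsub hp
    have h1 := chartVec_mfderiv_symm he₁.1 hp2.1 (chartVec e₁ s v)
    have hl := e₁.left_inv hp1
    have h2 : ∀ u ∈ C.cone (e₁.symm (e₁ p)), 0 < chartVec e₁ (e₁.symm (e₁ p)) u 0 := fun u hu =>
      hS.chartVec_pos_of_pos he₁ (by rwa [hl]) (by rwa [hl]) hu hp2.2 (by rw [h1]; exact hpos)
    rw [hl] at h2
    exact h2
  · rw [e₁.restr_source, hOo.interior_eq]
    exact ⟨hse₁, hse₁, mem_timelikeDom he₁.1 hse₁ hv⟩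

/-- The two sides of a slice chart belong to the future and to the past of `S`. -/
theorem eventually_sides {e : OpenPartialHomeomorph M (Model d)} (he : IsFutureSliceChart C S e)
    {s : M} (hs : s ∈ S) (hse : s ∈ e.source) :
    ∀ᶠ q in 𝓝 s, (e q 0 < 0 → q ∈ pastOf C S) ∧ (0 < e q 0 → q ∈ futureOf C S) := by
  obtain ⟨v, hv⟩ := C.nonempty s
  obtain ⟨R, hR, hsub, h⟩ := exists_chron_ball C he.1.1 hse hv
  have hpos := he.2 s hse hs v hv
  set w := chartVec e s v with hw
  have hes0 : e s 0 = 0 := (he.1.2 s hse).1 hs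
  -- the point of `S` on the straight line through `q` in the direction `w`
  have hec : ContinuousAt e s := e.continuousAt hse
  have hc : ContinuousAt (fun q => e q - (e q 0 / w 0) • w) s :=
    ContinuousAt.comp (g := fun y : Model d => y - (y 0 / w 0) • w)
      (Continuous.continuousAt (by fun_prop)) hec
  have hc' : Tendsto (fun q => e q - (e q 0 / w 0) • w) (𝓝 s) (𝓝 (e s)) := by
    have := hc.tendsto
    rwa [hes0, zero_div, zero_smul, sub_zero] at this
  filter_upwards [hc'.eventually (Metric.ball_mem_nhds _ hR),
    hec.eventually (Metric.ball_mem_nhds _ hR),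
    e.open_source.mem_nhds hse] with q hq1 hq2 hq3
  have hyt := (hsub hq1).1
  have hmem : e.symm (e q - (e q 0 / w 0) • w) ∈ S := by
    rw [he.1.2 _ (e.map_target hyt), e.right_inv hyt]
    simp [hpos.ne']
  constructor
  · intro hneg
    have := h _ hq2 (-(e q 0 / w 0)) (neg_pos.2 (div_neg_of_neg_of_pos hneg hpos)) (by
      rwa [neg_smul, ← sub_eq_add_neg])
    rw [neg_smul, ← sub_eq_add_neg, e.left_inv hq3] at this
    exact ⟨_, hmem, this.caus⟩
  · intro hp
    have := h _ hq1 (e q 0 / w 0) (div_pos hp hpos) (by rwa [sub_add_cancel])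
    rw [sub_add_cancel, e.left_inv hq3] at this
    exact ⟨_, hmem, this.caus⟩

end IsCauchySurface
end
end

/-! ### Compactness of causal futures and cutoff functions -/

section
variable {C : ChronalCone d M} [T2Space M] [SigmaCompactSpace M]

/-- Each compact set lies in the timelike future of a compact set: small coordinate balls are
translated to the past along a timelike direction. -/
theorem exists_compact_subset_chronFuture (C : ChronalCone d M) {K : Set M} (hK : IsCompact K) :
    ∃ K', IsCompact K' ∧ K ⊆ chronFuture C K' := by
  refine hK.induction_on (p := fun s => ∃ K', IsCompact K' ∧ s ⊆ chronFuture C K')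
    ⟨∅, isCompact_empty, empty_subset _⟩ (fun s t hst ⟨K', hK', h⟩ => ⟨K', hK', hst.trans h⟩)
    (fun s t ⟨K₁, hK₁, h₁⟩ ⟨K₂, hK₂, h₂⟩ => ⟨K₁ ∪ K₂, hK₁.union hK₂, union_subset
      (h₁.trans (chronFuture_mono C subset_union_left))
      (h₂.trans (chronFuture_mono C subset_union_right))⟩) fun p _ => ?_
  obtain ⟨v, hv⟩ := C.nonempty p
  set e := chartAt (Model d) p
  obtain ⟨R, hR, hsub, h⟩ := exists_chron_ball C (IsManifold.chart_mem_maximalAtlas p)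
    (mem_chart_source (Model d) p) hv
  set w := chartVec e p v
  have hc : Tendsto (fun a : ℝ => a • w) (𝓝[>] 0) (𝓝 ((0 : ℝ) • w)) :=
    (Continuous.tendsto (by fun_prop) (0 : ℝ)).mono_left nhdsWithin_le_nhds
  rw [zero_smul] at hc
  obtain ⟨a, ha, ha0⟩ := ((hc.eventually (Metric.ball_mem_nhds _ (half_pos hR))).and
    self_mem_nhdsWithin).exists
  rw [dist_zero_right] at ha
  have hball : Metric.closedBall (e p - a • w) (R / 2) ⊆ Metric.ball (e p) R := by
    intro y hy
    rw [Metric.mem_closedBall] at hy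
    rw [Metric.mem_ball]
    have h1 : dist (e p - a • w) (e p) = ‖a • w‖ := by simp
    have h2 := dist_triangle y (e p - a • w) (e p)
    linarith
  refine ⟨e ⁻¹' Metric.ball (e p) (R / 2) ∩ e.source, mem_nhdsWithin_of_mem_nhds (inter_mem
    ((e.continuousAt (mem_chart_source _ p)).preimage_mem_nhds
      (Metric.ball_mem_nhds _ (half_pos hR)))
    (e.open_source.mem_nhds (mem_chart_source _ p))),
      e.symm '' Metric.closedBall (e p - a • w) (R / 2),
    (isCompact_closedBall _ _).image_of_continuousOn
      (e.continuousOn_symm.mono (hball.trans (hsub.trans fun y hy => hy.1))), ?_⟩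
  rintro q ⟨hq1, hq2⟩
  have h1 : e q - a • w ∈ Metric.closedBall (e p - a • w) (R / 2) := by
    rw [Metric.mem_closedBall, dist_sub_right]
    exact (Metric.mem_ball.1 hq1).le
  refine ⟨_, mem_image_of_mem _ h1, ?_⟩
  have h2 := h _ (hball h1) a ha0 (by
    rw [sub_add_cancel]
    exact Metric.ball_subset_ball (by linarith) hq1)
  rwa [sub_add_cancel, e.left_inv hq2] at h2

theorem exists_compact_subset_chronPast (C : ChronalCone d M) {K : Set M} (hK : IsCompact K) :
    ∃ K', IsCompact K' ∧ K ⊆ chronPast C K' := by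
  obtain ⟨K', hK', h⟩ := exists_compact_subset_chronFuture C.opp hK
  exact ⟨K', hK', by rwa [chronFuture_opp] at h⟩

/-- The points reached from `K` by normalized curves. -/
def Clock.reach (T : Clock C) (K : Set M) : Set M :=
  {x | ∃ (γ : ℝ → M) (b : ℝ), 0 ≤ b ∧ T.IsNormal γ (Icc 0 b) ∧ γ 0 ∈ K ∧ γ b = x}

theorem Clock.chronFuture_subset_reach (T : Clock C) (K : Set M) : chronFuture C K ⊆ T.reach K := by
  rintro x ⟨k, hk, h⟩
  obtain ⟨b, hb, σ, hσ, rfl, rfl⟩ := T.exists_isNormal_of_chron h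
  exact ⟨σ, b, hb.le, hσ, hk, rfl⟩

namespace IsCauchySurface
variable {S : Set M} (hS : IsCauchySurface C S)
include hS

/-- The past of `S` is open. If points outside the past converged to a point `x` of the past, the
rays issuing from them would have an ultralimit, a ray from `x`. It meets `S`, and just before that
it passes through the interior of the past, hence so do rays from points outside the past. -/
theorem isOpen_pastOf : IsOpen (pastOf C S) := by
  obtain ⟨T⟩ := exists_clock C
  refine isOpen_iff_mem_nhds.2 fun x hx => ?_
  by_contra hcon
  have hne : (𝓝 x ⊓ 𝓟 (pastOf C S)ᶜ).NeBot := by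
    rw [neBot_iff, Ne, inf_principal_eq_bot, compl_compl]
    exact hcon
  set u : Ultrafilter M := Ultrafilter.of (𝓝 x ⊓ 𝓟 (pastOf C S)ᶜ)
  have hu : (u : Filter M) ≤ 𝓝 x ⊓ 𝓟 (pastOf C S)ᶜ := Ultrafilter.of_le _
  have hux : (u : Filter M) ≤ 𝓝 x := hu.trans inf_le_left
  have hup : ∀ᶠ y in u, y ∉ pastOf C S := hu.trans inf_le_right (mem_principal_self _)
  choose γ hγ hγ0 using T.exists_ray
  obtain ⟨σ, hσ, hlim⟩ := T.exists_ultralimit u (γ := γ) (J' := fun _ => Ici 0)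
    (θ := fun _ t => t) (J := Ici 0) (B := T.height x + 1) (by
      filter_upwards [hux (T.smooth_height.continuous.continuousAt.eventually_lt_const
        (lt_add_one (T.height x)))] with y hy
      exact ⟨hγ y, le_refl (0 : ℝ), by rw [hγ0]; exact le_of_lt hy⟩)
    (fun _ => monotone_id) (fun t ht => Eventually.of_forall fun _ => ⟨ht, ht, le_refl t⟩)
    (fun t _ => tendsto_const_nhds)
  have hσ0 : σ 0 = x := by
    have h1 := hlim 0 (le_refl (0 : ℝ))
    simp only [hγ0] at h1
    exact tendsto_nhds_unique h1 (tendsto_id.mono_left hux)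
  have hray := hS.exists_mem_of_ray hσ
  rw [hσ0] at hray
  obtain ⟨t₀, ht₀, hts⟩ := (hray.resolve_left (disjoint_left.1 hS.disjoint_pastOf hx)).resolve_left
    (disjoint_left.1 hS.disjoint_pastOf_futureOf hx)
  obtain ⟨e, he, hse⟩ := hS.exists_futureSliceChart hts
  -- just before meeting `S` the limit ray is strictly below `S` in the slice chart
  have hcont : Tendsto σ (𝓝[<] t₀) (𝓝 (σ t₀)) :=
    ((hσ.continuousOn t₀ ht₀.le).continuousAt
      (Ici_mem_nhds ht₀)).tendsto.mono_left nhdsWithin_le_nhds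
  have hev := (hS.eventually_sides he hts hse).and (e.open_source.mem_nhds hse)
  obtain ⟨t, ⟨htlt, ht0⟩, hside⟩ := (((eventually_mem_nhdsWithin (a := t₀) (s := Iio t₀)).and
    (mem_nhdsWithin_of_mem_nhds (lt_mem_nhds ht₀))).and
      (hcont.eventually hev.eventually_nhds)).exists
  have htp : σ t ∈ pastOf C S := ⟨_, hts, hσ.caus ordConnected_Ici (le_of_lt ht0) ht₀.le htlt⟩
  have hsrc := hside.self_of_nhds.2
  have hneg : e (σ t) 0 < 0 := by
    rcases lt_trichotomy (e (σ t) 0) 0 with h | h | h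
    · exact h
    · exact absurd ((he.1.2 _ hsrc).2 h) (disjoint_left.1 hS.disjoint_pastOf htp)
    · exact absurd (hside.self_of_nhds.1.2 h) (disjoint_left.1 hS.disjoint_pastOf_futureOf htp)
  have hcoord : ContinuousAt (fun q => e q 0) (σ t) :=
    ContinuousAt.comp (g := fun y : Model d => y 0) (Continuous.continuousAt (by fun_prop))
      (e.continuousAt hsrc)
  have hmem : ∀ᶠ q in 𝓝 (σ t), q ∈ pastOf C S := by
    filter_upwards [hside, hcoord.eventually_lt_const hneg] with q hq1 hq2 using hq1.1.1 hq2
  obtain ⟨y, ⟨s, hs, hys⟩, hy⟩ := (((hlim t (le_of_lt ht0)).eventually hmem).and hup).exists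
  refine hy ⟨s, hs, Caus.trans ?_ hys⟩
  have := (hγ y).caus ordConnected_Ici (le_refl (0 : ℝ)) (le_of_lt ht0) ht0
  rwa [hγ0] at this

theorem isOpen_futureOf : IsOpen (futureOf C S) := by
  have := hS.opp.isOpen_pastOf
  rwa [pastOf_opp] at this

theorem union_pastOf_eq : S ∪ pastOf C S = (futureOf C S)ᶜ := by
  ext x
  rcases hS.mem_cases x with h | h | h
  · simp [h, disjoint_right.1 hS.disjoint_futureOf h]
  · simp [h, disjoint_left.1 hS.disjoint_futureOf h, disjoint_right.1 hS.disjoint_pastOf_futureOf h]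
  · simp [h, disjoint_left.1 hS.disjoint_pastOf_futureOf h]

theorem union_futureOf_eq : S ∪ futureOf C S = (pastOf C S)ᶜ := by
  have := hS.opp.union_pastOf_eq
  rwa [pastOf_opp, futureOf_opp] at this

theorem isClosed_union_pastOf : IsClosed (S ∪ pastOf C S) := by
  rw [hS.union_pastOf_eq]
  exact hS.isOpen_futureOf.isClosed_compl

theorem isClosed_union_futureOf : IsClosed (S ∪ futureOf C S) := by
  rw [hS.union_futureOf_eq]
  exact hS.isOpen_pastOf.isClosed_compl

theorem isClosed : IsClosed S := by
  have : S = (S ∪ pastOf C S) ∩ (S ∪ futureOf C S) := by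
    rw [← union_inter_distrib_left, hS.disjoint_pastOf_futureOf.inter_eq, union_empty]
  rw [this]
  exact hS.isClosed_union_pastOf.inter hS.isClosed_union_futureOf

/-- A normalized ray ends up in the future of `S`. -/
theorem exists_mem_futureOf_of_ray {T : Clock C} {γ : ℝ → M} (h : T.IsNormal γ (Ici 0)) :
    ∃ t ≥ 0, γ t ∈ futureOf C S := by
  rcases hS.exists_mem_of_ray h with h0 | h0 | ⟨t, ht, h0⟩
  · exact ⟨1, zero_le_one, _, h0, h.caus ordConnected_Ici (le_refl (0 : ℝ))
      (show (0 : ℝ) ≤ 1 from zero_le_one) zero_lt_one⟩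
  · exact ⟨0, le_rfl, h0⟩
  · exact ⟨t + 1, by positivity, _, h0, h.caus ordConnected_Ici ht.le
      (show (0 : ℝ) ≤ t + 1 by positivity) (lt_add_one t)⟩

/-- The height is bounded on those points reached from `K` which are not in the future of `S`.
Otherwise normalized curves of unbounded length would end outside the future of `S`; their
ultralimit is a ray, which enters the open future of `S`. -/
theorem exists_height_le_of_mem_reach (T : Clock C) {K : Set M} (hK : IsCompact K) :
    ∃ B, ∀ x ∈ T.reach K, x ∈ S ∪ pastOf C S → T.height x ≤ B := by
  by_contra! hcon
  choose x hx hxS hxB using fun n : ℕ => hcon n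
  choose γ b hb hγ hγ0 hγb using hx
  obtain ⟨B₀, hB₀⟩ := (hK.image T.smooth_height.continuous).bddAbove
  have hB₀' : ∀ n, T.height (γ n 0) ≤ B₀ := fun n => hB₀ (mem_image_of_mem _ (hγ0 n))
  have hmem0 : ∀ n, (0 : ℝ) ∈ Icc 0 (b n) := fun n => ⟨le_rfl, hb n⟩
  have hmemb : ∀ n, b n ∈ Icc 0 (b n) := fun n => ⟨hb n, le_rfl⟩
  have hbn : ∀ n : ℕ, (n : ℝ) - B₀ ≤ b n := fun n => by
    have h1 := (abs_le.1 ((hγ n).abs_height_le (hmem0 n) (hmemb n) (hb n))).2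
    rw [hγb] at h1
    linarith [hxB n, hB₀' n]
  let l : Ultrafilter ℕ := hyperfilter ℕ
  have hl : (l : Filter ℕ) ≤ atTop := by
    rw [← Nat.cofinite_eq_atTop]
    exact hyperfilter_le_cofinite
  have hlarge : ∀ t : ℝ, ∀ᶠ n in l, t ≤ b n := fun t => hl (by
    filter_upwards [eventually_ge_atTop ⌈t + B₀⌉₊] with n hn
    have h1 : t + B₀ ≤ n := (Nat.le_ceil _).trans (Nat.cast_le.2 hn)
    linarith [hbn n])
  obtain ⟨σ, hσ, hlim⟩ := T.exists_ultralimit l (γ := γ) (J' := fun n => Icc 0 (b n))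
    (θ := fun _ t => t) (J := Ici 0) (B := B₀)
    (Eventually.of_forall fun n => ⟨hγ n, hmem0 n, hB₀' n⟩) (fun _ => monotone_id)
    (fun t ht => (hlarge t).mono fun n hn => ⟨⟨ht, hn⟩, ht, le_refl t⟩)
    (fun t _ => tendsto_const_nhds)
  obtain ⟨t, ht, hfut⟩ := hS.exists_mem_futureOf_of_ray hσ
  obtain ⟨n, hn, hnb⟩ := (((hlim t ht).eventually (hS.isOpen_futureOf.mem_nhds hfut)).and
    (hlarge t)).exists
  have hxf : x n ∈ futureOf C S := by
    rcases hnb.eq_or_lt with h | h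
    · have : x n = γ n t := by rw [h, hγb]
      rw [this]
      exact hn
    · obtain ⟨s, hs, hsn⟩ := hn
      have := (hγ n).caus ordConnected_Icc ⟨ht, hnb⟩ (hmemb n) h
      rw [hγb] at this
      exact ⟨s, hs, hsn.trans this⟩
  have := hxS n
  rw [hS.union_pastOf_eq] at this
  exact this hxf

/-- The bound of `exists_height_le_of_mem_reach` extends to the closure. In the open past of `S`
this is immediate; a point of the closure on `S` is within unit length of points of the past. -/
theorem exists_height_le_of_mem_closure (T : Clock C) {K : Set M} (hK : IsCompact K) :
    ∃ B, ∀ x ∈ closure (T.reach K), x ∈ S ∪ pastOf C S → T.height x ≤ B := by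
  obtain ⟨B, hB⟩ := hS.exists_height_le_of_mem_reach T hK
  obtain ⟨B₀, hB₀⟩ := (hK.image T.smooth_height.continuous).bddAbove
  refine ⟨max (B + 1) (B₀ + 1), fun x hx hxS => ?_⟩
  have hcl : IsClosed {y | T.height y ≤ max (B + 1) (B₀ + 1)} :=
    isClosed_le T.smooth_height.continuous continuous_const
  rcases hxS with hxS | hxp
  swap
  · have h1 : x ∈ closure (pastOf C S ∩ T.reach K) := hS.isOpen_pastOf.inter_closure ⟨hxp, hx⟩
    refine closure_minimal (fun y hy => ?_) hcl h1
    exact (hB y hy.2 (Or.inr hy.1)).trans (by linarith [le_max_left (B + 1) (B₀ + 1)])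
  obtain ⟨u, hu, hux⟩ := mem_closure_iff_ultrafilter.1 hx
  have hreach : ∀ y, ∃ (γ : ℝ → M) (b : ℝ), y ∈ T.reach K →
      0 ≤ b ∧ T.IsNormal γ (Icc 0 b) ∧ γ 0 ∈ K ∧ γ b = y := by
    intro y
    by_cases hy : y ∈ T.reach K
    · obtain ⟨γ, b, h⟩ := hy
      exact ⟨γ, b, fun _ => h⟩
    · exact ⟨fun _ => y, 0, fun h => absurd h hy⟩
  choose γ b hγ using hreach
  rcases u.eventually_or.1 (Eventually.of_forall (f := (u : Filter M)) fun y => le_total (b y) 1)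
    with hb | hb
  · refine hcl.mem_of_tendsto (tendsto_id.mono_left hux) ?_
    filter_upwards [hu, hb] with y hy hby
    obtain ⟨h0, h1, h2, h3⟩ := hγ y hy
    have h4 := (abs_le.1 (h1.abs_height_le ⟨le_rfl, h0⟩ ⟨h0, le_rfl⟩ h0)).2
    have h5 : T.height (γ y 0) ≤ B₀ := hB₀ (mem_image_of_mem _ h2)
    rw [h3] at h4
    change T.height y ≤ _
    linarith [le_max_right (B + 1) (B₀ + 1)]
  · -- a unit piece of the curves ending near `x ∈ S` has a limit starting in the past of `S`
    have hev : ∀ᶠ y in u, T.height y < T.height x + 1 :=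
      hux (T.smooth_height.continuous.continuousAt.eventually_lt_const (lt_add_one (T.height x)))
    have hpiece : ∀ y, y ∈ T.reach K → 1 ≤ b y →
        |T.height y - T.height (γ y (b y - 1))| ≤ 1 := by
      intro y hy hby
      obtain ⟨h0, h1, h2, h3⟩ := hγ y hy
      have := h1.abs_height_le (s := b y - 1) (t := b y) ⟨by linarith, by linarith⟩ ⟨h0, le_rfl⟩
        (by linarith)
      rw [h3] at this
      linarith
    obtain ⟨σ, hσ, hlim⟩ := T.exists_ultralimit u (γ := fun y t => γ y (t + (b y - 1)))
      (J' := fun _ => Icc 0 1) (θ := fun _ t => t) (J := Icc 0 1) (B := T.height x + 2) (by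
        filter_upwards [hu, hb, hev] with y hy hby hhy
        obtain ⟨h0, h1, h2, h3⟩ := hγ y hy
        refine ⟨(h1.comp_add (b y - 1)).mono fun t ht => ?_, ⟨le_rfl, zero_le_one⟩, ?_⟩
        · have := ht.1; have := ht.2
          exact ⟨by linarith, by linarith⟩
        · rw [zero_add]
          linarith [(abs_le.1 (hpiece y hy hby)).1])
      (fun _ => monotone_id) (fun t ht => Eventually.of_forall fun _ => ⟨ht, ht.1, le_refl t⟩)
      (fun t _ => tendsto_const_nhds)
    have h0 : (0 : ℝ) ∈ Icc (0 : ℝ) 1 := ⟨le_rfl, zero_le_one⟩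
    have h1 : (1 : ℝ) ∈ Icc (0 : ℝ) 1 := ⟨zero_le_one, le_rfl⟩
    have hσ1 : σ 1 = x := by
      refine tendsto_nhds_unique ((hlim 1 h1).congr' ?_) (tendsto_id.mono_left hux)
      filter_upwards [hu] with y hy
      rw [add_sub_cancel]
      exact (hγ y hy).2.2.2
    have hpast : σ 0 ∈ pastOf C S := ⟨x, hxS, by
      have := hσ.caus ordConnected_Icc h0 h1 zero_lt_one
      rwa [hσ1] at this⟩
    refine hcl.mem_of_tendsto (tendsto_id.mono_left hux) ?_
    filter_upwards [hu, hb, (hlim 0 h0).eventually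
      (hS.isOpen_pastOf.mem_nhds hpast)] with y hy hby hp
    rw [zero_add] at hp
    have h2 := hγ y hy
    have h3 : γ y (b y - 1) ∈ T.reach K := ⟨γ y, b y - 1, by linarith,
      h2.2.1.mono (Icc_subset_Icc_right (by linarith)), h2.2.2.1, rfl⟩
    have h4 := hB _ h3 (Or.inr hp)
    change T.height y ≤ _
    linarith [(abs_le.1 (hpiece y hy hby)).2, le_max_left (B + 1) (B₀ + 1)]

/-- The part of the future of a compact set which does not lie to the future of `S` is relatively
compact. -/
theorem isCompact_closure_chronFuture_inter {K : Set M} (hK : IsCompact K) :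
    IsCompact (closure (chronFuture C K) ∩ (S ∪ pastOf C S)) := by
  obtain ⟨T⟩ := exists_clock C
  obtain ⟨B, hB⟩ := hS.exists_height_le_of_mem_closure T hK
  exact (T.isCompact_le B).of_isClosed_subset
    (_root_.isClosed_closure.inter hS.isClosed_union_pastOf)
    fun x hx => hB x (closure_mono (T.chronFuture_subset_reach K) hx.1) hx.2

theorem isCompact_closure_chronPast_inter {K : Set M} (hK : IsCompact K) :
    IsCompact (closure (chronPast C K) ∩ (S ∪ futureOf C S)) := by
  have := hS.opp.isCompact_closure_chronFuture_inter hK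
  rwa [chronFuture_opp, pastOf_opp] at this

theorem isCompact_closure_inter_closure {K L : Set M} (hK : IsCompact K) (hL : IsCompact L) :
    IsCompact (closure (chronFuture C K) ∩ closure (chronPast C L)) := by
  refine ((hS.isCompact_closure_chronFuture_inter hK).union
    (hS.isCompact_closure_chronPast_inter hL)).of_isClosed_subset
    (_root_.isClosed_closure.inter _root_.isClosed_closure) fun x hx => ?_
  rcases hS.mem_cases x with h | h | h
  · exact Or.inl ⟨hx.1, Or.inl h⟩
  · exact Or.inr ⟨hx.2, Or.inr h⟩
  · exact Or.inl ⟨hx.1, Or.inr h⟩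

/-- There is a smooth function which is one near `S` and its future, whose support has compact
intersection with the closure of the timelike past of `K`, and which differs from one on a set
having relatively compact intersection with the closure of the timelike future of `K`. -/
theorem exists_cutoff {K : Set M} (hK : IsCompact K) : ∃ χ : M → ℝ, SmoothFun (d := d) χ ∧
    (∀ᶠ x in 𝓝ˢ (S ∪ futureOf C S), χ x = 1) ∧
    IsCompact (closure (chronPast C K) ∩ tsupport χ) ∧
    IsCompact (closure (chronFuture C K) ∩ tsupport (fun x => 1 - χ x)) := by
  have : LocallyCompactSpace M := ChartedSpace.locallyCompactSpace (Model d) M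
  obtain ⟨N, hN, hAN⟩ := exists_compact_superset (hS.isCompact_closure_chronPast_inter hK)
  have hd : Disjoint (closure (chronPast C K) ∩ (interior N)ᶜ) (S ∪ futureOf C S) :=
    disjoint_left.2 fun x hx hx' => hx.2 (hAN ⟨hx.1, hx'⟩)
  obtain ⟨f, hf0, hf1, -⟩ := exists_contMDiffMap_zero_one_nhds_of_isClosed 𝓘(ℝ, Model d)
    (n := (⊤ : ℕ∞))
    (_root_.isClosed_closure.inter isOpen_interior.isClosed_compl) hS.isClosed_union_futureOf hd
  refine ⟨f, f.contMDiff, hf1, hN.of_isClosed_subset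
    (_root_.isClosed_closure.inter (isClosed_tsupport _)) fun x hx => ?_,
    (hS.isCompact_closure_chronFuture_inter hK).of_isClosed_subset
      (_root_.isClosed_closure.inter (isClosed_tsupport _)) fun x hx => ⟨hx.1, ?_⟩⟩
  · by_contra hxN
    have : ∀ᶠ y in 𝓝 x, f y = 0 :=
      eventually_nhdsSet_iff_forall.1 hf0 x ⟨hx.1, fun h => hxN (interior_subset h)⟩
    exact (notMem_tsupport_iff_eventuallyEq.2 this) hx.2
  · rw [hS.union_pastOf_eq]
    intro hxf
    have : ∀ᶠ y in 𝓝 x, f y = 1 := eventually_nhdsSet_iff_forall.1 hf1 x (Or.inr hxf)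
    refine (notMem_tsupport_iff_eventuallyEq.2 ?_) hx.2
    filter_upwards [this] with y hy
    simp [hy]

end IsCauchySurface
end

/-! ### The divergence theorem in Euclidean space -/

/-- The divergence theorem in a half space, for fields with compact support. -/
theorem integral_div_halfspace {U : Model d → Model d} (hU : ContDiff ℝ 1 U)
    (hc : HasCompactSupport U) (t : ℝ) :
    ∫ y in {y : Model d | y 0 < t}, ∑ i, fderiv ℝ (fun z => U z i) y (EuclideanSpace.single i 1) =
      ∫ y : Fin d → ℝ, U (WithLp.toLp 2 (Fin.cons t y)) 0 := by
  let L : (Fin (d + 1) → ℝ) ≃L[ℝ] Model d := (PiLp.continuousLinearEquiv 2 ℝ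
    (fun _ : Fin (d + 1) => ℝ)).symm
  obtain ⟨R, hR, hRt, hsupp⟩ : ∃ R : ℝ, 0 < R ∧ -R < t ∧ ∀ y : Model d, (∃ i, R ≤ |y i|) →
    U y = 0 := by
    obtain ⟨R, hR⟩ := hc.isBounded.subset_ball 0
    refine ⟨max (max R 1) (1 - t), by positivity, by linarith [le_max_right (max R 1) (1 - t)], ?_⟩
    rintro y ⟨i, hi⟩
    by_contra hne
    have h1 := hR (subset_tsupport _ hne)
    rw [mem_ball_zero_iff] at h1
    have h2 := EuclideanSpace.norm_eq y
    have h3 : |y i| ≤ ‖y‖ := PiLp.norm_apply_le y i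
    have h4 : R ≤ max (max R 1) (1 - t) := (le_max_left R 1).trans (le_max_left _ _)
    linarith
  set D : Model d → ℝ := fun y => ∑ i, fderiv ℝ (fun z => U z i) y
    (EuclideanSpace.single i 1) with hD
  have hUi : ∀ i, ContDiff ℝ 1 (fun z => U z i) := fun i => by fun_prop
  have hDc : Continuous D := continuous_finsetSum _ fun i _ =>
    ((hUi i).continuous_fderiv (by simp)).clm_apply continuous_const
  have hDsupp : ∀ y : Model d, (∃ i, R < |y i|) → D y = 0 := by
    rintro y ⟨i, hi⟩
    refine Finset.sum_eq_zero fun j _ => ?_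
    have : (fun z => U z j) =ᶠ[𝓝 y] fun _ => 0 := by
      have hopen : IsOpen {z : Model d | R < |z i|} := isOpen_lt continuous_const (by fun_prop)
      filter_upwards [hopen.mem_nhds hi] with z hz
      rw [hsupp z ⟨i, le_of_lt hz⟩]
      rfl
    rw [this.fderiv_eq]
    simp
  -- a box whose upper face lies on the boundary of the half space
  set a : Fin (d + 1) → ℝ := fun _ => -R with ha
  set b : Fin (d + 1) → ℝ := Fin.cons t fun _ => R with hb
  have hab : a ≤ b := fun i => by
    refine Fin.cases ?_ (fun j => ?_) i
    · simp [ha, hb, hRt.le]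
    · simp only [ha, hb, Fin.cons_succ]
      linarith
  have hdiv := integral_divergence_of_hasFDerivAt_off_countable' a b hab (fun i x => U (L x) i)
    (fun i x => (fderiv ℝ (fun z => U z i) (L x)).comp (L : (Fin (d + 1) → ℝ) →L[ℝ] Model d)) ∅
    countable_empty
    (fun i => ((hUi i).continuous.comp L.continuous).continuousOn)
    (fun x _ i => (((hUi i).differentiable (by simp)) (L x)).hasFDerivAt.comp x L.hasFDerivAt)
    (Continuous.integrableOn_Icc (continuous_finsetSum _ fun i _ =>
      ((((hUi i).continuous_fderiv (by simp)).comp L.continuous).clm_apply continuous_const)))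
  have hsum : ∀ x : Fin (d + 1) → ℝ, ∑ i, ((fderiv ℝ (fun z => U z i) (L x)).comp
      (L : (Fin (d + 1) → ℝ) →L[ℝ] Model d)) (Pi.single i 1) = D (L x) := fun x => rfl
  simp only [hsum] at hdiv
  have hlhs : ∫ y in {y : Model d | y 0 < t}, D y = ∫ x in Icc a b, D (L x) := by
    have h1 := (PiLp.volume_preserving_toLp (Fin (d + 1))).setIntegral_preimage_emb
      (MeasurableEquiv.toLp 2 (Fin (d + 1) → ℝ)).measurableEmbedding D {y : Model d | y 0 < t}
    rw [← h1]
    have hset : (WithLp.toLp 2 ⁻¹' {y : Model d | y 0 < t} : Set (Fin (d + 1) → ℝ)) =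
      {x | x 0 < t} := rfl
    rw [hset]
    change ∫ x in {x : Fin (d + 1) → ℝ | x 0 < t}, D (L x) = _
    have hm1 : MeasurableSet {x : Fin (d + 1) → ℝ | x 0 < t} :=
      measurableSet_lt (measurable_pi_apply 0) measurable_const
    rw [← integral_indicator hm1, ← integral_indicator measurableSet_Icc]
    have hnull : ∀ᵐ x : Fin (d + 1) → ℝ, x 0 ≠ t := by
      have := Measure.ae_eval_ne (fun _ : Fin (d + 1) => (volume : Measure ℝ)) (i := 0) t
      exact this
    refine integral_congr_ae ?_
    filter_upwards [hnull] with x hx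
    by_cases hxa : ∃ i, R < |x i|
    · have h0 : D (L x) = 0 := hDsupp (L x) hxa
      simp [indicator, h0]
    · push Not at hxa
      have hiff : x ∈ Icc a b ↔ x 0 < t := by
        constructor
        · intro h
          exact lt_of_le_of_ne (h.2 0) hx
        · intro h
          refine ⟨fun i => (abs_le.1 (hxa i)).1, fun i => ?_⟩
          refine Fin.cases ?_ (fun j => ?_) i
          · exact h.le
          · exact (abs_le.1 (hxa j.succ)).2
      by_cases h : x 0 < t
      · rw [indicator_of_mem (show x ∈ {x | x 0 < t} from h), indicator_of_mem (hiff.2 h)]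
      · rw [indicator_of_notMem (show x ∉ {x | x 0 < t} from h),
          indicator_of_notMem (fun hh => h (hiff.1 hh))]
  rw [hlhs, hdiv, Fin.sum_univ_succ]
  have hback : ∀ (i : Fin (d + 1)) (x : Fin d → ℝ), U (L (i.insertNth (a i) x)) i = 0 := by
    intro i x
    rw [hsupp _ ⟨i, ?_⟩]
    · rfl
    · change R ≤ |(i.insertNth (a i) x : Fin (d + 1) → ℝ) i|
      simp [ha, abs_of_pos hR]
  have hfront : ∀ (i : Fin d) (x : Fin d → ℝ),
    U (L (i.succ.insertNth (b i.succ) x)) i.succ = 0 := by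
    intro i x
    rw [hsupp _ ⟨i.succ, ?_⟩]
    · rfl
    · change R ≤ |(i.succ.insertNth (b i.succ) x : Fin (d + 1) → ℝ) i.succ|
      simp [hb, abs_of_pos hR]
  simp only [hback, hfront, integral_zero, sub_zero, Finset.sum_const_zero, add_zero]
  rw [← integral_indicator measurableSet_Icc]
  refine integral_congr_ae (Eventually.of_forall fun x => ?_)
  have hcons : (Fin.insertNth (0 : Fin (d + 1)) (b 0) x : Fin (d + 1) → ℝ) = Fin.cons t x := by
    simp [hb]
  have hL : U (L (Fin.insertNth (0 : Fin (d + 1)) (b 0) x)) 0 =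
    U (WithLp.toLp 2 (Fin.cons t x)) 0 := by
    rw [hcons]
    rfl
  by_cases hx : x ∈ Icc (a ∘ (Fin.succAbove 0)) (b ∘ (Fin.succAbove 0))
  · rw [indicator_of_mem hx, hL]
  · rw [indicator_of_notMem hx]
    obtain ⟨j, hj⟩ : ∃ j, R ≤ |x j| := by
      by_contra! hcon
      refine hx ⟨fun j => (abs_lt.1 (hcon j)).1.le, fun j => ?_⟩
      simpa [hb] using (abs_lt.1 (hcon j)).2.le
    have h0 := hsupp (WithLp.toLp 2 (Fin.cons t x)) ⟨j.succ, by simpa using hj⟩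
    simp only [h0]
    rfl

/-- The integral over Euclidean space of the divergence of a field with compact support vanishes:
the support is contained in a half space with the field zero on its boundary. -/
theorem integral_div_eq_zero {U : Model d → Model d} (hU : ContDiff ℝ 1 U)
    (hc : HasCompactSupport U) :
    ∫ y, ∑ i, fderiv ℝ (fun z => U z i) y (EuclideanSpace.single i 1) = 0 := by
  obtain ⟨R, hR⟩ := hc.isBounded.subset_ball 0
  have hz : ∀ y : Model d, R ≤ y 0 → y ∉ tsupport U := fun y hy hmem => by
    have h1 := hR hmem
    rw [mem_ball_zero_iff] at h1
    have h3 : |y 0| ≤ ‖y‖ := PiLp.norm_apply_le y 0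
    linarith [le_abs_self (y 0)]
  have h := integral_div_halfspace hU hc R
  rw [← integral_indicator (measurableSet_lt (by fun_prop) measurable_const)] at h
  have h0 : ∫ y : Fin d → ℝ, U (WithLp.toLp 2 (Fin.cons R y)) 0 = 0 := by
    refine integral_eq_zero_of_ae (Eventually.of_forall fun y => ?_)
    have h1 : U (WithLp.toLp 2 (Fin.cons R y)) = 0 :=
      image_eq_zero_of_notMem_tsupport (hz _ (le_refl R))
    exact congrArg (fun v : Model d => v 0) h1
  rw [h0] at h
  refine Eq.trans ?_ h
  refine integral_congr_ae (Eventually.of_forall fun y => ?_)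
  by_cases hy : y 0 < R
  · rw [indicator_of_mem (show y ∈ {y : Model d | y 0 < R} from hy)]
  · rw [indicator_of_notMem (show y ∉ {y : Model d | y 0 < R} from hy)]
    refine Finset.sum_eq_zero fun i _ => ?_
    have : (fun z => U z i) =ᶠ[𝓝 y] fun _ => 0 := by
      filter_upwards [(notMem_tsupport_iff_eventuallyEq (f := U)).1 (hz y (not_lt.1 hy))] with z hz
      rw [hz]
      rfl
    rw [this.fderiv_eq]
    simp

/-! ### Partitions of unity and multiplication by functions -/

section
variable [T2Space M] [SigmaCompactSpace M]

/-- Smooth partitions of unity on a neighbourhood of a compact set are finite. -/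
theorem exists_finite_partition {K : Set M} (hK : IsCompact K) {ι : Type*} (U : ι → Set M)
    (hU : ∀ i, IsOpen (U i)) (hcov : K ⊆ ⋃ i, U i) :
    ∃ (N : ℕ) (i : Fin N → ι) (ρ : Fin N → M → ℝ), (∀ j, SmoothFun (d := d) (ρ j)) ∧
      (∀ j, HasCompactSupport (ρ j)) ∧ (∀ j, tsupport (ρ j) ⊆ U (i j)) ∧
      ∀ᶠ x in 𝓝ˢ K, ∑ j, ρ j x = 1 := by
  classical
  have : LocallyCompactSpace M := ChartedSpace.locallyCompactSpace (Model d) M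
  obtain ⟨K', hK', hKK', hK'U⟩ := exists_compact_between hK (isOpen_iUnion hU) hcov
  obtain ⟨t, ht⟩ := hK'.elim_finite_subcover U hU hK'U
  obtain ⟨V, hV, hK'V, hVc⟩ := exists_isOpen_superset_and_isCompact_closure hK'
  obtain ⟨f, hf⟩ := SmoothPartitionOfUnity.exists_isSubordinate 𝓘(ℝ, Model d) hK'.isClosed
    (fun i : t => U i ∩ V) (fun i => (hU i).inter hV) (fun x hx => by
      obtain ⟨i, hi, hxi⟩ := mem_iUnion₂.1 (ht hx)
      exact mem_iUnion.2 ⟨⟨i, hi⟩, hxi, hK'V hx⟩)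
  let eq := Fintype.equivFin t
  refine ⟨Fintype.card t, fun j => (eq.symm j : ι), fun j => f (eq.symm j), fun j =>
    (f _).contMDiff,
    fun j => HasCompactSupport.of_support_subset_isCompact hVc
      ((subset_tsupport _).trans ((hf _).trans (inter_subset_right.trans subset_closure))),
    fun j => (hf _).trans inter_subset_left, ?_⟩
  filter_upwards [subset_interior_iff_mem_nhdsSet.1 hKK'] with x hx
  rw [← f.sum_eq_one hx, finsum_eq_sum_of_fintype]
  exact eq.symm.sum_comp (fun i => f i x)
end

/-- The product of a smooth function and a section. -/
noncomputable def smulSec {V : VB.{u, v} d M} (f : M → ℝ) (hf : SmoothFun (d := d) f) (s : Sec V) :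
    Sec V :=
  ⟨fun x => f x • s x, hf.smul_section s.contMDiff⟩

@[simp]
theorem smulSec_apply {V : VB.{u, v} d M} (f : M → ℝ) (hf : SmoothFun (d := d) f) (s : Sec V)
    (x : M) : smulSec f hf s x = f x • s x := rfl

/-! ### Components of vector fields in charts -/

section
variable {e : OpenPartialHomeomorph M (Model d)}

theorem contDiffOn_vecComp (he : e ∈ IsManifold.maximalAtlas 𝓘(ℝ, Model d) ∞ M)
    (X : Sec (VB.tangent d M)) : ContDiffOn ℝ ∞ (vecComp e (fun x => X x)) e.target := by
  have h1 : ContMDiffOn 𝓘(ℝ, Model d).tangent 𝓘(ℝ, Model d).tangent ∞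
      (tangentMapWithin 𝓘(ℝ, Model d) 𝓘(ℝ, Model d) e e.source)
      (TotalSpace.proj ⁻¹' e.source) :=
    (contMDiffOn_of_mem_maximalAtlas he).contMDiffOn_tangentMapWithin (by simp)
      e.open_source.uniqueMDiffOn
  have h2 : ContMDiffOn 𝓘(ℝ, Model d) 𝓘(ℝ, Model d).tangent ∞
      (fun y => (⟨e.symm y, X (e.symm y)⟩ : TangentBundle 𝓘(ℝ, Model d) M)) e.target :=
    X.contMDiff.comp_contMDiffOn (contMDiffOn_symm_of_mem_maximalAtlas he)
  have h3 := (contMDiff_snd_tangentBundle_modelSpace (Model d) 𝓘(ℝ, Model d)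
    (n := ∞)).comp_contMDiffOn
    (h1.comp h2 (fun y hy => e.map_target hy))
  refine (contMDiffOn_iff_contDiffOn.1 h3).congr fun y hy => ?_
  have h4 : mfderivWithin 𝓘(ℝ, Model d) 𝓘(ℝ, Model d) e e.source (e.symm y) =
      mfderiv 𝓘(ℝ, Model d) 𝓘(ℝ, Model d) e (e.symm y) :=
    mfderivWithin_of_isOpen e.open_source (e.map_target hy)
  exact (DFunLike.congr_fun h4 (X (e.symm y))).symm

theorem vecComp_add (X Y : Sec (VB.tangent d M)) (y : Model d) :
    vecComp e (fun x => (X + Y) x) y = vecComp e (fun x => X x) y + vecComp e (fun x => Y x) y :=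
  map_add (mfderiv 𝓘(ℝ, Model d) 𝓘(ℝ, Model d) e (e.symm y)) (X (e.symm y)) (Y (e.symm y))

theorem vecComp_smulSec (f : M → ℝ) (hf : SmoothFun (d := d) f) (X : Sec (VB.tangent d M))
    (y : Model d) :
    vecComp e (fun x => smulSec f hf X x) y = f (e.symm y) • vecComp e (fun x => X x) y :=
  map_smul (mfderiv 𝓘(ℝ, Model d) 𝓘(ℝ, Model d) e (e.symm y)) (f (e.symm y)) (X (e.symm y))

theorem vecComp_eq_zero {X : (x : M) → TangentSpace 𝓘(ℝ, Model d) x} {y : Model d}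
    (h : X (e.symm y) = 0) : vecComp e X y = 0 := by
  unfold vecComp chartVec
  rw [h]
  exact map_zero (mfderiv 𝓘(ℝ, Model d) 𝓘(ℝ, Model d) e (e.symm y))

theorem fderiv_comp_symm (he : e ∈ IsManifold.maximalAtlas 𝓘(ℝ, Model d) ∞ M) {f : M → ℝ}
    (hf : SmoothFun (d := d) f) {p : M} (hp : p ∈ e.source) (v : TangentSpace 𝓘(ℝ, Model d) p) :
    fderiv ℝ (fun y => f (e.symm y)) (e p) (chartVec e p v) = differential f p v := by
  have hs : MDifferentiableAt 𝓘(ℝ, Model d) 𝓘(ℝ, Model d) e.symm (e p) :=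
    (mdifferentiable_of_mem_maximalAtlas he).mdifferentiableAt_symm (e.map_source hp)
  have h1 := ((hf.mdifferentiableAt (x := e.symm (e p)) (by simp)).hasMFDerivAt.comp (e p)
    hs.hasMFDerivAt).mfderiv
  rw [mfderiv_eq_fderiv] at h1
  refine (DFunLike.congr_fun h1 (chartVec e p v)).trans ?_
  have h2 := mfderiv_symm_chartVec he hp v
  have key : ∀ q : M, q = p → ∀ z : Model d, z = v →
      differential f q (z : TangentSpace 𝓘(ℝ, Model d) q) = differential f p v := by
    rintro q rfl z rfl
    rfl
  exact key _ (e.left_inv hp) _ h2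

theorem contDiffOn_comp_symm (he : e ∈ IsManifold.maximalAtlas 𝓘(ℝ, Model d) ∞ M) {f : M → ℝ}
    (hf : SmoothFun (d := d) f) : ContDiffOn ℝ ∞ (fun y => f (e.symm y)) e.target :=
  contMDiffOn_iff_contDiffOn.1 (hf.comp_contMDiffOn (contMDiffOn_symm_of_mem_maximalAtlas he))
end

/-! ### Calculus of divergences -/

section
variable [MeasurableSpace M] {μ : SmoothDensity d M}

theorem contDiffOn_dens_mul_vecComp {e : OpenPartialHomeomorph M (Model d)}
    (he : e ∈ IsManifold.maximalAtlas 𝓘(ℝ, Model d) ∞ M) (X : Sec (VB.tangent d M))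
    (i : Fin (d + 1)) :
    ContDiffOn ℝ ∞ (fun y => μ.dens e y * vecComp e (fun x => X x) y i) e.target :=
  (μ.smooth e he).mul (contDiffOn_euclidean.1 (contDiffOn_vecComp he X) i)

theorem differentiableAt_dens_mul_vecComp {e : OpenPartialHomeomorph M (Model d)}
    (he : e ∈ IsManifold.maximalAtlas 𝓘(ℝ, Model d) ∞ M) (X : Sec (VB.tangent d M))
    (i : Fin (d + 1))
    {y : Model d} (hy : y ∈ e.target) :
    DifferentiableAt ℝ (fun y => μ.dens e y * vecComp e (fun x => X x) y i) y :=
  ((contDiffOn_dens_mul_vecComp he X i).differentiableOn (by simp)).differentiableAt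
    (e.open_target.mem_nhds hy)

theorem IsDivergence.eq_div {X : (x : M) → TangentSpace 𝓘(ℝ, Model d) x} {ρ : M → ℝ}
    (h : IsDivergence μ X ρ) {e : OpenPartialHomeomorph M (Model d)}
    (he : e ∈ IsManifold.maximalAtlas 𝓘(ℝ, Model d) ∞ M) {p : M} (hp : p ∈ e.source) :
    ρ p = (∑ i, fderiv ℝ (fun y => μ.dens e y * vecComp e X y i) (e p)
      (EuclideanSpace.single i 1)) / μ.dens e (e p) := by
  rw [eq_div_iff (μ.pos e he _ (e.map_source hp)).ne', mul_comm]
  exact h e he p hp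

theorem IsDivergence.unique {X : (x : M) → TangentSpace 𝓘(ℝ, Model d) x} {ρ ρ' : M → ℝ}
    (h : IsDivergence μ X ρ) (h' : IsDivergence μ X ρ') : ρ = ρ' := by
  funext p
  rw [h.eq_div (IsManifold.chart_mem_maximalAtlas p) (mem_chart_source _ p),
    h'.eq_div (IsManifold.chart_mem_maximalAtlas p) (mem_chart_source _ p)]

theorem IsDivergence.congr_of_eventuallyEq {X Y : (x : M) → TangentSpace 𝓘(ℝ, Model d) x}
    {ρ σ : M → ℝ} (h : IsDivergence μ X ρ) (h' : IsDivergence μ Y σ) {p : M}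
    (hXY : ∀ᶠ q in 𝓝 p, X q = Y q) : ρ p = σ p := by
  have he := IsManifold.chart_mem_maximalAtlas (I := 𝓘(ℝ, Model d)) (n := ∞) p
  have hp := mem_chart_source (Model d) p
  rw [h.eq_div he hp, h'.eq_div he hp]
  congr 1
  refine Finset.sum_congr rfl fun i _ => ?_
  congr 1
  refine Filter.EventuallyEq.fderiv_eq ?_
  have hc : Tendsto (chartAt (Model d) p).symm (𝓝 (chartAt (Model d) p p)) (𝓝 p) := by
    have := (chartAt (Model d) p).continuousAt_symm ((chartAt (Model d) p).map_source hp)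
    rw [ContinuousAt, (chartAt (Model d) p).left_inv hp] at this
    exact this
  filter_upwards [hc.eventually hXY] with y hy
  unfold vecComp
  rw [hy]

theorem IsDivergence.eq_zero {X : (x : M) → TangentSpace 𝓘(ℝ, Model d) x}
    {ρ : M → ℝ} (h : IsDivergence μ X ρ) {p : M} (hX : ∀ᶠ q in 𝓝 p, X q = 0) : ρ p = 0 := by
  refine h.congr_of_eventuallyEq (Y := fun _ => 0) (σ := fun _ => 0) (fun e he q hq => ?_) hX
  have : ∀ i, (fun y => μ.dens e y * vecComp e (fun x => (0 : TangentSpace 𝓘(ℝ, Model d) x)) y i) =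
      fun _ => 0 := fun i => by
    funext y
    rw [vecComp_eq_zero rfl]
    simp
  simp [this]

theorem IsDivergence.add {X Y : Sec (VB.tangent d M)} {ρ σ : M → ℝ}
    (hX : IsDivergence μ (fun x => X x) ρ) (hY : IsDivergence μ (fun x => Y x) σ) :
    IsDivergence μ (fun x => (X + Y) x) (fun x => ρ x + σ x) := by
  intro e he p hp
  rw [mul_add, hX e he p hp, hY e he p hp, ← Finset.sum_add_distrib]
  refine Finset.sum_congr rfl fun i _ => ?_
  have : (fun y => μ.dens e y * vecComp e (fun x => (X + Y) x) y i) = fun y =>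
      μ.dens e y * vecComp e (fun x => X x) y i + μ.dens e y * vecComp e (fun x => Y x) y i := by
    funext y
    rw [vecComp_add, PiLp.add_apply, mul_add]
  rw [this, fderiv_fun_add (differentiableAt_dens_mul_vecComp he X i (e.map_source hp))
    (differentiableAt_dens_mul_vecComp he Y i (e.map_source hp))]
  rfl

/-- The Leibniz rule for divergences. -/
theorem IsDivergence.smulSec {X : Sec (VB.tangent d M)} {ρ : M → ℝ}
    (hX : IsDivergence μ (fun x => X x) ρ) {f : M → ℝ} (hf : SmoothFun (d := d) f) :
    IsDivergence μ (fun x => smulSec f hf X x) (fun x => f x * ρ x + differential f x (X x)) := by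
  intro e he p hp
  have hy := e.map_source hp
  have hfd : DifferentiableAt ℝ (fun y => f (e.symm y)) (e p) :=
    ((contDiffOn_comp_symm he hf).differentiableOn (by simp)).differentiableAt
      (e.open_target.mem_nhds hy)
  have h1 : ∀ i : Fin (d + 1),
      fderiv ℝ (fun y => μ.dens e y * vecComp e (fun x => Peierls.smulSec f hf X x) y i) (e p)
        (EuclideanSpace.single i 1) =
      f p * fderiv ℝ (fun y => μ.dens e y * vecComp e (fun x => X x) y i) (e p)
        (EuclideanSpace.single i 1) +
      μ.dens e (e p) * (vecComp e (fun x => X x) (e p) i *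
        fderiv ℝ (fun y => f (e.symm y)) (e p) (EuclideanSpace.single i 1)) := by
    intro i
    have : (fun y => μ.dens e y * vecComp e (fun x => Peierls.smulSec f hf X x) y i) = fun y =>
        f (e.symm y) * (μ.dens e y * vecComp e (fun x => X x) y i) := by
      funext y
      rw [vecComp_smulSec, PiLp.smul_apply, smul_eq_mul]
      ring
    rw [this, fderiv_fun_mul hfd (differentiableAt_dens_mul_vecComp he X i hy), e.left_inv hp]
    simp only [_root_.add_apply, _root_.smul_apply, smul_eq_mul]
    ring
  rw [Finset.sum_congr rfl fun i _ => h1 i, Finset.sum_add_distrib, ← Finset.mul_sum,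
    ← Finset.mul_sum,
    ← hX e he p hp]
  have h2 : ∑ i, vecComp e (fun x => X x) (e p) i *
      fderiv ℝ (fun y => f (e.symm y)) (e p) (EuclideanSpace.single i 1) =
        differential f p (X p) := by
    have h3 : chartVec e p (X p) = ∑ i, vecComp e (fun x => X x) (e p) i •
        (EuclideanSpace.single i 1 : Model d) := by
      have h4 : chartVec e p (X p) = vecComp e (fun x => X x) (e p) := by
        unfold vecComp
        rw [e.left_inv hp]
      rw [h4]
      ext j
      simp [Finset.sum_apply, Pi.single_apply]
    rw [← fderiv_comp_symm he hf hp (X p), h3, map_sum]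
    simp
  rw [h2]
  ring

theorem IsDivergence.continuous {X : Sec (VB.tangent d M)} {ρ : M → ℝ}
    (hX : IsDivergence μ (fun x => X x) ρ) : Continuous ρ := by
  refine continuous_iff_continuousAt.2 fun p => ?_
  have he := IsManifold.chart_mem_maximalAtlas (I := 𝓘(ℝ, Model d)) (n := ∞) p
  set e := chartAt (Model d) p
  have hp : p ∈ e.source := mem_chart_source (Model d) p
  have h1 : ContinuousOn (fun y => (∑ i, fderiv ℝ
    (fun y => μ.dens e y * vecComp e (fun x => X x) y i) y
      (EuclideanSpace.single i 1)) / μ.dens e y) e.target := by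
    refine ContinuousOn.div (continuousOn_finsetSum _ fun i _ => ?_) (μ.smooth e he).continuousOn
      fun y hy => (μ.pos e he y hy).ne'
    exact ((contDiffOn_dens_mul_vecComp he X i).continuousOn_fderiv_of_isOpen e.open_target
      (by simp)).clm_apply continuousOn_const
  have h2 := ((h1.comp e.continuousOn e.mapsTo).continuousAt (e.open_source.mem_nhds hp))
  refine h2.congr ?_
  filter_upwards [e.open_source.mem_nhds hp] with q hq
  exact (hX.eq_div he hq).symm
end

/-! ### Integration in charts -/

section
variable [T2Space M] [SigmaCompactSpace M] [MeasurableSpace M] [BorelSpace M]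
  (μ : SmoothDensity d M)
  {e : OpenPartialHomeomorph M (Model d)}

theorem aemeasurable_chart (e : OpenPartialHomeomorph M (Model d)) :
    AEMeasurable e (μ.meas.restrict e.source) :=
  e.continuousOn.aemeasurable e.open_source.measurableSet

theorem aemeasurable_dens (he : e ∈ IsManifold.maximalAtlas 𝓘(ℝ, Model d) ∞ M) :
    AEMeasurable (fun y => ENNReal.ofReal (μ.dens e y)) (volume.restrict e.target) :=
  ((μ.smooth e he).continuousOn.aemeasurable e.open_target.measurableSet).ennreal_ofReal

theorem SmoothDensity.meas_lt_top (he : e ∈ IsManifold.maximalAtlas 𝓘(ℝ, Model d) ∞ M) {K : Set M}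
    (hK : IsCompact K) (hKe : K ⊆ e.source) : μ.meas K < ⊤ := by
  have hcont : ContinuousOn e K := e.continuousOn.mono hKe
  have hT : IsCompact (e '' K) := hK.image_of_continuousOn hcont
  have hTt : e '' K ⊆ e.target := image_subset_iff.2 fun x hx => e.map_source (hKe hx)
  calc μ.meas K ≤ μ.meas.restrict e.source (e ⁻¹' (e '' K)) := by
        refine le_trans (measure_mono ?_) (Measure.le_restrict_apply _ _)
        exact fun x hx => ⟨mem_image_of_mem _ hx, hKe hx⟩
    _ = (μ.meas.restrict e.source).map e (e '' K) :=
        (Measure.map_apply_of_aemeasurable (aemeasurable_chart μ e) hT.measurableSet).symm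
    _ = ∫⁻ y in e '' K, ENNReal.ofReal (μ.dens e y) ∂(volume.restrict e.target) := by
        rw [μ.map_eq e he, withDensity_apply _ hT.measurableSet]
    _ ≤ ∫⁻ y in e '' K, ENNReal.ofReal (μ.dens e y) :=
        lintegral_mono' (Measure.restrict_mono subset_rfl Measure.restrict_le_self) le_rfl
    _ < ⊤ := (((μ.smooth e he).continuousOn.mono hTt).integrableOn_compact hT).lintegral_lt_top

instance SmoothDensity.isLocallyFiniteMeasure : IsLocallyFiniteMeasure μ.meas where
  finiteAtNhds x := by
    have : LocallyCompactSpace M := ChartedSpace.locallyCompactSpace (Model d) M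
    obtain ⟨K, hK, hxK, hKe⟩ := exists_compact_subset (chartAt (Model d) x).open_source
      (mem_chart_source (Model d) x)
    exact ⟨K, mem_interior_iff_mem_nhds.1 hxK,
      μ.meas_lt_top (IsManifold.chart_mem_maximalAtlas x) hK hKe⟩

instance SmoothDensity.isOpenPosMeasure : μ.meas.IsOpenPosMeasure where
  open_pos U hU hne h0 := by
    obtain ⟨x, hx⟩ := hne
    have he := IsManifold.chart_mem_maximalAtlas (I := 𝓘(ℝ, Model d)) (n := ∞) x
    set e := chartAt (Model d) x with hedef
    have hxe : x ∈ e.source := mem_chart_source (Model d) x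
    have hT : IsOpen (e '' (e.source ∩ U)) := by
      rw [e.image_source_inter_eq']
      exact e.isOpen_inter_preimage_symm hU
    have hTt : e '' (e.source ∩ U) ⊆ e.target := image_subset_iff.2 fun x hx => e.map_source hx.1
    have h1 : (μ.meas.restrict e.source).map e (e '' (e.source ∩ U)) = 0 := by
      rw [Measure.map_apply_of_aemeasurable (aemeasurable_chart μ e) hT.measurableSet,
        Measure.restrict_apply' e.open_source.measurableSet]
      refine measure_mono_null ?_ h0
      rintro q ⟨⟨q', hq', hqq⟩, hq⟩
      rw [← e.injOn hq'.1 hq hqq]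
      exact hq'.2
    rw [μ.map_eq e he, withDensity_apply_eq_zero' (aemeasurable_dens μ he)] at h1
    have h2 : {y | ENNReal.ofReal (μ.dens e y) ≠ 0} ∩ e '' (e.source ∩ U) =
      e '' (e.source ∩ U) := by
      refine inter_eq_right.2 fun y hy => ?_
      simpa using μ.pos e he y (hTt hy)
    rw [h2, Measure.restrict_apply' e.open_target.measurableSet, inter_eq_left.2 hTt] at h1
    exact hT.measure_ne_zero volume ⟨e x, mem_image_of_mem _ ⟨hxe, hx⟩⟩ h1

/-- Integrals over the domain of a chart, computed in coordinates. -/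
theorem SmoothDensity.integral_source (he : e ∈ IsManifold.maximalAtlas 𝓘(ℝ, Model d) ∞ M)
    {f : M → ℝ}
    (hf : Measurable f) :
    ∫ x in e.source, f x ∂μ.meas = ∫ y in e.target, μ.dens e y * f (e.symm y) := by
  have hfs : AEStronglyMeasurable (fun y => f (e.symm y)) (volume.restrict e.target) :=
    (hf.comp_aemeasurable (e.continuousOn_symm.aemeasurable
      e.open_target.measurableSet)).aestronglyMeasurable
  calc ∫ x in e.source, f x ∂μ.meas = ∫ x in e.source, f (e.symm (e x)) ∂μ.meas :=
        setIntegral_congr_fun e.open_source.measurableSet fun x hx => by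
          rw [e.left_inv hx]
    _ = ∫ y, f (e.symm y) ∂((μ.meas.restrict e.source).map e) := by
        refine (integral_map (f := fun y => f (e.symm y)) (aemeasurable_chart μ e) ?_).symm
        rw [μ.map_eq e he]
        exact hfs.mono_ac (withDensity_absolutelyContinuous _ _)
    _ = ∫ y in e.target, (ENNReal.ofReal (μ.dens e y)).toReal • f (e.symm y) := by
        rw [μ.map_eq e he, integral_withDensity_eq_integral_toReal_smul₀ (aemeasurable_dens μ he)
          (Eventually.of_forall fun y => ENNReal.ofReal_lt_top)]
    _ = ∫ y in e.target, μ.dens e y * f (e.symm y) :=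
        setIntegral_congr_fun e.open_target.measurableSet fun y hy => by
          simp only [smul_eq_mul]
          rw [ENNReal.toReal_ofReal (μ.pos e he y hy).le]

open Classical in
/-- The coordinate representation, with respect to `dy`, of the `(n-1)`-form given by the vector
field `X`, extended by zero outside the chart. -/
noncomputable def chartField (e : OpenPartialHomeomorph M (Model d))
    (X : (x : M) → TangentSpace 𝓘(ℝ, Model d) x) (y : Model d) : Model d :=
  if y ∈ e.target then μ.dens e y • vecComp e X y else 0

variable {μ}

theorem continuous_slicePt : Continuous (slicePt (d := d)) := by
  refine (PiLp.continuous_toLp 2 _).comp (continuous_pi fun i => ?_)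
  refine Fin.cases ?_ (fun j => ?_) i
  · exact continuous_const
  · exact continuous_apply j

/-- The flux in a chart in terms of the field extended by zero. -/
theorem localFlux_eq (e : OpenPartialHomeomorph M (Model d))
    (X : (x : M) → TangentSpace 𝓘(ℝ, Model d) x) :
    localFlux μ e X = ∫ y : Fin d → ℝ, chartField μ e X (WithLp.toLp 2 (Fin.cons 0 y)) 0 := by
  unfold localFlux
  have hm : MeasurableSet {y : Fin d → ℝ | slicePt y ∈ e.target} :=
    (e.open_target.preimage continuous_slicePt).measurableSet
  rw [← integral_indicator hm]
  refine integral_congr_ae (Eventually.of_forall fun y => ?_)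
  by_cases hy : slicePt y ∈ e.target
  · rw [indicator_of_mem (show y ∈ {y : Fin d → ℝ | slicePt y ∈ e.target} from hy)]
    have h1 : chartField μ e X (slicePt y) = μ.dens e (slicePt y) • vecComp e X (slicePt y) :=
      if_pos hy
    change _ = chartField μ e X (slicePt y) 0
    rw [h1, PiLp.smul_apply, smul_eq_mul, mul_comm]
  · rw [indicator_of_notMem (show y ∉ {y : Fin d → ℝ | slicePt y ∈ e.target} from hy)]
    have h1 : chartField μ e X (slicePt y) = 0 := if_neg hy
    change _ = chartField μ e X (slicePt y) 0
    rw [h1]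
    rfl

section
variable {X : Sec (VB.tangent d M)} {ρ : M → ℝ}

theorem chartField_eq_zero_of_notMem {y : Model d}
    (hy : y ∉ e '' supp X) : chartField μ e (fun x => X x) y = 0 := by
  unfold chartField
  split_ifs with h
  · rw [vecComp_eq_zero, smul_zero]
    by_contra hne
    exact hy ⟨e.symm y, subset_closure hne, e.right_inv h⟩
  · rfl

theorem hasCompactSupport_chartField (hc : IsCompact (supp X)) (hs : supp X ⊆ e.source) :
    HasCompactSupport (chartField μ e (fun x => X x)) :=
  HasCompactSupport.intro (hc.image_of_continuousOn (e.continuousOn.mono hs)) fun _ hy =>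
    chartField_eq_zero_of_notMem hy

theorem eventually_chartField_eq_zero (hc : IsCompact (supp X)) (hs : supp X ⊆ e.source)
    {y : Model d} (hy : y ∉ e.target) :
    ∀ᶠ z in 𝓝 y, chartField μ e (fun x => X x) z = 0 := by
  have hcl := (hc.image_of_continuousOn (e.continuousOn.mono hs)).isClosed
  have hy' : y ∉ e '' supp X := fun h => hy (by
    obtain ⟨x, hx, rfl⟩ := h
    exact e.map_source (hs hx))
  filter_upwards [hcl.isOpen_compl.mem_nhds hy'] with z hz
  exact chartField_eq_zero_of_notMem hz

theorem contDiff_chartField (he : e ∈ IsManifold.maximalAtlas 𝓘(ℝ, Model d) ∞ M)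
    (hc : IsCompact (supp X)) (hs : supp X ⊆ e.source) :
    ContDiff ℝ 1 (chartField μ e (fun x => X x)) := by
  refine contDiff_iff_contDiffAt.2 fun y => ?_
  by_cases hy : y ∈ e.target
  · have h1 : ContDiffOn ℝ ∞ (fun y => μ.dens e y • vecComp e (fun x => X x) y) e.target :=
      (μ.smooth e he).smul (contDiffOn_vecComp he X)
    refine ((h1.of_le (by simp)).contDiffAt (e.open_target.mem_nhds hy)).congr_of_eventuallyEq ?_
    filter_upwards [e.open_target.mem_nhds hy] with z hz
    exact if_pos hz
  · exact contDiffAt_const.congr_of_eventuallyEq (eventually_chartField_eq_zero hc hs hy)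

theorem divergence_chartField (hρ : IsDivergence μ (fun x => X x) ρ)
    (he : e ∈ IsManifold.maximalAtlas 𝓘(ℝ, Model d) ∞ M) {y : Model d} (hy : y ∈ e.target) :
    ∑ i, fderiv ℝ (fun z => chartField μ e (fun x => X x) z i) y (EuclideanSpace.single i 1) =
      μ.dens e y * ρ (e.symm y) := by
  have h := hρ e he _ (e.map_target hy)
  rw [e.right_inv hy] at h
  rw [h]
  refine Finset.sum_congr rfl fun i _ => ?_
  congr 1
  refine Filter.EventuallyEq.fderiv_eq ?_
  filter_upwards [e.open_target.mem_nhds hy] with z hz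
  simp only [chartField, if_pos hz]
  rfl

theorem divergence_chartField_of_notMem (hc : IsCompact (supp X)) (hs : supp X ⊆ e.source)
    {y : Model d} (hy : y ∉ e.target) :
    ∑ i, fderiv ℝ (fun z => chartField μ e (fun x => X x) z i) y
      (EuclideanSpace.single i 1) = 0 := by
  refine Finset.sum_eq_zero fun i _ => ?_
  have : (fun z => chartField μ e (fun x => X x) z i) =ᶠ[𝓝 y] fun _ => 0 := by
    filter_upwards [eventually_chartField_eq_zero (μ := μ) hc hs hy] with z hz
    rw [hz]
    rfl
  rw [this.fderiv_eq]
  simp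

/-- The divergence theorem in a slice chart: the flux through the slice is the integral of the
divergence over the points below it. -/
theorem integral_divergence_lt (hρ : IsDivergence μ (fun x => X x) ρ)
    (he : e ∈ IsManifold.maximalAtlas 𝓘(ℝ, Model d) ∞ M) (hc : IsCompact (supp X))
    (hs : supp X ⊆ e.source) :
    ∫ x in {x | x ∈ e.source ∧ e x 0 < 0}, ρ x ∂μ.meas = localFlux μ e (fun x => X x) := by
  have hTo : IsOpen {x | x ∈ e.source ∧ e x 0 < 0} :=
    e.isOpen_inter_preimage (isOpen_lt (f := fun y : Model d => y 0) (by fun_prop) continuous_const)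
  rw [localFlux_eq, ← integral_div_halfspace (contDiff_chartField he hc hs)
    (hasCompactSupport_chartField hc hs)]
  have h1 : ∫ x in {x | x ∈ e.source ∧ e x 0 < 0}, ρ x ∂μ.meas =
      ∫ x in e.source, {x | x ∈ e.source ∧ e x 0 < 0}.indicator ρ x ∂μ.meas := by
    rw [setIntegral_indicator hTo.measurableSet]
    congr 2
    exact (inter_eq_right.2 fun x hx => hx.1).symm
  rw [h1, μ.integral_source he (hρ.continuous.measurable.indicator hTo.measurableSet),
    ← integral_indicator e.open_target.measurableSet,
    ← integral_indicator (isOpen_lt (by fun_prop) continuous_const).measurableSet]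
  refine integral_congr_ae (Eventually.of_forall fun y => ?_)
  by_cases hy : y ∈ e.target
  · by_cases hy0 : y 0 < 0
    · rw [indicator_of_mem hy, indicator_of_mem (show y ∈ {y : Model d | y 0 < 0} from hy0),
        divergence_chartField hρ he hy, indicator_of_mem]
      exact ⟨e.map_target hy, by rwa [e.right_inv hy]⟩
    · rw [indicator_of_mem hy, indicator_of_notMem (show y ∉ {y : Model d | y 0 < 0} from hy0),
        indicator_of_notMem, mul_zero]
      rintro ⟨-, h⟩
      rw [e.right_inv hy] at h
      exact hy0 h
  · rw [indicator_of_notMem hy]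
    by_cases hy0 : y 0 < 0
    · rw [indicator_of_mem (show y ∈ {y : Model d | y 0 < 0} from hy0),
        divergence_chartField_of_notMem hc hs hy]
    · rw [indicator_of_notMem (show y ∉ {y : Model d | y 0 < 0} from hy0)]

theorem divergence_eq_zero_of_notMem_supp (hρ : IsDivergence μ (fun x => X x) ρ) {x : M}
    (hx : x ∉ supp X) : ρ x = 0 := by
  refine hρ.eq_zero ?_
  filter_upwards [(_root_.isClosed_closure (s := {x | X x ≠ 0})).isOpen_compl.mem_nhds hx] with q hq
  by_contra h
  exact hq (subset_closure h)

theorem integral_divergence_eq_zero_of_chart (hρ : IsDivergence μ (fun x => X x) ρ)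
    (he : e ∈ IsManifold.maximalAtlas 𝓘(ℝ, Model d) ∞ M) (hc : IsCompact (supp X))
    (hs : supp X ⊆ e.source) : ∫ x, ρ x ∂μ.meas = 0 := by
  rw [← setIntegral_eq_integral_of_forall_compl_eq_zero (s := e.source)
    (fun x hx => divergence_eq_zero_of_notMem_supp hρ fun h => hx (hs h)),
    μ.integral_source he hρ.continuous.measurable, ← integral_div_eq_zero
    (contDiff_chartField he hc hs) (hasCompactSupport_chartField (μ := μ) hc hs),
    ← integral_indicator e.open_target.measurableSet]
  refine integral_congr_ae (Eventually.of_forall fun y => ?_)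
  by_cases hy : y ∈ e.target
  · simp only [indicator_of_mem hy, divergence_chartField hρ he hy]
  · simp only [indicator_of_notMem hy, divergence_chartField_of_notMem hc hs hy]

end
end

/-! ### The theorem of Stokes for a Cauchy surface -/

section
variable [T2Space M] [SigmaCompactSpace M]

theorem supp_smulSec {V : VB.{u, v} d M} {f : M → ℝ} {hf : SmoothFun (d := d) f} {s : Sec V} :
    supp (smulSec f hf s) ⊆ tsupport f ∩ supp s := by
  refine subset_inter (closure_mono fun x hx h => ?_) (closure_mono fun x hx h => ?_)
  · simp only [mem_ofPred_eq, smulSec_apply] at hx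
    exact hx (by rw [h, zero_smul])
  · simp only [mem_ofPred_eq, smulSec_apply] at hx
    exact hx (by rw [h, smul_zero])

theorem sum_sec_apply {V : VB.{u, v} d M} {ι : Type*} (s : Finset ι) (X : ι → Sec V) (x : M) :
    (∑ i ∈ s, X i) x = ∑ i ∈ s, X i x := by
  classical
  induction s using Finset.induction_on with
  | empty => rfl
  | insert a s ha ih => rw [Finset.sum_insert ha, Finset.sum_insert ha, ← ih]; rfl

theorem notMem_supp_iff {V : VB.{u, v} d M} {s : Sec V} {x : M} :
    x ∉ supp s ↔ ∀ᶠ q in 𝓝 x, s q = 0 := by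
  rw [supp, mem_closure_iff_frequently, not_frequently]
  simp

theorem isClosed_supp {V : VB.{u, v} d M} (s : Sec V) : IsClosed (supp s) := _root_.isClosed_closure

theorem exists_smooth_cutoff {K U : Set M} (hK : IsCompact K) (hU : IsOpen U) (hKU : K ⊆ U) :
    ∃ κ : M → ℝ, SmoothFun (d := d) κ ∧ HasCompactSupport κ ∧ tsupport κ ⊆ U ∧
      ∀ᶠ x in 𝓝ˢ K, κ x = 1 := by
  have : LocallyCompactSpace M := ChartedSpace.locallyCompactSpace (Model d) M
  obtain ⟨L, hL, hKL, hLU⟩ := exists_compact_between hK hU hKU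
  obtain ⟨f, hf1, hf0, -⟩ := exists_contMDiffMap_one_nhds_of_subset_interior 𝓘(ℝ, Model d)
    (n := (⊤ : ℕ∞)) hK.isClosed hKL
  have hsub : tsupport f ⊆ L := closure_minimal (fun x hx => by
    by_contra h
    exact hx (hf0 x h)) hL.isClosed
  exact ⟨f, f.contMDiff, HasCompactSupport.of_support_subset_isCompact hL
    ((subset_tsupport _).trans hsub), hsub.trans hLU, hf1⟩

variable [MeasurableSpace M] [BorelSpace M] {μ : SmoothDensity d M}

theorem IsDivergence.zero : IsDivergence μ (fun x => (0 : Sec (VB.tangent d M)) x)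
    (fun _ => 0) := by
  intro e he q hq
  have : ∀ i, (fun y => μ.dens e y * vecComp e (fun x => (0 : Sec (VB.tangent d M)) x) y i) =
      fun _ => 0 := fun i => by
    funext y
    rw [vecComp_eq_zero rfl]
    simp
  simp only [this]
  simp

theorem IsDivergence.sum {ι : Type*} (s : Finset ι) {X : ι → Sec (VB.tangent d M)} {ρ : ι → M → ℝ}
    (h : ∀ i ∈ s, IsDivergence μ (fun x => X i x) (ρ i)) :
    IsDivergence μ (fun x => (∑ i ∈ s, X i) x) (fun x => ∑ i ∈ s, ρ i x) := by
  classical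
  induction s using Finset.induction_on with
  | empty => simpa using IsDivergence.zero
  | insert a s ha ih =>
    have := (h a (Finset.mem_insert_self a s)).add
      (ih fun i hi => h i (Finset.mem_insert_of_mem hi))
    simpa [Finset.sum_insert ha] using this

/-- The integral of the divergence of a compactly supported field vanishes. -/
theorem integral_divergence_eq_zero {X : Sec (VB.tangent d M)} {ρ : M → ℝ}
    (hρ : IsDivergence μ (fun x => X x) ρ) (hc : IsCompact (supp X)) : ∫ x, ρ x ∂μ.meas = 0 := by
  obtain ⟨N, i, f, hf, hfc, hfs, hf1⟩ := exists_finite_partition (d := d) hc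
    (fun x : M => (chartAt (Model d) x).source) (fun x => (chartAt (Model d) x).open_source)
    (fun x _ => mem_iUnion.2 ⟨x, mem_chart_source _ x⟩)
  have h1 : ∀ j, IsDivergence μ (fun x => smulSec (f j) (hf j) X x)
      (fun x => f j x * ρ x + differential (f j) x (X x)) := fun j => hρ.smulSec (hf j)
  have hX : ∑ j, smulSec (f j) (hf j) X = X := by
    ext x
    rw [sum_sec_apply]
    simp only [smulSec_apply]
    rw [← Finset.sum_smul]
    by_cases hx : X x = 0
    · rw [hx, smul_zero]
    · rw [hf1.self_of_nhdsSet x (subset_closure hx), one_smul]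
  have h2 := IsDivergence.sum Finset.univ (fun j _ => h1 j)
  rw [hX] at h2
  rw [hρ.unique h2, integral_finsetSum]
  · refine Finset.sum_eq_zero fun j _ => ?_
    refine integral_divergence_eq_zero_of_chart (h1 j) (IsManifold.chart_mem_maximalAtlas (i j)) ?_
      (supp_smulSec.trans (inter_subset_left.trans (hfs j)))
    exact hc.of_isClosed_subset (isClosed_supp _) (supp_smulSec.trans inter_subset_right)
  · intro j _
    refine (h1 j).continuous.integrable_of_hasCompactSupport
      (HasCompactSupport.intro hc fun x hx => ?_)
    exact divergence_eq_zero_of_notMem_supp (h1 j) fun h => hx (supp_smulSec h).2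

variable {C : ChronalCone d M} {S : Set M}

theorem localFlux_congr {e : OpenPartialHomeomorph M (Model d)} (he : IsSliceChart S e)
    {X Y : (x : M) → TangentSpace 𝓘(ℝ, Model d) x} (h : ∀ p ∈ S, X p = Y p) :
    localFlux μ e X = localFlux μ e Y := by
  have hm : MeasurableSet {y : Fin d → ℝ | slicePt y ∈ e.target} :=
    (e.open_target.preimage continuous_slicePt).measurableSet
  refine setIntegral_congr_fun hm fun y hy => ?_
  have hS : e.symm (slicePt y) ∈ S := by
    rw [he.2 _ (e.map_target hy), e.right_inv hy]
    rfl
  simp only [vecComp]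
  rw [h _ hS]

namespace IsCauchySurface
variable (hS : IsCauchySurface C S)
include hS

section
variable {X : Sec (VB.tangent d M)} {ρ : M → ℝ} (hρ : IsDivergence μ (fun x => X x) ρ)
  (hc : IsCompact (supp X ∩ (S ∪ pastOf C S)))
include hρ hc

theorem integrableOn_divergence : IntegrableOn ρ (pastOf C S) μ.meas := by
  refine (hρ.continuous.continuousOn.integrableOn_compact hc).of_forall_sdiff_eq_zero
    hS.isOpen_pastOf.measurableSet fun x hx => ?_
  exact divergence_eq_zero_of_notMem_supp hρ fun h => hx.2 ⟨h, Or.inr hx.1⟩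

/-- Fields supported away from `S` have vanishing flux through `S`. -/
theorem integral_divergence_of_disjoint (hd : Disjoint (supp X) S) :
    ∫ x in pastOf C S, ρ x ∂μ.meas = 0 := by
  have hsub : supp X ∩ (S ∪ pastOf C S) ⊆ pastOf C S := fun x hx =>
    hx.2.resolve_left (disjoint_left.1 hd hx.1)
  obtain ⟨κ, hκ, hκc, hκs, hκ1⟩ := exists_smooth_cutoff (d := d) hc hS.isOpen_pastOf hsub
  have h1 := hρ.smulSec hκ
  have h2 := integral_divergence_eq_zero h1
    (hκc.isCompact.of_isClosed_subset (isClosed_supp _) (supp_smulSec.trans inter_subset_left))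
  rw [← h2, ← setIntegral_eq_integral_of_forall_compl_eq_zero (s := pastOf C S) fun x hx =>
    divergence_eq_zero_of_notMem_supp h1 fun h => hx (hκs (supp_smulSec h).1)]
  refine setIntegral_congr_fun hS.isOpen_pastOf.measurableSet fun x hx => ?_
  refine hρ.congr_of_eventuallyEq h1 ?_
  by_cases hxs : x ∈ supp X
  · filter_upwards [eventually_nhdsSet_iff_forall.1 hκ1 x ⟨hxs, Or.inr hx⟩] with q hq
    rw [smulSec_apply, hq, one_smul]
  · filter_upwards [notMem_supp_iff.1 hxs] with q hq
    rw [smulSec_apply, hq, smul_zero]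

end

/-- Decomposition of the integral of a divergence over the past of `S` with respect to finitely many
functions and the difference of their sum from one. -/
theorem integral_divergence_split {X : Sec (VB.tangent d M)} {ρ : M → ℝ}
    (hρ : IsDivergence μ (fun x => X x) ρ) (hc : IsCompact (supp X ∩ (S ∪ pastOf C S)))
    {N : ℕ} {f : Fin N → M → ℝ} (hf : ∀ j, SmoothFun (d := d) (f j))
    (hg : SmoothFun (d := d) (fun x => 1 - ∑ j, f j x)) :
    ∫ x in pastOf C S, ρ x ∂μ.meas =
      ∑ j, ∫ x in pastOf C S, (f j x * ρ x + differential (f j) x (X x)) ∂μ.meas +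
      ∫ x in pastOf C S, ((1 - ∑ j, f j x) * ρ x +
        differential (fun x => 1 - ∑ j, f j x) x (X x)) ∂μ.meas := by
  have h1 : ∀ j, IsDivergence μ (fun x => smulSec (f j) (hf j) X x)
      (fun x => f j x * ρ x + differential (f j) x (X x)) := fun j => hρ.smulSec (hf j)
  have h2 := hρ.smulSec hg
  have hX : ∑ j, smulSec (f j) (hf j) X + smulSec _ hg X = X := by
    ext x
    rw [ContMDiffSection.coe_add, Pi.add_apply, sum_sec_apply]
    simp only [smulSec_apply]
    rw [← Finset.sum_smul]
    change (∑ j, f j x) • X x + (1 - ∑ j, f j x) • X x = X x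
    rw [← add_smul, add_sub_cancel, one_smul]
  have h3 := (IsDivergence.sum Finset.univ (fun j _ => h1 j)).add h2
  rw [hX] at h3
  have hcs : ∀ (g : M → ℝ) (hg : SmoothFun (d := d) g),
      IsCompact (supp (smulSec g hg X) ∩ (S ∪ pastOf C S)) := fun g hg =>
    hc.of_isClosed_subset ((isClosed_supp _).inter hS.isClosed_union_pastOf)
      (inter_subset_inter_left _ (supp_smulSec.trans inter_subset_right))
  rw [hρ.unique h3, integral_add, integral_finsetSum]
  · rw [← hρ.unique h3]
  · exact fun j _ => hS.integrableOn_divergence (h1 j) (hcs _ _)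
  · exact integrable_finsetSum _ fun j _ => hS.integrableOn_divergence (h1 j) (hcs _ _)
  · have := hS.integrableOn_divergence h2 (hcs _ _)
    exact this

/-- For a compactly supported field in a slice chart, the flux is the integral of the divergence
over the past of `S`. -/
theorem localFlux_eq_integral {e : OpenPartialHomeomorph M (Model d)}
    (he : IsFutureSliceChart C S e) {X : Sec (VB.tangent d M)} {ρ : M → ℝ}
    (hρ : IsDivergence μ (fun x => X x) ρ) (hc : IsCompact (supp X)) (hs : supp X ⊆ e.source) :
    localFlux μ e (fun x => X x) = ∫ x in pastOf C S, ρ x ∂μ.meas := by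
  -- the cutoff `κ` is one where the support meets `S`, and is supported where the sides of the
  -- chart are the past and the future of `S`
  set U : Set M := e.source ∩
    interior {q | (e q 0 < 0 → q ∈ pastOf C S) ∧ (0 < e q 0 → q ∈ futureOf C S)} with hU
  obtain ⟨κ, hκ, hκc, hκs, hκ1⟩ := exists_smooth_cutoff (d := d) (hc.inter_right hS.isClosed)
    (e.open_source.inter isOpen_interior : IsOpen U)
    (fun x hx => ⟨hs hx.1, mem_interior_iff_mem_nhds.2 (hS.eventually_sides he hx.2 (hs hx.1))⟩)
  have h1 := hρ.smulSec hκ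
  have hg : SmoothFun (d := d) (fun x => 1 - ∑ _j : Fin 1, κ x) := by
    simp only [Finset.univ_unique, Finset.sum_const, Finset.card_singleton, one_smul]
    exact contMDiff_const.sub hκ
  have hcp : IsCompact (supp X ∩ (S ∪ pastOf C S)) := hc.inter_right hS.isClosed_union_pastOf
  have h2 := hS.integral_divergence_split hρ hcp (f := fun _ : Fin 1 => κ) (fun _ => hκ) hg
  have h3 := hρ.smulSec hg
  have h4 : Disjoint (supp (smulSec _ hg X)) S := by
    refine disjoint_left.2 fun x hx hxS => ?_
    refine notMem_supp_iff.2 ?_ hx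
    filter_upwards [eventually_nhdsSet_iff_forall.1 hκ1 x ⟨(supp_smulSec hx).2, hxS⟩] with q hq
    simp [hq]
  rw [hS.integral_divergence_of_disjoint h3 (hcp.of_isClosed_subset
    ((isClosed_supp _).inter hS.isClosed_union_pastOf)
    (inter_subset_inter_left _ (supp_smulSec.trans inter_subset_right))) h4, add_zero] at h2
  rw [h2]
  simp only [Finset.univ_unique, Finset.sum_const, Finset.card_singleton, one_smul]
  have h5 : localFlux μ e (fun x => X x) = localFlux μ e (fun x => smulSec κ hκ X x) := by
    refine localFlux_congr he.1 fun p hp => ?_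
    by_cases hpX : X p = 0
    · rw [smulSec_apply, hpX, smul_zero]
    · rw [smulSec_apply, hκ1.self_of_nhdsSet p ⟨subset_closure hpX, hp⟩, one_smul]
  rw [h5, ← integral_divergence_lt h1 he.1.1
    (hc.of_isClosed_subset (isClosed_supp _) (supp_smulSec.trans inter_subset_right))
    ((supp_smulSec.trans inter_subset_right).trans hs)]
  have hTo : IsOpen {x | x ∈ e.source ∧ e x 0 < 0} :=
    e.isOpen_inter_preimage (isOpen_lt (f := fun y : Model d => y 0) (by fun_prop) continuous_const)
  rw [← integral_indicator hTo.measurableSet, ← integral_indicator hS.isOpen_pastOf.measurableSet]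
  refine integral_congr_ae (Eventually.of_forall fun x => ?_)
  by_cases hx : x ∈ tsupport κ
  · obtain ⟨hxe, hxi⟩ := hκs hx
    obtain ⟨hx1, hx2⟩ := interior_subset hxi
    have hiff : x ∈ {x | x ∈ e.source ∧ e x 0 < 0} ↔ x ∈ pastOf C S := by
      refine ⟨fun h => hx1 h.2, fun h => ⟨hxe, ?_⟩⟩
      rcases lt_trichotomy (e x 0) 0 with h' | h' | h'
      · exact h'
      · exact absurd ((he.1.2 _ hxe).2 h') (disjoint_left.1 hS.disjoint_pastOf h)
      · exact absurd (hx2 h') (disjoint_left.1 hS.disjoint_pastOf_futureOf h)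
    by_cases hp : x ∈ pastOf C S
    · rw [indicator_of_mem hp, indicator_of_mem (hiff.2 hp)]
    · rw [indicator_of_notMem hp, indicator_of_notMem fun h => hp (hiff.1 h)]
  · have h0 := divergence_eq_zero_of_notMem_supp h1 fun h => hx (supp_smulSec h).1
    simp only [indicator, h0, ite_self]

section
variable {X : Sec (VB.tangent d M)} {ρ : M → ℝ} (hρ : IsDivergence μ (fun x => X x) ρ)
  (hc : IsCompact (supp X ∩ (S ∪ pastOf C S)))
include hρ hc

/-- Fields vanishing on `S` have vanishing flux through `S`: near `S` the flux can be computed in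
slice charts, where it involves only the values on `S`. -/
theorem integral_divergence_of_eq_zero (h0 : ∀ p ∈ S, X p = 0) :
    ∫ x in pastOf C S, ρ x ∂μ.meas = 0 := by
  have hK : IsCompact (supp X ∩ S) := hc.of_isClosed_subset ((isClosed_supp _).inter hS.isClosed)
    (inter_subset_inter_right _ subset_union_left)
  obtain ⟨N, i, f, hf, hfc, hfs, hf1⟩ := exists_finite_partition (d := d) hK
    (fun e : {e : OpenPartialHomeomorph M (Model d) // IsFutureSliceChart C S e} => e.1.source)
    (fun e => e.1.open_source) (fun x hx => by
      obtain ⟨e, he, hxe⟩ := hS.exists_futureSliceChart hx.2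
      exact mem_iUnion.2 ⟨⟨e, he⟩, hxe⟩)
  have hg : SmoothFun (d := d) (fun x => 1 - ∑ j, f j x) :=
    contMDiff_const.sub (contMDiff_finsetSum fun j _ => hf j)
  rw [hS.integral_divergence_split hρ hc hf hg, Finset.sum_eq_zero, zero_add]
  · refine hS.integral_divergence_of_disjoint (hρ.smulSec hg) (hc.of_isClosed_subset
      ((isClosed_supp _).inter hS.isClosed_union_pastOf)
      (inter_subset_inter_left _ (supp_smulSec.trans inter_subset_right))) ?_
    refine disjoint_left.2 fun x hx hxS => ?_
    refine notMem_supp_iff.2 ?_ hx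
    filter_upwards [eventually_nhdsSet_iff_forall.1 hf1 x ⟨(supp_smulSec hx).2, hxS⟩] with q hq
    simp [hq]
  · intro j _
    rw [← hS.localFlux_eq_integral (i j).2 (hρ.smulSec (hf j))
      ((hfc j).isCompact.of_isClosed_subset (isClosed_supp _)
        (supp_smulSec.trans inter_subset_left))
      ((supp_smulSec.trans inter_subset_left).trans (hfs j))]
    have : localFlux μ (i j).1 (fun x => smulSec (f j) (hf j) X x) =
        localFlux μ (i j).1 (fun x => (0 : TangentSpace 𝓘(ℝ, Model d) x)) :=
      localFlux_congr (i j).2.1 fun p hp => by rw [smulSec_apply, h0 p hp, smul_zero]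
    rw [this]
    unfold localFlux
    refine integral_eq_zero_of_ae (Eventually.of_forall fun y => ?_)
    simp only
    rw [vecComp_eq_zero rfl]
    simp

/-- The theorem of Stokes: the flux through a Cauchy surface of a field whose support has compact
intersection with the past of the surface. -/
theorem hasFlux_iff {a : ℝ} :
    HasFlux μ C S (fun x => X x) a ↔ a = ∫ x in pastOf C S, ρ x ∂μ.meas := by
  have key : ∀ (N : ℕ) (e : Fin N → OpenPartialHomeomorph M (Model d)) (f : Fin N → M → ℝ),
      (∀ i, IsFutureSliceChart C S (e i)) → ∀ hf : (∀ i, SmoothFun (d := d) (f i)),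
      (∀ i, HasCompactSupport (f i)) → (∀ i, tsupport (f i) ⊆ (e i).source) →
      (∀ p ∈ S, X p ≠ 0 → ∑ i, f i p = 1) →
      ∑ i, localFlux μ (e i) (fun x => f i x • X x) = ∫ x in pastOf C S, ρ x ∂μ.meas := by
    intro N e f he hf hfc hfs hf1
    have hg : SmoothFun (d := d) (fun x => 1 - ∑ j, f j x) :=
      contMDiff_const.sub (contMDiff_finsetSum fun j _ => hf j)
    rw [hS.integral_divergence_split hρ hc hf hg, hS.integral_divergence_of_eq_zero
      (hρ.smulSec hg) (hc.of_isClosed_subset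
      ((isClosed_supp _).inter hS.isClosed_union_pastOf)
      (inter_subset_inter_left _ (supp_smulSec.trans inter_subset_right))), add_zero]
    · refine Finset.sum_congr rfl fun i _ => ?_
      exact hS.localFlux_eq_integral (he i) (hρ.smulSec (hf i))
        ((hfc i).isCompact.of_isClosed_subset (isClosed_supp _)
          (supp_smulSec.trans inter_subset_left))
        ((supp_smulSec.trans inter_subset_left).trans (hfs i))
    · intro p hp
      by_cases hX : X p = 0
      · rw [smulSec_apply, hX, smul_zero]
      · rw [smulSec_apply, hf1 p hp hX, sub_self, zero_smul]
  constructor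
  · rintro ⟨N, e, f, he, hf, hfc, hfs, hf1, rfl⟩
    exact key N e f he hf hfc hfs hf1
  · rintro rfl
    have hK : IsCompact (supp X ∩ S) := hc.of_isClosed_subset ((isClosed_supp _).inter hS.isClosed)
      (inter_subset_inter_right _ subset_union_left)
    obtain ⟨N, i, f, hf, hfc, hfs, hf1⟩ := exists_finite_partition (d := d) hK
      (fun e : {e : OpenPartialHomeomorph M (Model d) // IsFutureSliceChart C S e} => e.1.source)
      (fun e => e.1.open_source) (fun x hx => by
        obtain ⟨e, he, hxe⟩ := hS.exists_futureSliceChart hx.2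
        exact mem_iUnion.2 ⟨⟨e, he⟩, hxe⟩)
    have hf1' : ∀ p ∈ S, X p ≠ 0 → ∑ i, f i p = 1 := fun p hp hX =>
      hf1.self_of_nhdsSet p ⟨subset_closure hX, hp⟩
    exact ⟨N, fun j => (i j).1, f, fun j => (i j).2, hf, hfc, hfs, hf1',
      (key N _ f (fun j => (i j).2) hf hfc hfs hf1').symm⟩

end

end IsCauchySurface

/-- The flux through `S` depends only on the values of the field on `S`. -/
theorem hasFlux_congr {X Y : (x : M) → TangentSpace 𝓘(ℝ, Model d) x} (h : ∀ p ∈ S, X p = Y p)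
    {a : ℝ} :
    HasFlux μ C S X a ↔ HasFlux μ C S Y a := by
  have key : ∀ {X Y : (x : M) → TangentSpace 𝓘(ℝ, Model d) x}, (∀ p ∈ S, X p = Y p) →
      HasFlux μ C S X a → HasFlux μ C S Y a := by
    rintro X Y h ⟨N, e, f, he, hf, hfc, hfs, hf1, rfl⟩
    refine ⟨N, e, f, he, hf, hfc, hfs, fun p hp hY => hf1 p hp (by rwa [h p hp]), ?_⟩
    exact Finset.sum_congr rfl fun i _ => localFlux_congr (he i).1 fun p hp => by rw [h p hp]
  exact ⟨key h, key fun p hp => (h p hp).symm⟩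

end

section

/-! ### Locality of differential operators -/

theorem locRep_eventuallyEq {V : VB.{u, v} d M} {s t : Sec V} {x : M} (h : ∀ᶠ q in 𝓝 x, s q = t q) :
    locRep x s =ᶠ[𝓝 (chartAt (Model d) x x)] locRep x t := by
  have hx := mem_chart_source (Model d) x
  have hc : Tendsto (chartAt (Model d) x).symm (𝓝 (chartAt (Model d) x x)) (𝓝 x) := by
    have := (chartAt (Model d) x).continuousAt_symm ((chartAt (Model d) x).map_source hx)
    rw [ContinuousAt, (chartAt (Model d) x).left_inv hx] at this
    exact this
  filter_upwards [hc.eventually h] with y hy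
  unfold locRep
  rw [hy]

theorem mem_locDom (V : VB.{u, v} d M) (x : M) : chartAt (Model d) x x ∈ locDom V x := by
  refine ⟨(chartAt (Model d) x).map_source (mem_chart_source _ x), ?_⟩
  rw [(chartAt (Model d) x).left_inv (mem_chart_source _ x)]
  exact FiberBundle.mem_baseSet_trivializationAt' x

theorem eq_of_locRep_eq {V : VB.{u, v} d M} {s t : Sec V} {x : M}
    (h : locRep x s (chartAt (Model d) x x) = locRep x t (chartAt (Model d) x x)) : s x = t x := by
  unfold locRep at h
  rw [(chartAt (Model d) x).left_inv (mem_chart_source _ x)] at h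
  have hb : x ∈ (trivializationAt V.Fib V.Fiber x).baseSet :=
    FiberBundle.mem_baseSet_trivializationAt' x
  exact ((trivializationAt V.Fib V.Fiber x).continuousLinearEquivAt ℝ x hb).injective h

theorem jetCoord_congr {A : Type v} [NormedAddCommGroup A] [NormedSpace ℝ A] (k : ℕ)
    {a b : Model d → A} {y : Model d} (h : a =ᶠ[𝓝 y] b) : jetCoord k a y = jetCoord k b y :=
  funext fun i => (h.iteratedFDeriv ℝ i).eq_of_nhds

/-- Differential operators are local. -/
theorem IsDiffOp.congr {V : VB.{u, v} d M} {W : VB.{u, w} d M} {D : Sec V → Sec W} (hD : IsDiffOp D)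
    {s t : Sec V} {x : M} (h : ∀ᶠ q in 𝓝 x, s q = t q) : D s x = D t x := by
  obtain ⟨k, hk⟩ := hD
  obtain ⟨ℓ, -, hℓ⟩ := hk x
  have hx : chartAt (Model d) x x ∈ locDom V x ∩ locDom W x := ⟨mem_locDom V x, mem_locDom W x⟩
  refine eq_of_locRep_eq ?_
  rw [hℓ s _ hx, hℓ t _ hx, jetCoord_congr k (locRep_eventuallyEq h)]

theorem IsBiDiffOp.congr {V₁ : VB.{u, v} d M} {V₂ : VB.{u, w} d M} {W : VB.{u, 0} d M}
    {D : Sec V₁ → Sec V₂ → Sec W} (hD : IsBiDiffOp D) {s s' : Sec V₁} {t t' : Sec V₂} {x : M}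
    (h : ∀ᶠ q in 𝓝 x, s q = s' q) (h' : ∀ᶠ q in 𝓝 x, t q = t' q) : D s t x = D s' t' x := by
  obtain ⟨k, hk⟩ := hD
  obtain ⟨ℓ, -, hℓ⟩ := hk x
  have hx : chartAt (Model d) x x ∈ locDom V₁ x ∩ locDom V₂ x ∩ locDom W x :=
    ⟨⟨mem_locDom V₁ x, mem_locDom V₂ x⟩, mem_locDom W x⟩
  refine eq_of_locRep_eq ?_
  rw [hℓ s t _ hx, hℓ s' t' _ hx, jetCoord_congr k (locRep_eventuallyEq h),
    jetCoord_congr k (locRep_eventuallyEq h')]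

theorem IsDiffOp.eventually_congr {V : VB.{u, v} d M} {W : VB.{u, w} d M} {D : Sec V → Sec W}
    (hD : IsDiffOp D) {s t : Sec V} {x : M} (h : ∀ᶠ q in 𝓝 x, s q = t q) :
    ∀ᶠ q in 𝓝 x, D s q = D t q :=
  h.eventually_nhds.mono fun _ hq => hD.congr hq

variable [T2Space M] [SigmaCompactSpace M]

theorem IsDiffOp.supp_subset {V : VB.{u, v} d M} {W : VB.{u, w} d M} {D : Sec V →ₗ[ℝ] Sec W}
    (hD : IsDiffOp D) (s : Sec V) : supp (D s) ⊆ supp s := by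
  intro x hx
  by_contra h
  refine notMem_supp_iff.2 ?_ hx
  have := hD.eventually_congr (t := 0) (notMem_supp_iff.1 h)
  filter_upwards [this] with q hq
  rw [hq, map_zero]
  rfl

/-! ### Pairings and adjoints -/

theorem ev_sub_left {V : VB.{u, v} d M} (s t : Sec V) (a : Sec V.dual) (x : M) :
    ev (s - t) a x = ev s a x - ev t a x := map_sub (a x) (s x) (t x)

theorem ev_add_right {V : VB.{u, v} d M} (s : Sec V) (a b : Sec V.dual) (x : M) :
    ev s (a + b) x = ev s a x + ev s b x := rfl

theorem ev_sub_right {V : VB.{u, v} d M} (s : Sec V) (a b : Sec V.dual) (x : M) :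
    ev s (a - b) x = ev s a x - ev s b x := rfl

theorem ev_eq_zero_left {V : VB.{u, v} d M} {s : Sec V} (a : Sec V.dual) {x : M} (h : s x = 0) :
    ev s a x = 0 := by
  unfold ev
  rw [h, map_zero]

theorem ev_eq_zero_right {V : VB.{u, v} d M} (s : Sec V) {a : Sec V.dual} {x : M} (h : a x = 0) :
    ev s a x = 0 := by
  unfold ev
  rw [h]
  rfl

theorem continuous_ev {V : VB.{u, v} d M} (s : Sec V) (a : Sec V.dual) : Continuous (ev s a) :=
  (contMDiff_ev s a).continuous

/-- A pairing of sections by continuous functions which is local in both arguments. -/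
structure IsLocalPairing {V V' : VB.{u, v} d M} (p : Sec V → Sec V' → M → ℝ) : Prop where
  continuous : ∀ s a, Continuous (p s a)
  eq_zero_left : ∀ s a x, s x = 0 → p s a x = 0
  eq_zero_right : ∀ s a x, a x = 0 → p s a x = 0

theorem isLocalPairing_ev {V : VB.{u, v} d M} : IsLocalPairing (ev (V := V)) :=
  ⟨continuous_ev, fun _ a _ h => ev_eq_zero_left a h, fun s _ _ h => ev_eq_zero_right s h⟩

theorem isLocalPairing_ev' {V : VB.{u, v} d M} : IsLocalPairing (ev' (V := V)) :=
  ⟨fun a s => continuous_ev s a, fun _ s _ h => ev_eq_zero_right s h,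
    fun a _ _ h => ev_eq_zero_left a h⟩

variable [MeasurableSpace M] [BorelSpace M] {μ : SmoothDensity d M}

section
variable {V V' : VB.{u, v} d M} {p : Sec V → Sec V' → M → ℝ} (hp : IsLocalPairing p)
include hp

theorem IsLocalPairing.integrable {s : Sec V} {a : Sec V'} (h : IsCompact (supp s ∩ supp a)) :
    Integrable (p s a) μ.meas := by
  refine (hp.continuous s a).integrable_of_hasCompactSupport
    (HasCompactSupport.intro h fun x hx => ?_)
  by_contra hne
  exact hx ⟨subset_closure fun h0 => hne (hp.eq_zero_left s a x h0),
    subset_closure fun h0 => hne (hp.eq_zero_right s a x h0)⟩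
end

theorem integrable_ev {V : VB.{u, v} d M} {s : Sec V} {a : Sec V.dual}
    (h : IsCompact (supp s ∩ supp a)) : Integrable (ev s a) μ.meas :=
  isLocalPairing_ev.integrable h

theorem IsBiDiffOp.supp_subset {V W : VB.{u, v} d M}
    {G : Sec V →ₗ[ℝ] Sec W →ₗ[ℝ] Sec (VB.tangent d M)} (hG : IsBiDiffOp (fun φ ψ => G φ ψ))
    (s : Sec V) (t : Sec W) : supp (G s t) ⊆ supp s ∩ supp t := by
  intro x hx
  by_contra h
  refine notMem_supp_iff.2 ?_ hx
  rw [mem_inter_iff, not_and_or] at h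
  rcases h with h | h
  · filter_upwards [(notMem_supp_iff.1 h).eventually_nhds] with q hq
    have := hG.congr (s' := 0) (t := t) (t' := t) hq (Eventually.of_forall fun _ => rfl)
    refine this.trans ?_
    simp
  · filter_upwards [(notMem_supp_iff.1 h).eventually_nhds] with q hq
    have := hG.congr (s := s) (s' := s) (t' := 0) (Eventually.of_forall fun _ => rfl) hq
    refine this.trans ?_
    simp

/-- Formal adjoints are adjoint with respect to integration if supports overlap compactly: the Green
form then has compact support, and its divergence integrates to zero. -/
theorem AreAdjoint.integral_eq {V V' W W' : VB.{u, v} d M}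
    {pV : Sec V → Sec V' → M → ℝ} {pW : Sec W → Sec W' → M → ℝ} (hV : IsLocalPairing pV)
    (hW : IsLocalPairing pW) {D : Sec V →ₗ[ℝ] Sec W} {D' : Sec W' →ₗ[ℝ] Sec V'}
    (h : AreAdjoint μ pV pW D D') {s : Sec V} {t : Sec W'} (hst : IsCompact (supp s ∩ supp t)) :
    ∫ x, pW (D s) t x ∂μ.meas = ∫ x, pV s (D' t) x ∂μ.meas := by
  obtain ⟨hD, hD', G, hG, hdiv⟩ := h
  have h1 := integral_divergence_eq_zero (hdiv s t)
    (hst.of_isClosed_subset (isClosed_supp _) (hG.supp_subset s t))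
  rw [integral_sub] at h1
  · exact sub_eq_zero.1 h1
  · exact hW.integrable (hst.of_isClosed_subset ((isClosed_supp _).inter (isClosed_supp _))
      (inter_subset_inter_left _ (hD.supp_subset s)))
  · exact hV.integrable (hst.of_isClosed_subset ((isClosed_supp _).inter (isClosed_supp _))
      (inter_subset_inter_right _ (hD'.supp_subset t)))

theorem HypOp.integral_eq {C : ChronalCone d M} {V : VB.{u, v} d M} (f : HypOp μ C V) {s t : Sec V}
    (hst : IsCompact (supp s ∩ supp t)) :
    ∫ x, ev t (f.op s) x ∂μ.meas = ∫ x, ev s (f.adj t) x ∂μ.meas :=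
  f.adjoint.integral_eq isLocalPairing_ev isLocalPairing_ev' hst

theorem FieldOp.integral_eq {V W : VB.{u, v} d M} (f : FieldOp μ V W) {s : Sec V} {t : Sec W.dual}
    (hst : IsCompact (supp s ∩ supp t)) :
    ∫ x, ev (f.op s) t x ∂μ.meas = ∫ x, ev s (f.adj t) x ∂μ.meas :=
  f.adjoint.integral_eq isLocalPairing_ev isLocalPairing_ev hst

theorem DensOp.integral_eq {V W : VB.{u, v} d M} (f : DensOp μ V W) {s : Sec V.dual} {t : Sec W}
    (hst : IsCompact (supp s ∩ supp t)) :
    ∫ x, ev t (f.op s) x ∂μ.meas = ∫ x, ev (f.adj t) s x ∂μ.meas :=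
  f.adjoint.integral_eq isLocalPairing_ev' isLocalPairing_ev' hst

/-! ### The fundamental lemma of the calculus of variations -/

/-- The square of a continuous function not vanishing at `x` has positive integral against a bump
function at `x`. -/
theorem exists_bump_integral_pos (μ : SmoothDensity d M) {f : M → ℝ} (hf : Continuous f) {x : M}
    (hx : f x ≠ 0) :
    ∃ η : M → ℝ, SmoothFun (d := d) η ∧ HasCompactSupport η ∧ 0 < ∫ y, η y * f y ^ 2 ∂μ.meas := by
  obtain ⟨η⟩ : Nonempty (SmoothBumpFunction 𝓘(ℝ, Model d) x) := inferInstance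
  refine ⟨η, η.contMDiff, η.hasCompactSupport, ?_⟩
  refine Continuous.integral_pos_of_hasCompactSupport_nonneg_nonzero (x := x)
    (η.continuous.mul (hf.pow 2)) η.hasCompactSupport.mul_right
    (fun y => mul_nonneg η.nonneg (sq_nonneg _)) ?_
  simp [hx]

theorem hasCompactSupport_smulSec {V : VB.{u, v} d M} {η : M → ℝ} {hη : SmoothFun (d := d) η}
    (hc : HasCompactSupport η) (s : Sec V) : smulSec η hη s ∈ Sec₀ V :=
  ⟨_, hc, supp_smulSec.trans inter_subset_left⟩

/-- A dual density annihilating the compactly supported sections vanishes. -/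
theorem eq_zero_of_integral_ev_left {V : VB.{u, v} d M} {α : Sec V.dual}
    (h : ∀ ψ ∈ Sec₀ V, ∫ x, ev ψ α x ∂μ.meas = 0) : α = 0 := by
  refine ContMDiffSection.ext fun x => ?_
  by_contra hne
  obtain ⟨v, hv⟩ : ∃ v, α x v ≠ 0 := by
    by_contra! hcon
    exact hne (ContinuousLinearMap.ext hcon)
  obtain ⟨s, hs⟩ := exists_sec_eq V x v
  have hev : ev s α x ≠ 0 := by
    unfold ev
    rwa [hs]
  obtain ⟨η, hη, hηc, hpos⟩ := exists_bump_integral_pos μ (continuous_ev s α) hev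
  have h1 := h (smulSec (fun y => η y * ev s α y) (hη.mul (contMDiff_ev s α)) s)
    (hasCompactSupport_smulSec hηc.mul_right s)
  refine hpos.ne' (Eq.trans (integral_congr_ae (Eventually.of_forall fun y => ?_)) h1)
  have : ev (smulSec (fun y => η y * ev s α y) (hη.mul (contMDiff_ev s α)) s) α y =
      (η y * ev s α y) * ev s α y := map_smul (α y) (η y * ev s α y) (s y)
  simp only [this]
  ring

theorem exists_dual_ne_zero {V : VB.{u, v} d M} {x : M} {v : V.Fiber x} (hv : v ≠ 0) :
    ∃ a : V.Fiber x →L[ℝ] ℝ, a v ≠ 0 := by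
  have hb : x ∈ (trivializationAt V.Fib V.Fiber x).baseSet :=
    FiberBundle.mem_baseSet_trivializationAt' x
  set L := (trivializationAt V.Fib V.Fiber x).continuousLinearEquivAt ℝ x hb
  obtain ⟨a, ha⟩ := SeparatingDual.exists_ne_zero (R := ℝ) (x := L v) (by simpa using hv)
  exact ⟨a.comp (L : V.Fiber x →L[ℝ] V.Fib), ha⟩

/-- A section annihilating the compactly supported dual densities vanishes. -/
theorem eq_zero_of_integral_ev_right {V : VB.{u, v} d M} {ψ : Sec V}
    (h : ∀ α ∈ Sec₀ V.dual, ∫ x, ev ψ α x ∂μ.meas = 0) : ψ = 0 := by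
  refine ContMDiffSection.ext fun x => ?_
  by_contra hne
  obtain ⟨a, ha⟩ := exists_dual_ne_zero hne
  obtain ⟨s, hs⟩ := exists_sec_eq V.dual x a
  have hev : ev ψ s x ≠ 0 := by
    unfold ev
    rwa [hs]
  obtain ⟨η, hη, hηc, hpos⟩ := exists_bump_integral_pos μ (continuous_ev ψ s) hev
  have h1 := h (smulSec (fun y => η y * ev ψ s y) (hη.mul (contMDiff_ev ψ s)) s)
    (hasCompactSupport_smulSec hηc.mul_right s)
  refine hpos.ne' (Eq.trans (integral_congr_ae (Eventually.of_forall fun y => ?_)) h1)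
  have : ev ψ (smulSec (fun y => η y * ev ψ s y) (hη.mul (contMDiff_ev ψ s)) s) y =
      (η y * ev ψ s y) * ev ψ s y := rfl
  simp only [this]
  ring

end

/-! ### Smooth families of sections -/

theorem isOpen_locDom (V : VB.{u, v} d M) (x₀ : M) : IsOpen (locDom V x₀) :=
  (chartAt (Model d) x₀).isOpen_inter_preimage_symm
    (trivializationAt V.Fib V.Fiber x₀).open_baseSet

theorem contDiffOn_locRep {V : VB.{u, v} d M} (x₀ : M) (s : Sec V) :
    ContDiffOn ℝ ∞ (locRep x₀ s) (locDom V x₀) := by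
  have h1 : ContMDiffOn 𝓘(ℝ, Model d) 𝓘(ℝ, V.Fib) ∞
      (fun x => (trivializationAt V.Fib V.Fiber x₀ ⟨x, s x⟩).2)
      (trivializationAt V.Fib V.Fiber x₀).baseSet :=
    (Bundle.Trivialization.contMDiffOn_section_baseSet_iff _).1 s.contMDiff.contMDiffOn
  have h2 : ContMDiffOn 𝓘(ℝ, Model d) 𝓘(ℝ, Model d) ∞ (chartAt (Model d) x₀).symm (locDom V x₀) :=
    (contMDiffOn_symm_of_mem_maximalAtlas (IsManifold.chart_mem_maximalAtlas x₀)).mono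
      fun y hy => hy.1
  exact contMDiffOn_iff_contDiffOn.1 (h1.comp h2 fun y hy => hy.2)

theorem locRep_add_smul {V : VB.{u, v} d M} (x₀ : M) (φ ψ : Sec V) (t : ℝ) {y : Model d}
    (hy : y ∈ locDom V x₀) : locRep x₀ (φ + t • ψ) y = locRep x₀ φ y + t • locRep x₀ ψ y := by
  let L := (trivializationAt V.Fib V.Fiber x₀).continuousLinearEquivAt ℝ
    ((chartAt (Model d) x₀).symm y) hy.2
  have h := L.map_add (φ ((chartAt (Model d) x₀).symm y)) (t • ψ ((chartAt (Model d) x₀).symm y))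
  rw [L.map_smul] at h
  exact h

theorem jetCoord_add_smul {A : Type v} [NormedAddCommGroup A] [NormedSpace ℝ A] (k : ℕ)
    {a b : Model d → A} {y : Model d} (t : ℝ) (ha : ContDiffAt ℝ ∞ a y) (hb : ContDiffAt ℝ ∞ b y) :
    jetCoord k (fun y => a y + t • b y) y = jetCoord k a y + t • jetCoord k b y := by
  funext i
  have hi : ((i : ℕ) : WithTop ℕ∞) ≤ ∞ := by exact_mod_cast le_top
  have h1 := iteratedFDeriv_add_apply (𝕜 := ℝ) (i := (i : ℕ)) (ha.of_le hi)
    ((hb.of_le hi).const_smul t)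
  have h2 := iteratedFDeriv_const_smul_apply (𝕜 := ℝ) (i := (i : ℕ)) (a := t) (hb.of_le hi)
  exact h1.trans (congrArg _ h2)

theorem jetCoord_locRep_add_smul {V : VB.{u, v} d M} (k : ℕ) (x₀ : M) (φ ψ : Sec V) (t : ℝ)
    {y : Model d} (hy : y ∈ locDom V x₀) :
    jetCoord k (locRep x₀ (φ + t • ψ)) y =
      jetCoord k (locRep x₀ φ) y + t • jetCoord k (locRep x₀ ψ) y := by
  have hn := (isOpen_locDom V x₀).mem_nhds hy
  rw [← jetCoord_add_smul k t ((contDiffOn_locRep x₀ φ).contDiffAt hn)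
    ((contDiffOn_locRep x₀ ψ).contDiffAt hn)]
  refine jetCoord_congr k ?_
  filter_upwards [hn] with z hz
  exact locRep_add_smul x₀ φ ψ t hz

theorem contDiffAt_jetCoord {V : VB.{u, v} d M} (k : ℕ) (x₀ : M) (s : Sec V) {y : Model d}
    (hy : y ∈ locDom V x₀) : ContDiffAt ℝ ∞ (jetCoord k (locRep x₀ s)) y := by
  refine contDiffAt_pi.2 fun i => ?_
  refine ((contDiffOn_locRep x₀ s).contDiffAt
    ((isOpen_locDom V x₀).mem_nhds hy)).iteratedFDeriv_right
    (m := ∞) ?_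
  exact_mod_cast le_top

/-- A family of sections depending smoothly on parameters and on the point of the manifold jointly.
-/
def IsSmoothFamily {P : Type*} [NormedAddCommGroup P] [NormedSpace ℝ P] {V : VB.{u, v} d M}
    (X : P → Sec V) : Prop :=
  ∀ (x₀ : M) (p : P),
    ContDiffAt ℝ ∞ (fun q : P × Model d => locRep x₀ (X q.1) q.2) (p, chartAt (Model d) x₀ x₀)

/-- Differential operators map affine two-parameter families to smooth families. -/
theorem IsDiffOp.isSmoothFamily {V : VB.{u, v} d M} {W : VB.{u, w} d M} {D : Sec V → Sec W}
    (hD : IsDiffOp D) (φ ψ ξ : Sec V) :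
    IsSmoothFamily (fun p : ℝ × ℝ => D (φ + p.1 • ψ + p.2 • ξ)) := by
  intro x₀ p
  obtain ⟨k, hk⟩ := hD
  obtain ⟨ℓ, hsm, hℓ⟩ := hk x₀
  set c := chartAt (Model d) x₀ x₀
  have hO : IsOpen (locDom V x₀ ∩ locDom W x₀) := (isOpen_locDom V x₀).inter (isOpen_locDom W x₀)
  have hc : c ∈ locDom V x₀ ∩ locDom W x₀ := ⟨mem_locDom V x₀, mem_locDom W x₀⟩
  have hj : ∀ s : Sec V, ContDiffAt ℝ ∞
      (fun q : (ℝ × ℝ) × Model d => jetCoord k (locRep x₀ s) q.2) (p, c) := fun s =>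
    (contDiffAt_jetCoord k x₀ s hc.1).comp (p, c) contDiffAt_snd
  have h1 : ContDiffAt ℝ ∞ (fun q : (ℝ × ℝ) × Model d => (q.2, jetCoord k (locRep x₀ φ) q.2 +
      q.1.1 • jetCoord k (locRep x₀ ψ) q.2 + q.1.2 • jetCoord k (locRep x₀ ξ) q.2)) (p, c) :=
    contDiffAt_snd.prodMk (((hj φ).add ((contDiffAt_fst.comp (p, c) contDiffAt_fst).smul
      (hj ψ))).add
      ((contDiffAt_snd.comp (p, c) contDiffAt_fst).smul (hj ξ)))
  have h2 := (hsm.contDiffAt (x := (c, jetCoord k (locRep x₀ φ) c + p.1 • jetCoord k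
    (locRep x₀ ψ) c +
    p.2 • jetCoord k (locRep x₀ ξ) c)) ((hO.prod isOpen_univ).mem_nhds ⟨hc, mem_univ _⟩)).comp
      (p, c) h1
  refine h2.congr_of_eventuallyEq ?_
  have h3 : ∀ᶠ q : (ℝ × ℝ) × Model d in 𝓝 (p, c), q.2 ∈ locDom V x₀ ∩ locDom W x₀ :=
    (continuous_snd.tendsto (p, c)).eventually (hO.mem_nhds hc)
  filter_upwards [h3] with q hq
  rw [hℓ _ _ hq, jetCoord_locRep_add_smul k x₀ _ _ _ hq.1, jetCoord_locRep_add_smul k x₀ _ _ _ hq.1]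
  rfl

/-- Bidifferential operators map affine families in the first argument to smooth families. -/
theorem IsBiDiffOp.isSmoothFamily {V₁ : VB.{u, v} d M} {V₂ : VB.{u, w} d M} {W : VB.{u, 0} d M}
    {D : Sec V₁ → Sec V₂ → Sec W} (hD : IsBiDiffOp D) (φ ψ : Sec V₁) (ξ : Sec V₂) :
    IsSmoothFamily (fun t : ℝ => D (φ + t • ψ) ξ) := by
  intro x₀ p
  obtain ⟨k, hk⟩ := hD
  obtain ⟨ℓ, hsm, hℓ⟩ := hk x₀
  set c := chartAt (Model d) x₀ x₀
  have hO : IsOpen (locDom V₁ x₀ ∩ locDom V₂ x₀ ∩ locDom W x₀) :=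
    ((isOpen_locDom V₁ x₀).inter (isOpen_locDom V₂ x₀)).inter (isOpen_locDom W x₀)
  have hc : c ∈ locDom V₁ x₀ ∩ locDom V₂ x₀ ∩ locDom W x₀ :=
    ⟨⟨mem_locDom V₁ x₀, mem_locDom V₂ x₀⟩, mem_locDom W x₀⟩
  have hj : ∀ s : Sec V₁, ContDiffAt ℝ ∞
      (fun q : ℝ × Model d => jetCoord k (locRep x₀ s) q.2) (p, c) := fun s =>
    (contDiffAt_jetCoord k x₀ s hc.1.1).comp (p, c) contDiffAt_snd
  have h1 : ContDiffAt ℝ ∞ (fun q : ℝ × Model d => (q.2, jetCoord k (locRep x₀ φ) q.2 +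
      q.1 • jetCoord k (locRep x₀ ψ) q.2, jetCoord k (locRep x₀ ξ) q.2)) (p, c) :=
    contDiffAt_snd.prodMk (((hj φ).add (contDiffAt_fst.smul (hj ψ))).prodMk
      ((contDiffAt_jetCoord k x₀ ξ hc.1.2).comp (p, c) contDiffAt_snd))
  have h2 := (hsm.contDiffAt (x := (c, jetCoord k (locRep x₀ φ) c + p • jetCoord k (locRep x₀ ψ) c,
    jetCoord k (locRep x₀ ξ) c)) ((hO.prod isOpen_univ).mem_nhds ⟨hc, mem_univ _⟩)).comp (p, c) h1
  refine h2.congr_of_eventuallyEq ?_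
  have h3 : ∀ᶠ q : ℝ × Model d in 𝓝 (p, c),
      q.2 ∈ locDom V₁ x₀ ∩ locDom V₂ x₀ ∩ locDom W x₀ :=
    (continuous_snd.tendsto (p, c)).eventually (hO.mem_nhds hc)
  filter_upwards [h3] with q hq
  rw [hℓ _ _ _ hq, jetCoord_locRep_add_smul k x₀ _ _ _ hq.1.1]
  rfl

/-! ### Derivatives of families of vector fields -/

theorem chartVec_change {c e : OpenPartialHomeomorph M (Model d)}
    (hc : c ∈ IsManifold.maximalAtlas 𝓘(ℝ, Model d) ∞ M)
    (he : e ∈ IsManifold.maximalAtlas 𝓘(ℝ, Model d) ∞ M) {p : M} (hpc : p ∈ c.source)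
    (hpe : p ∈ e.source) (v : TangentSpace 𝓘(ℝ, Model d) p) :
    chartVec e p v = fderiv ℝ (fun y => e (c.symm y)) (c p) (chartVec c p v) := by
  have hs : MDifferentiableAt 𝓘(ℝ, Model d) 𝓘(ℝ, Model d) c.symm (c p) :=
    (mdifferentiable_of_mem_maximalAtlas hc).mdifferentiableAt_symm (c.map_source hpc)
  have hpe' : c.symm (c p) ∈ e.source := by rwa [c.left_inv hpc]
  have h1 := (((mdifferentiable_of_mem_maximalAtlas he).mdifferentiableAt hpe').hasMFDerivAt.comp
    (c p)
    hs.hasMFDerivAt).mfderiv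
  rw [mfderiv_eq_fderiv] at h1
  have h2 := congrArg (fun T : Model d →L[ℝ] Model d => T (chartVec c p v)) h1
  refine Eq.trans ?_ h2.symm
  have h3 := mfderiv_symm_chartVec hc hpc v
  have key : ∀ q, q = p → ∀ z : Model d, z = v →
      chartVec e p v = (mfderiv 𝓘(ℝ, Model d) 𝓘(ℝ, Model d) e q : Model d →L[ℝ] Model d) z := by
    rintro q rfl z rfl
    rfl
  exact key _ (c.left_inv hpc) _ h3

theorem locRep_apply {V : VB.{u, v} d M} (x₀ : M) (s : Sec V) {x : M}
    (hx : x ∈ (chartAt (Model d) x₀).source) :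
    locRep x₀ s (chartAt (Model d) x₀ x) = (trivializationAt V.Fib V.Fiber x₀ ⟨x, s x⟩).2 := by
  unfold locRep
  rw [(chartAt (Model d) x₀).left_inv hx]

theorem trivializationAt_tangent (x₀ : M) {x : M} (hx : x ∈ (chartAt (Model d) x₀).source)
    (v : TangentSpace 𝓘(ℝ, Model d) x) :
    (trivializationAt (Model d) (TangentSpace 𝓘(ℝ, Model d)) x₀ ⟨x, v⟩).2 =
      chartVec (chartAt (Model d) x₀) x v := by
  have h := TangentBundle.continuousLinearMapAt_trivializationAt (I := 𝓘(ℝ, Model d)) (x₀ := x₀) hx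
  have h2 := congrArg (fun T : Model d →L[ℝ] Model d => T v) h
  refine Eq.trans ?_ h2
  have hb : x ∈ (trivializationAt (Model d) (TangentSpace 𝓘(ℝ, Model d)) x₀).baseSet := hx
  exact (congrFun (Trivialization.coe_linearMapAt_of_mem (R := ℝ) _ hb) v).symm

/-- The value of a vector field at a point, as an element of the model space. -/
noncomputable def modelValue (X : Sec (VB.tangent d M)) (x : M) : Model d := X x

theorem contDiffAt_coordChange {c e : OpenPartialHomeomorph M (Model d)}
    (hc : c ∈ IsManifold.maximalAtlas 𝓘(ℝ, Model d) ∞ M)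
    (he : e ∈ IsManifold.maximalAtlas 𝓘(ℝ, Model d) ∞ M) {p : M} (hpc : p ∈ c.source)
    (hpe : p ∈ e.source) : ContDiffAt ℝ ∞ (fun y => e (c.symm y)) (c p) := by
  have h1 : ContMDiffAt 𝓘(ℝ, Model d) 𝓘(ℝ, Model d) ∞ c.symm (c p) :=
    (contMDiffOn_symm_of_mem_maximalAtlas hc).contMDiffAt
      (c.open_target.mem_nhds (c.map_source hpc))
  have h2 : ContMDiffAt 𝓘(ℝ, Model d) 𝓘(ℝ, Model d) ∞ e (c.symm (c p)) := by
    rw [c.left_inv hpc]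
    exact (contMDiffOn_of_mem_maximalAtlas he).contMDiffAt (e.open_source.mem_nhds hpe)
  exact contMDiffAt_iff_contDiffAt.1 (h2.comp _ h1)

theorem contDiffAt_vecComp_family {X : ℝ → Sec (VB.tangent d M)} (hX : IsSmoothFamily X)
    {e : OpenPartialHomeomorph M (Model d)} (he : e ∈ IsManifold.maximalAtlas 𝓘(ℝ, Model d) ∞ M)
    {p : M} (hp : p ∈ e.source) (t : ℝ) :
    ContDiffAt ℝ ∞ (fun q : ℝ × Model d => vecComp e (fun x => X q.1 x) q.2) (t, e p) := by
  have hc := IsManifold.chart_mem_maximalAtlas (I := 𝓘(ℝ, Model d)) (n := ∞) p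
  have hpc := mem_chart_source (Model d) p
  have hR := hX p t
  set c := chartAt (Model d) p
  have hy := e.map_source hp
  have hτ : ContDiffAt ℝ ∞ (fun y => c (e.symm y)) (e p) := contDiffAt_coordChange he hc hp hpc
  have hσ : ContDiffAt ℝ ∞ (fun y => e (c.symm y)) (c p) := contDiffAt_coordChange hc he hpc hp
  have hDσ : ContDiffAt ℝ ∞ (fderiv ℝ (fun y => e (c.symm y))) (c (e.symm (e p))) := by
    rw [e.left_inv hp]
    exact hσ.fderiv_right (m := ∞) (by simp)
  have hA : ContDiffAt ℝ ∞
      (fun q : ℝ × Model d => fderiv ℝ (fun y => e (c.symm y)) (c (e.symm q.2))) (t, e p) :=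
    ContDiffAt.comp (g := fun y : Model d => fderiv ℝ (fun y => e (c.symm y)) (c (e.symm y)))
      (t, e p) (hDσ.comp (e p) hτ) contDiffAt_snd
  obtain ⟨R, hRdef⟩ : ∃ R : ℝ × Model d → Model d, R = fun q => locRep p (X q.1) q.2 := ⟨_, rfl⟩
  have hR1 : ContDiffAt ℝ ∞ R (t, c (e.symm (e p))) := by
    rw [e.left_inv hp, hRdef]
    exact hR
  have hR' : ContDiffAt ℝ ∞ (fun q : ℝ × Model d => R (q.1, c (e.symm q.2))) (t, e p) :=
    ContDiffAt.comp (g := R) (f := fun q : ℝ × Model d => (q.1, c (e.symm q.2))) (t, e p) hR1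
      (contDiffAt_fst.prodMk
        (ContDiffAt.comp (g := fun y : Model d => c (e.symm y)) (t, e p) hτ contDiffAt_snd))
  refine (hA.clm_apply hR').congr_of_eventuallyEq ?_
  have h3 : ∀ᶠ y in 𝓝 (e p), y ∈ e.target ∧ e.symm y ∈ c.source := by
    refine (e.isOpen_inter_preimage_symm c.open_source).mem_nhds ⟨hy, ?_⟩
    simpa only [mem_preimage, e.left_inv hp] using hpc
  filter_upwards [(continuous_snd.tendsto (t, e p)).eventually h3] with q hq
  have hRq : R (q.1, c (e.symm q.2)) = chartVec c (e.symm q.2) (X q.1 (e.symm q.2)) := by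
    rw [hRdef]
    exact (locRep_apply p _ hq.2).trans (trivializationAt_tangent p hq.2 _)
  rw [hRq]
  exact chartVec_change hc he hq.2 (e.map_target hq.1) _

/-- The derivative with respect to the parameter of a smooth family of vector fields is a smooth
vector field. -/
theorem IsSmoothFamily.exists_deriv {X : ℝ → Sec (VB.tangent d M)} (hX : IsSmoothFamily X) :
    ∃ Y : Sec (VB.tangent d M),
      ∀ x, HasDerivAt (fun t => modelValue (X t) x) (modelValue Y x) 0 := by
  have hdiff : ∀ x, DifferentiableAt ℝ (fun t => modelValue (X t) x) 0 := by
    intro x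
    have hx := mem_chart_source (Model d) x
    have hb : x ∈ (trivializationAt (Model d) (TangentSpace 𝓘(ℝ, Model d)) x).baseSet :=
      FiberBundle.mem_baseSet_trivializationAt' x
    let L : Model d ≃L[ℝ] Model d :=
      (trivializationAt (Model d) (TangentSpace 𝓘(ℝ, Model d)) x).continuousLinearEquivAt ℝ x hb
    have h1 : DifferentiableAt ℝ (fun t => locRep x (X t) (chartAt (Model d) x x)) 0 := by
      have h2 : ContDiffAt ℝ ∞ (fun t : ℝ => (t, chartAt (Model d) x x)) 0 :=
        contDiffAt_id.prodMk contDiffAt_const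
      exact ((hX x 0).comp (0 : ℝ) h2).differentiableAt (by simp)
    have h3 : (fun t => modelValue (X t) x) =
        fun t => L.symm (locRep x (X t) (chartAt (Model d) x x)) := by
      funext t
      rw [locRep_apply x _ hx]
      exact (L.symm_apply_apply (modelValue (X t) x)).symm
    rw [h3]
    exact L.symm.differentiableAt.comp (0 : ℝ) h1
  let Z : (x : M) → TangentSpace 𝓘(ℝ, Model d) x := fun x => deriv (fun t => modelValue (X t) x) 0
  have hZ : ContMDiff 𝓘(ℝ, Model d) (𝓘(ℝ, Model d).prod 𝓘(ℝ, Model d)) ∞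
      (fun x => TotalSpace.mk' (Model d) x (Z x)) := by
    intro p
    rw [contMDiffAt_section]
    have hR := hX p 0
    have hpc := mem_chart_source (Model d) p
    have hc := IsManifold.chart_mem_maximalAtlas (I := 𝓘(ℝ, Model d)) (n := ∞) p
    set c := chartAt (Model d) p
    set R := fun q : ℝ × Model d => locRep p (X q.1) q.2
    have h1 : ContDiffAt ℝ ∞ (fun y : Model d => fderiv ℝ R (0, y) (1, 0)) (c p) := by
      have h2 : ContDiffAt ℝ ∞ (fun y : Model d => ((0 : ℝ), y)) (c p) :=
        contDiffAt_const.prodMk contDiffAt_id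
      have h3 : ContDiffAt ℝ ∞ (fderiv ℝ R) (0, c p) := hR.fderiv_right (m := ∞) (by simp)
      exact (h3.comp (c p) h2).clm_apply contDiffAt_const
    have h2 : ContMDiffAt 𝓘(ℝ, Model d) 𝓘(ℝ, Model d) ∞
        (fun x => fderiv ℝ R (0, c x) (1, 0)) p :=
      (contMDiffAt_iff_contDiffAt.2 h1).comp p
        ((contMDiffOn_of_mem_maximalAtlas hc).contMDiffAt (c.open_source.mem_nhds hpc))
    refine h2.congr_of_eventuallyEq ?_
    have h3 : ∀ᶠ x in 𝓝 p, DifferentiableAt ℝ R (0, c x) := by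
      have h4 : ∀ᶠ q in 𝓝 ((0 : ℝ), c p), DifferentiableAt ℝ R q :=
        (hR.of_le (m := 1) (by simp)).eventually (by simp) |>.mono fun q hq =>
          hq.differentiableAt (by simp)
      have h5 : Tendsto (fun x => ((0 : ℝ), c x)) (𝓝 p) (𝓝 (0, c p)) :=
        tendsto_const_nhds.prodMk_nhds (c.continuousAt hpc)
      exact h5.eventually h4
    filter_upwards [c.open_source.mem_nhds hpc, h3] with x hx hd
    have hb : x ∈ (trivializationAt (Model d) (TangentSpace 𝓘(ℝ, Model d)) p).baseSet := hx
    let L : Model d ≃L[ℝ] Model d :=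
      (trivializationAt (Model d) (TangentSpace 𝓘(ℝ, Model d)) p).continuousLinearEquivAt ℝ x hb
    have h6 := L.toContinuousLinearMap.hasFDerivAt.comp_hasDerivAt (0 : ℝ) (hdiff x).hasDerivAt
    have h7 : HasDerivAt (fun t => R (t, c x)) (fderiv ℝ R (0, c x) (1, 0)) 0 :=
      HasFDerivAt.comp_hasDerivAt (f := fun t : ℝ => (t, c x)) (0 : ℝ) hd.hasFDerivAt
        ((hasDerivAt_id (0 : ℝ)).prodMk (hasDerivAt_const _ _))
    refine h6.unique (h7.congr_of_eventuallyEq (Eventually.of_forall fun t => ?_))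
    exact (locRep_apply p (X t) hx).symm
  exact ⟨⟨Z, hZ⟩, fun x => (hdiff x).hasDerivAt⟩

/-- The mixed second partial derivatives of a function of a real parameter and a point agree. -/
theorem hasDerivAt_fderiv_apply {E : Type*} [NormedAddCommGroup E] [NormedSpace ℝ E] {W : ℝ × E → ℝ}
    {t₀ : ℝ} {y₀ : E} (hW : ContDiffAt ℝ 2 W (t₀, y₀)) (v : E) :
    HasDerivAt (fun t => fderiv ℝ (fun y => W (t, y)) y₀ v)
      (fderiv ℝ (fun y => deriv (fun t => W (t, y)) t₀) y₀ v) t₀ := by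
  have hd : ∀ᶠ q in 𝓝 (t₀, y₀), DifferentiableAt ℝ W q :=
    (hW.eventually (by simp)).mono fun q hq => hq.differentiableAt (by simp)
  have h2 : DifferentiableAt ℝ (fderiv ℝ W) (t₀, y₀) :=
    (hW.fderiv_right (m := 1) (by norm_num)).differentiableAt (by simp)
  have hsymm := hW.isSymmSndFDerivAt (by simp)
  have hy : ∀ t : ℝ, HasFDerivAt (fun y : E => (t, y)) (ContinuousLinearMap.inr ℝ ℝ E) y₀ :=
    fun t => hasFDerivAt_prodMk_right t y₀
  have ht : ∀ y : E, HasDerivAt (fun t : ℝ => (t, y)) ((1 : ℝ), (0 : E)) t₀ :=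
    fun y => (hasDerivAt_id t₀).prodMk (hasDerivAt_const _ _)
  have hL : (fun t => fderiv ℝ (fun y => W (t, y)) y₀ v) =ᶠ[𝓝 t₀] fun t =>
    fderiv ℝ W (t, y₀) (0, v) := by
    have h5 : Tendsto (fun t : ℝ => (t, y₀)) (𝓝 t₀) (𝓝 (t₀, y₀)) := by
      exact (ht y₀).continuousAt
    filter_upwards [h5.eventually hd] with t h
    have := (h.hasFDerivAt.comp y₀ (hy t)).fderiv
    exact congrArg (fun T => T v) this
  have hRr : (fun y => deriv (fun t => W (t, y)) t₀) =ᶠ[𝓝 y₀] fun y =>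
    fderiv ℝ W (t₀, y) (1, 0) := by
    have h5 : Tendsto (fun y : E => (t₀, y)) (𝓝 y₀) (𝓝 (t₀, y₀)) := (hy t₀).continuousAt
    filter_upwards [h5.eventually hd] with y h
    exact (h.hasFDerivAt.comp_hasDerivAt t₀ (ht y)).deriv
  rw [hRr.fderiv_eq]
  have h6 : HasFDerivAt (fun y => fderiv ℝ W (t₀, y) (1, 0))
      (((ContinuousLinearMap.apply ℝ ℝ ((1 : ℝ), (0 : E))).comp
        (fderiv ℝ (fderiv ℝ W) (t₀, y₀))).comp (ContinuousLinearMap.inr ℝ ℝ E)) y₀ :=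
    ((ContinuousLinearMap.apply ℝ ℝ ((1 : ℝ), (0 : E))).hasFDerivAt.comp _ h2.hasFDerivAt).comp y₀
    (hy t₀)
  have h7 : HasDerivAt (fun t => fderiv ℝ W (t, y₀) (0, v))
      (fderiv ℝ (fderiv ℝ W) (t₀, y₀) (1, 0) (0, v)) t₀ :=
    (ContinuousLinearMap.apply ℝ ℝ ((0 : ℝ), v)).hasFDerivAt.comp_hasDerivAt t₀
      (h2.hasFDerivAt.comp_hasDerivAt t₀ (ht y₀))
  rw [h6.fderiv]
  refine (h7.congr_of_eventuallyEq hL).congr_deriv ?_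
  exact hsymm (1, 0) (0, v)

section
variable [MeasurableSpace M] {μ : SmoothDensity d M}

/-- Divergences may be differentiated with respect to a parameter. -/
theorem IsDivergence.hasDerivAt {X : ℝ → Sec (VB.tangent d M)} (hX : IsSmoothFamily X)
    {Y : Sec (VB.tangent d M)} (hY : ∀ x, HasDerivAt (fun t => modelValue (X t) x)
      (modelValue Y x) 0)
    {ρ : ℝ → M → ℝ} (hρ : ∀ t, IsDivergence μ (fun x => X t x) (ρ t)) {σ : M → ℝ}
    (hσ : ∀ x, HasDerivAt (fun t => ρ t x) (σ x) 0) : IsDivergence μ (fun x => Y x) σ := by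
  intro e he p hp
  have hy := e.map_source hp
  have hW : ∀ i, ContDiffAt ℝ 2
      (fun q : ℝ × Model d => μ.dens e q.2 * vecComp e (fun x => X q.1 x) q.2 i) (0, e p) := by
    intro i
    have h1 : ContDiffAt ℝ ∞ (fun q : ℝ × Model d => μ.dens e q.2) (0, e p) :=
      ((μ.smooth e he).contDiffAt (e.open_target.mem_nhds hy)).comp (0, e p) contDiffAt_snd
    exact (h1.mul (contDiffAt_euclidean.1 (contDiffAt_vecComp_family hX he hp 0) i)).of_le
      (WithTop.coe_le_coe.2 le_top)
  have h1 : HasDerivAt (fun t => μ.dens e (e p) * ρ t p) (∑ i : Fin (d + 1),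
      fderiv ℝ (fun y => deriv (fun t => μ.dens e y * vecComp e (fun x => X t x) y i) 0) (e p)
        (EuclideanSpace.single i 1)) 0 := by
    refine (HasDerivAt.fun_sum fun i _ => hasDerivAt_fderiv_apply (hW i) _).congr_of_eventuallyEq
      (Eventually.of_forall fun t => ?_)
    exact hρ t e he p hp
  rw [((hσ p).const_mul _).unique h1]
  refine Finset.sum_congr rfl fun i _ => ?_
  congr 2
  funext y
  let A : Model d →L[ℝ] Model d := mfderiv 𝓘(ℝ, Model d) 𝓘(ℝ, Model d) e (e.symm y)
  have h2 := (((EuclideanSpace.proj i : Model d →L[ℝ] ℝ).comp A).hasFDerivAt.comp_hasDerivAt (0 : ℝ)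
    (hY (e.symm y))).const_mul (μ.dens e y)
  exact h2.deriv
end

section

/-! ### The presymplectic current -/

variable [MeasurableSpace M] {μ : SmoothDensity d M}

theorem IsDivergence.sub {X Y : Sec (VB.tangent d M)} {ρ σ : M → ℝ}
    (hX : IsDivergence μ (fun x => X x) ρ) (hY : IsDivergence μ (fun x => Y x) σ) :
    IsDivergence μ (fun x => (X - Y) x) (fun x => ρ x - σ x) := by
  intro e he p hp
  rw [mul_sub, hX e he p hp, hY e he p hp, ← Finset.sum_sub_distrib]
  refine Finset.sum_congr rfl fun i _ => ?_
  have : (fun y => μ.dens e y * vecComp e (fun x => (X - Y) x) y i) = fun y =>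
      μ.dens e y * vecComp e (fun x => X x) y i - μ.dens e y * vecComp e (fun x => Y x) y i := by
    funext y
    have h : vecComp e (fun x => (X - Y) x) y =
      vecComp e (fun x => X x) y - vecComp e (fun x => Y x) y :=
      map_sub (mfderiv 𝓘(ℝ, Model d) 𝓘(ℝ, Model d) e (e.symm y)) (X (e.symm y)) (Y (e.symm y))
    rw [h, ← mul_sub]
    rfl
  rw [this, fderiv_fun_sub (differentiableAt_dens_mul_vecComp he X i (e.map_source hp))
    (differentiableAt_dens_mul_vecComp he Y i (e.map_source hp))]
  rfl

variable {F : VB.{u, v} d M} (V : VariationalSystem μ F) (φ : Sec F)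

/-- The presymplectic current is a smooth vector field, and its divergence is the antisymmetrized
Jacobi operator. This is the second variation of the Lagrangian density: the first variation formula
is differentiated once more, and the second derivatives of `L` cancel by symmetry. -/
theorem VariationalSystem.exists_current {J : Sec F →ₗ[ℝ] Sec F.dual} (hJ : V.IsJacobi φ J)
    (ψ ξ : Sec F) :
    ∃ X : Sec (VB.tangent d M), (∀ x, X x = V.current φ ψ ξ x) ∧
      IsDivergence μ (fun x => X x) (fun x => ev ψ (J ξ) x - ev ξ (J ψ) x) := by
  have hfam : ∀ ψ ξ : Sec F, IsSmoothFamily (fun t : ℝ => V.θ (φ + t • ψ) ξ) :=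
    fun ψ ξ => V.θ_diffOp.isSmoothFamily φ ψ ξ
  obtain ⟨Y₁, hY₁⟩ := (hfam ψ ξ).exists_deriv
  obtain ⟨Y₂, hY₂⟩ := (hfam ξ ψ).exists_deriv
  -- differentiability of the first variation of `L`, by smoothness of the two-parameter family
  have hΛ : ∀ ψ ξ x, HasDerivAt
      (fun t : ℝ => deriv (fun s : ℝ => (V.L (φ + t • ψ + s • ξ) x : ℝ)) 0)
      (deriv (fun s : ℝ => deriv (fun t : ℝ => (V.L (φ + t • ψ + s • ξ) x : ℝ)) 0) 0) 0 := by
    intro ψ ξ x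
    have h1 : ContDiffAt ℝ ∞ (fun p : ℝ × ℝ => (p, chartAt (Model d) x x)) (0, 0) :=
      contDiffAt_id.prodMk contDiffAt_const
    have h2 := (V.L_diffOp.isSmoothFamily φ ψ ξ x (0, 0)).comp ((0 : ℝ), (0 : ℝ)) h1
    have h3 : ContDiffAt ℝ 2 (fun p : ℝ × ℝ => (V.L (φ + p.1 • ψ + p.2 • ξ) x : ℝ)) (0, 0) := by
      refine (h2.of_le (WithTop.coe_le_coe.2 le_top)).congr_of_eventuallyEq
        (Eventually.of_forall fun p => ?_)
      exact (locRep_apply x (V.L (φ + p.1 • ψ + p.2 • ξ)) (mem_chart_source (Model d) x)).symm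
    exact hasDerivAt_fderiv_apply h3 1
  have hdiv : ∀ ψ ξ (Y : Sec (VB.tangent d M)),
      (∀ x, HasDerivAt (fun t : ℝ => modelValue (V.θ (φ + t • ψ) ξ) x) (modelValue Y x) 0) →
      IsDivergence μ (fun x => Y x) (fun x => deriv (fun s : ℝ => deriv
        (fun t : ℝ => (V.L (φ + t • ψ + s • ξ) x : ℝ)) 0) 0 - ev ξ (J ψ) x) := fun ψ ξ Y hY =>
    IsDivergence.hasDerivAt (hfam ψ ξ) hY (fun t => V.first_variation (φ + t • ψ) ξ)
      fun x => (hΛ ψ ξ x).sub (hJ ψ ξ x)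
  refine ⟨Y₁ - Y₂, fun x => ?_, ?_⟩
  · have h1 := (hY₁ x).deriv
    have h2 := (hY₂ x).deriv
    exact (congrArg₂ (fun a b : Model d => a - b) h1 h2).symm
  · have h := (hdiv ψ ξ Y₁ hY₁).sub (hdiv ξ ψ Y₂ hY₂)
    -- symmetry of the second derivatives of `L`
    have heq : ∀ x, deriv (fun s : ℝ => deriv (fun t : ℝ => (V.L (φ + t • ψ + s • ξ) x : ℝ)) 0) 0 =
        deriv (fun s : ℝ => deriv (fun t : ℝ => (V.L (φ + t • ξ + s • ψ) x : ℝ)) 0) 0 := by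
      intro x
      rw [← (hΛ ξ ψ x).deriv]
      simp only [add_right_comm φ]
    convert h using 2 with x
    rw [heq x]
    ring

theorem VariationalSystem.current_congr {ψ ψ' ξ ξ' : Sec F} {x : M}
    (h : ∀ᶠ q in 𝓝 x, ψ q = ψ' q) (h' : ∀ᶠ q in 𝓝 x, ξ q = ξ' q) :
    V.current φ ψ ξ x = V.current φ ψ' ξ' x := by
  have key : ∀ {ψ ψ' ξ ξ' : Sec F}, (∀ᶠ q in 𝓝 x, ψ q = ψ' q) → (∀ᶠ q in 𝓝 x, ξ q = ξ' q) →
      (fun t : ℝ => V.θ (φ + t • ψ) ξ x) = fun t : ℝ => V.θ (φ + t • ψ') ξ' x := by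
    intro ψ ψ' ξ ξ' h h'
    funext t
    refine V.θ_diffOp.congr ?_ h'
    filter_upwards [h] with q hq
    simp [hq]
  unfold VariationalSystem.current
  rw [key h h', key h' h]

theorem VariationalSystem.current_zero_left (ξ : Sec F) (x : M) : V.current φ 0 ξ x = 0 := by
  unfold VariationalSystem.current
  simp only [smul_zero, add_zero, map_zero]
  exact (congrArg₂ (fun a b : Model d => a - b) (deriv_const _ _) (deriv_const _ _)).trans
    (sub_zero (0 : Model d))

theorem VariationalSystem.current_zero_right (ψ : Sec F) (x : M) : V.current φ ψ 0 x = 0 := by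
  unfold VariationalSystem.current
  simp only [smul_zero, add_zero, map_zero]
  exact (congrArg₂ (fun a b : Model d => a - b) (deriv_const _ _) (deriv_const _ _)).trans
    (sub_zero (0 : Model d))

end

/-! ### Sections with restricted supports -/

section
variable [T2Space M] [SigmaCompactSpace M] {C : ChronalCone d M} {V : VB.{u, v} d M}
  {W : VB.{u, w} d M}

theorem mem_Sec₀_iff {s : Sec V} : s ∈ Sec₀ V ↔ IsCompact (supp s) :=
  ⟨fun ⟨_, hK, hs⟩ => hK.of_isClosed_subset (isClosed_supp _) hs, fun h => ⟨_, h, Subset.rfl⟩⟩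

theorem Sec₀_le_SecRet (C : ChronalCone d M) (V : VB.{u, v} d M) : Sec₀ V ≤ SecRet C V := by
  rintro s ⟨K, hK, hs⟩
  obtain ⟨K', hK', hKK'⟩ := exists_compact_subset_chronFuture C hK
  exact ⟨K', hK', hs.trans (hKK'.trans subset_closure)⟩

theorem Sec₀_le_SecAdv (C : ChronalCone d M) (V : VB.{u, v} d M) : Sec₀ V ≤ SecAdv C V := by
  rintro s ⟨K, hK, hs⟩
  obtain ⟨K', hK', hKK'⟩ := exists_compact_subset_chronPast C hK
  exact ⟨K', hK', hs.trans (hKK'.trans subset_closure)⟩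

theorem SecRet_le_SecSC (C : ChronalCone d M) (V : VB.{u, v} d M) : SecRet C V ≤ SecSC C V := by
  rintro s ⟨K, hK, hs⟩
  exact ⟨K, hK, hs.trans (closure_mono (subset_union_left.trans subset_union_left))⟩

theorem SecAdv_le_SecSC (C : ChronalCone d M) (V : VB.{u, v} d M) : SecAdv C V ≤ SecSC C V := by
  rintro s ⟨K, hK, hs⟩
  exact ⟨K, hK, hs.trans (closure_mono (subset_union_right.trans subset_union_left))⟩

theorem isCompact_overlap_left {s : Sec V} (hs : s ∈ Sec₀ V) (t : Sec W) :
    IsCompact (supp s ∩ supp t) :=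
  (mem_Sec₀_iff.1 hs).inter_right (isClosed_supp _)

theorem isCompact_overlap_right (s : Sec V) {t : Sec W} (ht : t ∈ Sec₀ W) :
    IsCompact (supp s ∩ supp t) :=
  (mem_Sec₀_iff.1 ht).inter_left (isClosed_supp _)

variable {S : Set M} (hS : IsCauchySurface C S)
include hS

theorem IsCauchySurface.isCompact_overlap {s : Sec V} (hs : s ∈ SecRet C V) {t : Sec W}
    (ht : t ∈ SecAdv C W) : IsCompact (supp s ∩ supp t) := by
  obtain ⟨K, hK, hs⟩ := hs
  obtain ⟨L, hL, ht⟩ := ht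
  exact (hS.isCompact_closure_inter_closure hK hL).of_isClosed_subset
    ((isClosed_supp _).inter (isClosed_supp _)) (inter_subset_inter hs ht)

theorem IsCauchySurface.isCompact_overlap' {s : Sec V} (hs : s ∈ SecAdv C V) {t : Sec W}
    (ht : t ∈ SecRet C W) : IsCompact (supp s ∩ supp t) :=
  inter_comm (supp t) (supp s) ▸ hS.isCompact_overlap ht hs

theorem IsCauchySurface.mem_Sec₀ {s : Sec V} (hs : s ∈ SecRet C V) (hs' : s ∈ SecAdv C V) :
    s ∈ Sec₀ V :=
  mem_Sec₀_iff.2 (inter_self (supp s) ▸ hS.isCompact_overlap hs hs')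

theorem IsCauchySurface.isCompact_supp_inter {s : Sec V} (hs : s ∈ SecRet C V) :
    IsCompact (supp s ∩ (S ∪ pastOf C S)) := by
  obtain ⟨K, hK, hs⟩ := hs
  exact (hS.isCompact_closure_chronFuture_inter hK).of_isClosed_subset
    ((isClosed_supp _).inter hS.isClosed_union_pastOf) (inter_subset_inter_left _ hs)

/-- A section with spacelike compact support is the sum of a section with retarded support and one
with advanced support, the latter vanishing to the future of the Cauchy surface. -/
theorem IsCauchySurface.exists_split {ψ : Sec V} (hψ : ψ ∈ SecSC C V) :
    ∃ ψp ∈ SecRet C V, ψ - ψp ∈ SecAdv C V ∧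
      ∀ x ∈ S ∪ futureOf C S, ∀ᶠ q in 𝓝 x, ψp q = ψ q := by
  obtain ⟨K, hK, hψ⟩ := hψ
  obtain ⟨K', hK', hKK'⟩ := exists_compact_subset_chronFuture C hK
  have hL : IsCompact (K ∪ K') := hK.union hK'
  set L := K ∪ K'
  have hψL : supp ψ ⊆ closure (chronFuture C L) ∪ closure (chronPast C L) := by
    rw [← closure_union]
    refine hψ.trans (closure_mono (union_subset (union_subset ?_ ?_) ?_))
    · exact (chronFuture_mono C subset_union_left).trans subset_union_left
    · exact (chronPast_mono C subset_union_left).trans subset_union_right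
    · exact hKK'.trans ((chronFuture_mono C subset_union_right).trans subset_union_left)
  obtain ⟨χ, hχ, hχ1, hχp, hχf⟩ := hS.exists_cutoff hL
  have hχ' : SmoothFun (d := d) (fun x => 1 - χ x) := contMDiff_const.sub hχ
  refine ⟨smulSec χ hχ ψ, ?_, ?_, fun x hx => ?_⟩
  · obtain ⟨K₁, hK₁, h₁⟩ := exists_compact_subset_chronFuture C hχp
    refine ⟨L ∪ K₁, hL.union hK₁, fun x hx => ?_⟩
    have hx' := supp_smulSec hx
    rcases hψL hx'.2 with h | h
    · exact closure_mono (chronFuture_mono C subset_union_left) h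
    · exact subset_closure (chronFuture_mono C subset_union_right (h₁ ⟨h, hx'.1⟩))
  · have h2 : ψ - smulSec χ hχ ψ = smulSec (fun x => 1 - χ x) hχ' ψ := by
      refine ContMDiffSection.ext fun x => ?_
      have : ψ x - χ x • ψ x = (1 - χ x) • ψ x := by rw [sub_smul, one_smul]
      exact this
    rw [h2]
    obtain ⟨K₁, hK₁, h₁⟩ := exists_compact_subset_chronPast C hχf
    refine ⟨L ∪ K₁, hL.union hK₁, fun x hx => ?_⟩
    have hx' := supp_smulSec hx
    rcases hψL hx'.2 with h | h
    · exact subset_closure (chronPast_mono C subset_union_right (h₁ ⟨h, hx'.1⟩))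
    · exact closure_mono (chronPast_mono C subset_union_left) h
  · filter_upwards [eventually_nhdsSet_iff_forall.1 hχ1 x hx] with q hq
    rw [smulSec_apply, hq, one_smul]
end

/-! ### Local operators -/

/-- A linear operator which does not increase supports. -/
def IsLocal {V : VB.{u, v} d M} {W : VB.{u, w} d M} (D : Sec V →ₗ[ℝ] Sec W) : Prop :=
  ∀ s, supp (D s) ⊆ supp s

section
variable {V : VB.{u, v} d M} {W : VB.{u, w} d M} {D : Sec V →ₗ[ℝ] Sec W}

theorem IsDiffOp.isLocal [T2Space M] [SigmaCompactSpace M] (h : IsDiffOp D) : IsLocal D :=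
  h.supp_subset

theorem IsLocal.comp {X : VB.{u, v} d M} {D' : Sec W →ₗ[ℝ] Sec X} (h' : IsLocal D')
    (h : IsLocal D) :
    IsLocal (D' ∘ₗ D) := fun s => (h' (D s)).trans (h s)

theorem IsLocal.add {D' : Sec V →ₗ[ℝ] Sec W} (h : IsLocal D) (h' : IsLocal D') :
    IsLocal (D + D') := fun s => (supp_add _ _).trans (union_subset (h s) (h' s))

theorem IsLocal.mem_Sec₀ (h : IsLocal D) {s : Sec V} : s ∈ Sec₀ V → D s ∈ Sec₀ W :=
  fun ⟨K, hK, hs⟩ => ⟨K, hK, (h s).trans hs⟩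

theorem IsLocal.mem_SecRet {C : ChronalCone d M} (h : IsLocal D) {s : Sec V} :
    s ∈ SecRet C V → D s ∈ SecRet C W :=
  fun ⟨K, hK, hs⟩ => ⟨K, hK, (h s).trans hs⟩

theorem IsLocal.mem_SecAdv {C : ChronalCone d M} (h : IsLocal D) {s : Sec V} :
    s ∈ SecAdv C V → D s ∈ SecAdv C W :=
  fun ⟨K, hK, hs⟩ => ⟨K, hK, (h s).trans hs⟩

theorem IsLocal.mem_SecSC {C : ChronalCone d M} (h : IsLocal D) {s : Sec V} :
    s ∈ SecSC C V → D s ∈ SecSC C W :=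
  fun ⟨K, hK, hs⟩ => ⟨K, hK, (h s).trans hs⟩

variable [T2Space M] [SigmaCompactSpace M]

theorem IsLocal.eventually_eq (h : IsLocal D) {s t : Sec V} {x : M} (hst : ∀ᶠ q in 𝓝 x, s q = t q) :
    ∀ᶠ q in 𝓝 x, D s q = D t q := by
  have h1 : x ∉ supp (s - t) := notMem_supp_iff.2 <| by
    filter_upwards [hst] with q hq
    have : s q - t q = 0 := sub_eq_zero.2 hq
    exact this
  have h2 := notMem_supp_iff.1 fun hx => h1 (h (s - t) hx)
  filter_upwards [h2] with q hq
  rw [map_sub] at hq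
  have hq' : D s q - D t q = 0 := hq
  exact sub_eq_zero.1 hq'
end

/-! ### Green functions -/

section
variable {C : ChronalCone d M} {V W : VB.{u, v} d M} {f : Sec V →ₗ[ℝ] Sec W}

theorem solveIn_spec {B : Submodule ℝ (Sec V)} {α : Sec W} (h : ∃ φ ∈ B, f φ = α) :
    solveIn f B α ∈ B ∧ f (solveIn f B α) = α := by
  unfold solveIn
  rw [dif_pos h]
  exact h.choose_spec

namespace GreenHyperbolic
variable (hf : GreenHyperbolic C f)
include hf

theorem ret_spec {α : Sec W} (hα : α ∈ SecRet C W) :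
    solveIn f (SecRet C V) α ∈ SecRet C V ∧ f (solveIn f (SecRet C V) α) = α :=
  let ⟨φ, hφ, h, _⟩ := (hf.1 α hα).1
  solveIn_spec ⟨φ, hφ, h⟩

theorem adv_spec {α : Sec W} (hα : α ∈ SecAdv C W) :
    solveIn f (SecAdv C V) α ∈ SecAdv C V ∧ f (solveIn f (SecAdv C V) α) = α :=
  let ⟨φ, hφ, h, _⟩ := (hf.2 α hα).1
  solveIn_spec ⟨φ, hφ, h⟩

theorem eq_zero_of_ret {φ : Sec V} (hφ : φ ∈ SecRet C V) (h : f φ = 0) : φ = 0 :=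
  (hf.1 0 (zero_mem _)).2 φ hφ 0 (zero_mem _) h (map_zero f)

theorem eq_zero_of_adv {φ : Sec V} (hφ : φ ∈ SecAdv C V) (h : f φ = 0) : φ = 0 :=
  (hf.2 0 (zero_mem _)).2 φ hφ 0 (zero_mem _) h (map_zero f)

theorem eq_of_ret {φ ψ : Sec V} (hφ : φ ∈ SecRet C V) (hψ : ψ ∈ SecRet C V) (h : f φ = f ψ) :
    φ = ψ :=
  sub_eq_zero.1 (hf.eq_zero_of_ret (sub_mem hφ hψ) (by rw [map_sub, h, sub_self]))

theorem eq_of_adv {φ ψ : Sec V} (hφ : φ ∈ SecAdv C V) (hψ : ψ ∈ SecAdv C V) (h : f φ = f ψ) :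
    φ = ψ :=
  sub_eq_zero.1 (hf.eq_zero_of_adv (sub_mem hφ hψ) (by rw [map_sub, h, sub_self]))

/-- The causal Green function is characterized by the retarded and the advanced solution. -/
theorem causalGreen_eq {α : Sec W} {φ ψ : Sec V} (hφ : φ ∈ SecRet C V) (hψ : ψ ∈ SecAdv C V)
    (hφα : f φ = α) (hψα : f ψ = α) (hα : α ∈ SecRet C W) (hα' : α ∈ SecAdv C W) :
    causalGreen C f α = φ - ψ := by
  unfold causalGreen
  rw [hf.eq_of_ret (hf.ret_spec hα).1 hφ ((hf.ret_spec hα).2.trans hφα.symm),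
    hf.eq_of_adv (hf.adv_spec hα').1 hψ ((hf.adv_spec hα').2.trans hψα.symm)]
end GreenHyperbolic
end

/-! ### The pairing of sections with dual densities -/

section
variable [T2Space M] [SigmaCompactSpace M] [MeasurableSpace M] [BorelSpace M]
  {μ : SmoothDensity d M} {V : VB.{u, v} d M}

/-- The pairing `∫ s · a` of a section with a dual density. -/
noncomputable def pairing (μ : SmoothDensity d M) (s : Sec V) (a : Sec V.dual) : ℝ :=
  ∫ x, ev s a x ∂μ.meas

theorem pairing_sub_left {s t : Sec V} {a : Sec V.dual} (hs : IsCompact (supp s ∩ supp a))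
    (ht : IsCompact (supp t ∩ supp a)) : pairing μ (s - t) a = pairing μ s a - pairing μ t a := by
  unfold pairing
  simp_rw [ev_sub_left]
  exact integral_sub (integrable_ev hs) (integrable_ev ht)

theorem pairing_add_right {s : Sec V} {a b : Sec V.dual} (ha : IsCompact (supp s ∩ supp a))
    (hb : IsCompact (supp s ∩ supp b)) : pairing μ s (a + b) = pairing μ s a + pairing μ s b := by
  unfold pairing
  simp_rw [ev_add_right]
  exact integral_add (integrable_ev ha) (integrable_ev hb)

theorem pairing_sub_right {s : Sec V} {a b : Sec V.dual} (ha : IsCompact (supp s ∩ supp a))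
    (hb : IsCompact (supp s ∩ supp b)) : pairing μ s (a - b) = pairing μ s a - pairing μ s b := by
  unfold pairing
  simp_rw [ev_sub_right]
  exact integral_sub (integrable_ev ha) (integrable_ev hb)

theorem pairing_zero_left (a : Sec V.dual) : pairing μ (0 : Sec V) a = 0 := by
  unfold pairing
  simp [ev_eq_zero_left a (show (0 : Sec V) _ = 0 from rfl)]

theorem pairing_zero_right (s : Sec V) : pairing μ s (0 : Sec V.dual) = 0 := by
  unfold pairing
  simp [ev_eq_zero_right s (show (0 : Sec V.dual) _ = 0 from rfl)]

theorem pairing_neg_right (s : Sec V) (a : Sec V.dual) : pairing μ s (-a) = -pairing μ s a := by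
  unfold pairing
  rw [← integral_neg]
  rfl

end

section
variable [T2Space M] [SigmaCompactSpace M] [MeasurableSpace M] [BorelSpace M]
  {μ : SmoothDensity d M} {C : ChronalCone d M}

/-! ### Adjoints and Green functions -/

section
variable {V W : VB.{u, v} d M}

theorem isCompact_overlap_mono {X : VB.{u, v} d M} {s : Sec V} {t : Sec W} {t' : Sec X}
    (h : IsCompact (supp s ∩ supp t))
    (ht : supp t' ⊆ supp t) : IsCompact (supp s ∩ supp t') :=
  h.of_isClosed_subset ((isClosed_supp _).inter (isClosed_supp _)) (inter_subset_inter_right _ ht)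

theorem HypOp.isLocal (f : HypOp μ C V) : IsLocal f.op := f.adjoint.1.isLocal
theorem HypOp.isLocal_adj (f : HypOp μ C V) : IsLocal f.adj := f.adjoint.2.1.isLocal
theorem FieldOp.isLocal (f : FieldOp μ V W) : IsLocal f.op := f.adjoint.1.isLocal
theorem FieldOp.isLocal_adj (f : FieldOp μ V W) : IsLocal f.adj := f.adjoint.2.1.isLocal
theorem DensOp.isLocal_adj (f : DensOp μ V W) : IsLocal f.adj := f.adjoint.2.1.isLocal

theorem HypOp.pairing_eq (f : HypOp μ C V) {s t : Sec V} (h : IsCompact (supp s ∩ supp t)) :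
    pairing μ t (f.op s) = pairing μ s (f.adj t) := f.integral_eq h

theorem FieldOp.pairing_eq (f : FieldOp μ V W) {s : Sec V} {t : Sec W.dual}
    (h : IsCompact (supp s ∩ supp t)) : pairing μ (f.op s) t = pairing μ s (f.adj t) :=
  f.integral_eq h

theorem DensOp.pairing_eq (f : DensOp μ V W) {s : Sec V.dual} {t : Sec W}
    (h : IsCompact (supp s ∩ supp t)) : pairing μ t (f.op s) = pairing μ (f.adj t) s :=
  f.integral_eq h

/-- The adjoint of a commutative square commutes. -/
theorem adj_comm {a : FieldOp μ V W} {f : HypOp μ C W} {s : DensOp μ V W} {k : HypOp μ C V}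
    (h : f.op ∘ₗ a.op = s.op ∘ₗ k.op) (ξ : Sec W) : a.adj (f.adj ξ) = k.adj (s.adj ξ) := by
  refine sub_eq_zero.1 (eq_zero_of_integral_ev_left (μ := μ) fun ψ hψ => ?_)
  change pairing μ ψ (a.adj (f.adj ξ) - k.adj (s.adj ξ)) = 0
  rw [pairing_sub_right (isCompact_overlap_left hψ _) (isCompact_overlap_left hψ _),
    ← a.pairing_eq (isCompact_overlap_left hψ _),
    ← f.pairing_eq (isCompact_overlap_left (a.isLocal.mem_Sec₀ hψ) _),
    ← k.pairing_eq (isCompact_overlap_left hψ _),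
    ← s.pairing_eq (isCompact_overlap_left (k.isLocal.mem_Sec₀ hψ) _)]
  have h1 : f.op (a.op ψ) = s.op (k.op ψ) := LinearMap.congr_fun h ψ
  rw [h1, sub_self]

variable {S : Set M} (hS : IsCauchySurface C S)
include hS

/-- The causal Green functions of an operator and of its adjoint are antiadjoint. -/
theorem IsCauchySurface.pairing_causalGreen (f : HypOp μ C V) {β γ : Sec V.dual}
    (hβ : β ∈ Sec₀ V.dual)
    (hγ : γ ∈ Sec₀ V.dual) :
    pairing μ (causalGreen C f.op γ) β = -pairing μ (causalGreen C f.adj β) γ := by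
  obtain ⟨hR, hRγ⟩ := f.green.ret_spec (Sec₀_le_SecRet C _ hγ)
  obtain ⟨hA, hAγ⟩ := f.green.adv_spec (Sec₀_le_SecAdv C _ hγ)
  obtain ⟨hR', hRβ⟩ := f.green_adj.ret_spec (Sec₀_le_SecRet C _ hβ)
  obtain ⟨hA', hAβ⟩ := f.green_adj.adv_spec (Sec₀_le_SecAdv C _ hβ)
  unfold causalGreen
  rw [pairing_sub_left (isCompact_overlap_right _ hβ) (isCompact_overlap_right _ hβ),
    pairing_sub_left (isCompact_overlap_right _ hγ) (isCompact_overlap_right _ hγ)]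
  have h1 := f.pairing_eq (hS.isCompact_overlap hR hA')
  have h2 := f.pairing_eq (hS.isCompact_overlap' hA hR')
  rw [hRγ, hAβ] at h1
  rw [hAγ, hRβ] at h2
  rw [← h1, ← h2]
  ring

/-- The theorem of Stokes for a field with divergence `ξ · α`, where `α` vanishes on `S` and to its
future. -/
theorem IsCauchySurface.hasFlux_pairing {X : Sec (VB.tangent d M)} {ξ : Sec V} {α : Sec V.dual}
    (hX : IsDivergence μ (fun x => X x) (ev ξ α)) (hc : IsCompact (supp X ∩ (S ∪ pastOf C S)))
    (hα : ∀ x ∈ S ∪ futureOf C S, α x = 0) {a : ℝ} :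
    HasFlux μ C S (fun x => X x) a ↔ a = pairing μ ξ α := by
  rw [hS.hasFlux_iff hX hc, pairing, setIntegral_eq_integral_of_forall_compl_eq_zero]
  intro x hx
  refine ev_eq_zero_right ξ (hα x ?_)
  rw [hS.union_futureOf_eq]
  exact hx
end

/-! ### The Jacobi operator -/

section
variable {F : VB.{u, v} d M} {V : VariationalSystem μ F} {φ : Sec F} {J : Sec F →ₗ[ℝ] Sec F.dual}

theorem VariationalSystem.supp_current_subset {ψ ξ : Sec F} {X : Sec (VB.tangent d M)}
    (hX : ∀ x, X x = V.current φ ψ ξ x) : supp X ⊆ supp ψ ∩ supp ξ := by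
  refine fun x hx => ⟨?_, ?_⟩
  · by_contra h
    refine notMem_supp_iff.2 ?_ hx
    filter_upwards [(notMem_supp_iff.1 h).eventually_nhds] with q hq
    rw [hX, V.current_congr φ (ψ' := 0) (ξ' := ξ) hq (Eventually.of_forall fun _ => rfl),
      V.current_zero_left]
  · by_contra h
    refine notMem_supp_iff.2 ?_ hx
    filter_upwards [(notMem_supp_iff.1 h).eventually_nhds] with q hq
    rw [hX, V.current_congr φ (ψ' := ψ) (ξ' := 0) (Eventually.of_forall fun _ => rfl) hq,
      V.current_zero_right]

/-- The Jacobi operator is formally self-adjoint. -/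
theorem VariationalSystem.IsJacobi.pairing_eq (hJ : V.IsJacobi φ J) (hJl : IsLocal J) {ψ ξ : Sec F}
    (h : IsCompact (supp ψ ∩ supp ξ)) : pairing μ ψ (J ξ) = pairing μ ξ (J ψ) := by
  obtain ⟨X, hX, hdiv⟩ := V.exists_current φ hJ ψ ξ
  have hc : IsCompact (supp X) :=
    h.of_isClosed_subset (isClosed_supp _) (VariationalSystem.supp_current_subset hX)
  have h' : IsCompact (supp ξ ∩ supp ψ) := by rwa [inter_comm]
  have h1 : pairing μ ψ (J ξ) - pairing μ ξ (J ψ) = 0 := by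
    unfold pairing
    rw [← integral_sub (integrable_ev (isCompact_overlap_mono h (hJl ξ)))
      (integrable_ev (isCompact_overlap_mono h' (hJl ψ)))]
    exact integral_divergence_eq_zero hdiv hc
  exact sub_eq_zero.1 h1

namespace Hyperbolization
variable (H : Hyperbolization μ C J)
include H

theorem isLocal_J : IsLocal J := by
  rw [H.J_eq]
  exact (H.r_diffOp.isLocal.comp H.f.isLocal).add (H.rc_diffOp.isLocal.comp H.constr.b.isLocal)

theorem J_eq_zero {ψ : Sec F} (hψ : ψ ∈ H.Sol) : J ψ = 0 := by
  have h1 : H.f.op ψ = 0 := hψ.1.2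
  have h2 : H.constr.b.op ψ = 0 := hψ.2
  rw [H.J_eq, LinearMap.add_apply, LinearMap.comp_apply, LinearMap.comp_apply, h1, h2, map_zero,
    map_zero, add_zero]

/-- Noether's identity `g^* J = 0`. -/
theorem gauge_adj_J (hJ : V.IsJacobi φ J) (ψ : Sec F) : H.gauge.a.adj (J ψ) = 0 := by
  refine eq_zero_of_integral_ev_left (μ := μ) fun ε hε => ?_
  change pairing μ ε (H.gauge.a.adj (J ψ)) = 0
  have h0 : J (H.gauge.a.op ε) = 0 := LinearMap.congr_fun H.gauge_invariance ε
  rw [← H.gauge.a.pairing_eq (isCompact_overlap_left hε _),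
    hJ.pairing_eq H.isLocal_J (isCompact_overlap_left (H.gauge.a.isLocal.mem_Sec₀ hε) _), h0,
    pairing_zero_right]

variable {H}

theorem Trivial_le_Sec₀ : H.Trivial ≤ Sec₀ F.dual := by
  refine sup_le ?_ ?_
  · rintro _ ⟨ξ, hξ, rfl⟩
    exact H.f.isLocal_adj.mem_Sec₀ hξ
  · rintro _ ⟨ε, hε, rfl⟩
    exact H.constr.b.isLocal_adj.mem_Sec₀ hε

/-- Trivial dual densities annihilate the linearized solutions, of arbitrary support. -/
theorem pairing_eq_zero_of_mem_Trivial {ψ : Sec F} (h1 : H.f.op ψ = 0) (h2 : H.constr.b.op ψ = 0)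
    {α : Sec F.dual} (hα : α ∈ H.Trivial) : pairing μ ψ α = 0 := by
  obtain ⟨_, ⟨ξ, hξ, rfl⟩, _, ⟨ε, hε, rfl⟩, rfl⟩ := Submodule.mem_sup.1 hα
  rw [pairing_add_right (isCompact_overlap_right _ (H.f.isLocal_adj.mem_Sec₀ hξ))
    (isCompact_overlap_right _ (H.constr.b.isLocal_adj.mem_Sec₀ hε)),
    ← H.f.pairing_eq (isCompact_overlap_right _ hξ), ← H.constr.b.pairing_eq
      (isCompact_overlap_right _ hε), h1, h2, pairing_zero_right, pairing_zero_left, add_zero]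

/-- Compactly supported dual densities annihilating all linearized solutions are trivial. This is
where parametrizability of the constraints enters. -/
theorem mem_Trivial_of_pairing {S : Set M} (hS : IsCauchySurface C S)
    (hpar : H.GloballyParametrizable S) {α : Sec F.dual} (hα : α ∈ Sec₀ F.dual)
    (h : ∀ ξ ∈ H.Sol, pairing μ ξ α = 0) : α ∈ H.Trivial := by
  obtain ⟨G, hG, -, hpar⟩ := hpar
  have hαr := Sec₀_le_SecRet C _ hα
  have hαa := Sec₀_le_SecAdv C _ hα
  -- the retarded and advanced solutions of `h'^* η = c'^* α` agree
  have hβ : H.constr.a.adj α ∈ Sec₀ H.E'.dual := H.constr.a.isLocal_adj.mem_Sec₀ hα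
  have hGβ : causalGreen C H.constr.k.adj (H.constr.a.adj α) = 0 := by
    refine eq_zero_of_integral_ev_right (μ := μ) fun γ hγ => ?_
    change pairing μ _ γ = 0
    obtain ⟨hR, hRγ⟩ := H.constr.k.green.ret_spec (Sec₀_le_SecRet C _ hγ)
    obtain ⟨hA, hAγ⟩ := H.constr.k.green.adv_spec (Sec₀_le_SecAdv C _ hγ)
    have h1 := hS.pairing_causalGreen H.constr.k hβ hγ
    have h2 : H.constr.k.op (causalGreen C H.constr.k.op γ) = 0 := by
      rw [causalGreen, map_sub, hRγ, hAγ, sub_self]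
    have hsc : causalGreen C H.constr.k.op γ ∈ SecSC C H.E' :=
      sub_mem (SecRet_le_SecSC C _ hR) (SecAdv_le_SecSC C _ hA)
    have h3 : H.constr.a.op (causalGreen C H.constr.k.op γ) ∈ H.Sol := by
      refine ⟨⟨H.constr.a.isLocal.mem_SecSC hsc, ?_⟩, ?_⟩
      · change H.f.op (H.constr.a.op _) = 0
        have := LinearMap.congr_fun H.constr.comm_left (causalGreen C H.constr.k.op γ)
        refine this.trans ?_
        rw [LinearMap.comp_apply, h2, map_zero]
      · exact LinearMap.congr_fun H.constr.exact_field.1 _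
    have h4 := h _ h3
    rw [H.constr.a.pairing_eq (isCompact_overlap_right _ hα), h1, neg_eq_zero] at h4
    exact h4
  obtain ⟨hηp, hηpβ⟩ := H.constr.k.green_adj.ret_spec (Sec₀_le_SecRet C _ hβ)
  obtain ⟨hηm, hηmβ⟩ := H.constr.k.green_adj.adv_spec (Sec₀_le_SecAdv C _ hβ)
  have hη := sub_eq_zero.1 hGβ
  -- hence `ξp - ξm`, where `f^* ξp = f^* ξm = α`, is annihilated by `q'^*`
  obtain ⟨hξp, hξpα⟩ := H.f.green_adj.ret_spec hαr
  obtain ⟨hξm, hξmα⟩ := H.f.green_adj.adv_spec hαa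
  set ξp := solveIn H.f.adj (SecRet C F) α
  set ξm := solveIn H.f.adj (SecAdv C F) α
  have hqp : H.constr.s.adj ξp = solveIn H.constr.k.adj (SecRet C H.E') (H.constr.a.adj α) := by
    refine H.constr.k.green_adj.eq_of_ret (H.constr.s.isLocal_adj.mem_SecRet hξp) hηp ?_
    rw [hηpβ, ← adj_comm H.constr.comm_left, hξpα]
  have hqm : H.constr.s.adj ξm = solveIn H.constr.k.adj (SecAdv C H.E') (H.constr.a.adj α) := by
    refine H.constr.k.green_adj.eq_of_adv (H.constr.s.isLocal_adj.mem_SecAdv hξm) hηm ?_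
    rw [hηmβ, ← adj_comm H.constr.comm_left, hξmα]
  have hξsc : ξp - ξm ∈ SecSC C F := sub_mem (SecRet_le_SecSC C _ hξp) (SecAdv_le_SecSC C _ hξm)
  have hfξ : H.f.adj (ξp - ξm) = 0 := by rw [map_sub, hξpα, hξmα, sub_self]
  have hqξ : H.constr.s.adj (ξp - ξm) = 0 := by rw [map_sub, hqp, hqm, hη, sub_self]
  -- it pairs to zero with the solutions on `S`, and therefore equals `q^* ζ`
  obtain ⟨ζ, hζ, hhζ, hξζ⟩ := hpar (ξp - ξm) hξsc hfξ hqξ fun ψ hψ hfψ hcψ => by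
    obtain ⟨ψp, hψp, hψm, hnear⟩ := hS.exists_split hψ
    have hfm : H.f.op (ψ - ψp) = -H.f.op ψp := by rw [map_sub, hfψ, zero_sub]
    have hδ : H.f.op ψp ∈ Sec₀ F.dual := by
      refine hS.mem_Sec₀ (H.f.isLocal.mem_SecRet hψp) ?_
      have := neg_mem (H.f.isLocal.mem_SecAdv hψm)
      rwa [hfm, neg_neg] at this
    have hdiv := hG.2 ψp (ξp - ξm)
    have hdiv' : IsDivergence μ (fun x => G ψp (ξp - ξm) x) (ev (ξp - ξm) (H.f.op ψp)) := by
      convert hdiv using 2 with x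
      rw [hfξ, ev_eq_zero_right ψp (show (0 : Sec F.dual) x = 0 from rfl), sub_zero]
      rfl
    have hcpt : IsCompact (supp (G ψp (ξp - ξm)) ∩ (S ∪ pastOf C S)) :=
      (hS.isCompact_supp_inter hψp).of_isClosed_subset
        ((isClosed_supp _).inter hS.isClosed_union_pastOf)
        (inter_subset_inter_left _ ((hG.1.supp_subset _ _).trans inter_subset_left))
    have hvan : ∀ x ∈ S ∪ futureOf C S, H.f.op ψp x = 0 := fun x hx => by
      rw [(H.f.isLocal.eventually_eq (hnear x hx)).self_of_nhds, hfψ]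
      rfl
    rw [hasFlux_congr (Y := fun x => G ψp (ξp - ξm) x) fun x hx => hG.1.congr
      ((hnear x (Or.inl hx)).mono fun _ h => h.symm) (Eventually.of_forall fun _ => rfl),
      hS.hasFlux_pairing hdiv' hcpt hvan]
    have hψα := h ψ ⟨⟨hψ, hfψ⟩, hcψ⟩
    have e1 := H.f.pairing_eq (hS.isCompact_overlap' hψm hξp)
    have e2 := H.f.pairing_eq (hS.isCompact_overlap hψp hξm)
    rw [hξpα, hfm, pairing_neg_right, pairing_sub_left (isCompact_overlap_right _ hα)
      (isCompact_overlap_right _ hα), hψα] at e1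
    rw [hξmα] at e2
    rw [pairing_sub_left (isCompact_overlap_right _ hδ) (isCompact_overlap_right _ hδ), e2]
    linarith
  -- correct `ξp` by the retarded part of the potential `ζ`
  obtain ⟨ζp, hζp, hζm, -⟩ := hS.exists_split hζ
  have hε : H.constr.l.adj ζp ∈ Sec₀ H.E.dual := by
    refine hS.mem_Sec₀ (H.constr.l.isLocal_adj.mem_SecRet hζp) ?_
    have := neg_mem (H.constr.l.isLocal_adj.mem_SecAdv hζm)
    rwa [map_sub, hhζ, zero_sub, neg_neg] at this
  have hw : ξp - H.constr.t.adj ζp ∈ Sec₀ F := by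
    refine hS.mem_Sec₀ (sub_mem hξp (H.constr.t.isLocal_adj.mem_SecRet hζp)) ?_
    have h1 : ξp - H.constr.t.adj ζp = ξm + H.constr.t.adj (ζ - ζp) := by
      rw [map_sub, ← hξζ]
      abel
    rw [h1]
    exact add_mem hξm (H.constr.t.isLocal_adj.mem_SecAdv hζm)
  have hα' : α = H.f.adj (ξp - H.constr.t.adj ζp) + H.constr.b.adj (H.constr.l.adj ζp) := by
    rw [map_sub, hξpα, adj_comm H.constr.comm_right, sub_add_cancel]
  rw [hα']
  exact add_mem (Submodule.mem_sup_left ⟨_, hw, rfl⟩) (Submodule.mem_sup_right ⟨_, hε, rfl⟩)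

end Hyperbolization
end
end

/-! ### Linear maps defined by representatives -/

section

/-- A relation which is additive, homogeneous, total and functional is the graph of a linear map. -/
theorem exists_linearMap_of_rel {A B : Type*} [AddCommGroup A] [Module ℝ A] [AddCommGroup B]
    [Module ℝ B] (R : A → B → Prop) (hex : ∀ a, ∃ b, R a b)
    (hadd : ∀ a a' b b', R a b → R a' b' → R (a + a') (b + b'))
    (hsmul : ∀ (c : ℝ) a b, R a b → R (c • a) (c • b))
    (huniq : ∀ a b b', R a b → R a b' → b = b') : ∃ f : A →ₗ[ℝ] B, ∀ a b, R a b → f a = b := by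
  choose f hf using hex
  exact ⟨{ toFun := f
           map_add' := fun a a' => huniq _ _ _ (hf _) (hadd _ _ _ _ (hf a) (hf a'))
           map_smul' := fun c a => huniq _ _ _ (hf _) (hsmul c _ _ (hf a)) },
    fun a b h => huniq _ _ _ (hf a) h⟩

variable [T2Space M] [SigmaCompactSpace M] [MeasurableSpace M] [BorelSpace M]
  {μ : SmoothDensity d M} {C : ChronalCone d M} {F : VB.{u, v} d M} {V : VariationalSystem μ F}
  {φ : Sec F} {J : Sec F →ₗ[ℝ] Sec F.dual} {S : Set M}

namespace Hyperbolization
variable {H : Hyperbolization μ C J}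

theorem mk_tangent_eq {ψ ψ' : H.Sol} :
    (Submodule.Quotient.mk ψ : H.Tangent) = Submodule.Quotient.mk ψ' ↔
      (ψ : Sec F) - ψ' ∈ H.PureGauge :=
  Submodule.Quotient.eq _

theorem mk_cotangent_eq {α α' : H.GaugeInv} :
    (Submodule.Quotient.mk α : H.Cotangent) = Submodule.Quotient.mk α' ↔
      (α : Sec F.dual) - α' ∈ H.Trivial :=
  Submodule.Quotient.eq _

/-! ### The reduced presymplectic form -/

theorem mem_GaugeInv_of_adj_eq_zero {α : Sec F.dual} (hα : α ∈ Sec₀ F.dual)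
    (h : H.gauge.a.adj α = 0) : α ∈ H.GaugeInv :=
  ⟨hα, 0, zero_mem _, by rw [map_zero, h]⟩

section
variable (hS : IsCauchySurface C S) (hJ : V.IsJacobi φ J)

section
include hJ

theorem pairing_J_eq_zero {δ ξ : Sec F} (hδ : δ ∈ Sec₀ F) (hξ : ξ ∈ H.Sol) :
    pairing μ ξ (J δ) = 0 := by
  rw [hJ.pairing_eq H.isLocal_J (isCompact_overlap_right _ hδ), J_eq_zero H hξ, pairing_zero_right]
end

include hS

/-- If `ψ = ψ₊ + ψ₋` is a decomposition of a linearized solution into a retarded and an advanced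
part, then `J ψ₊ = -J ψ₋` has compact support. -/
theorem J_mem_Sec₀ {ψ ψp : Sec F} (hψ : ψ ∈ H.Sol) (hp : ψp ∈ SecRet C F)
    (hm : ψ - ψp ∈ SecAdv C F) : J ψp ∈ Sec₀ F.dual := by
  refine hS.mem_Sec₀ (H.isLocal_J.mem_SecRet hp) ?_
  have := neg_mem (H.isLocal_J.mem_SecAdv hm)
  rwa [map_sub, J_eq_zero H hψ, zero_sub, neg_neg] at this

include hJ

theorem J_mem_GaugeInv {ψ ψp : Sec F} (hψ : ψ ∈ H.Sol) (hp : ψp ∈ SecRet C F)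
    (hm : ψ - ψp ∈ SecAdv C F) : J ψp ∈ H.GaugeInv :=
  mem_GaugeInv_of_adj_eq_zero (J_mem_Sec₀ hS hψ hp hm) (H.gauge_adj_J hJ ψp)

/-- The flux of the presymplectic current is the pairing with the image under the Jacobi operator of
the retarded part of a linearized solution. -/
theorem hasFlux_current_iff {ξ ψ ψp : Sec F} (hξ : ξ ∈ H.Sol) (hψ : ψ ∈ H.Sol)
    (hp : ψp ∈ SecRet C F) (hm : ψ - ψp ∈ SecAdv C F) {a : ℝ} :
    HasFlux μ C S (V.current φ ξ ψ) a ↔ a = pairing μ ξ (J ψp) := by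
  obtain ⟨ψq, hq, hqm, hnear⟩ := hS.exists_split hψ.1.1
  have hpq : pairing μ ξ (J ψp) = pairing μ ξ (J ψq) := by
    have hδ : ψp - ψq ∈ Sec₀ F := by
      refine hS.mem_Sec₀ (sub_mem hp hq) ?_
      have := sub_mem hqm hm
      rwa [sub_sub_sub_cancel_left] at this
    have h1 := pairing_J_eq_zero hJ hδ hξ
    rwa [map_sub, pairing_sub_right (isCompact_overlap_right _ (J_mem_Sec₀ hS hψ hp hm))
      (isCompact_overlap_right _ (J_mem_Sec₀ hS hψ hq hqm)), sub_eq_zero] at h1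
  obtain ⟨X, hX, hdiv⟩ := V.exists_current φ hJ ξ ψq
  rw [hpq, hasFlux_congr (Y := fun x => X x) fun x hx => ?_]
  · refine hS.hasFlux_pairing ?_ ?_ ?_
    · convert hdiv using 2 with x
      rw [J_eq_zero H hξ, ev_eq_zero_right ψq (show (0 : Sec F.dual) x = 0 from rfl), sub_zero]
    · exact (hS.isCompact_supp_inter hq).of_isClosed_subset
        ((isClosed_supp _).inter hS.isClosed_union_pastOf) (inter_subset_inter_left _
          ((VariationalSystem.supp_current_subset hX).trans inter_subset_right))
    · intro x hx
      rw [(H.isLocal_J.eventually_eq (hnear x hx)).self_of_nhds, J_eq_zero H hψ]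
      rfl
  · rw [hX]
    exact V.current_congr φ (Eventually.of_forall fun _ => rfl)
      ((hnear x (Or.inl hx)).mono fun _ h => h.symm)

variable (hpar : H.GloballyParametrizable S)
include hpar

theorem J_mem_Trivial {δ : Sec F} (hδ : δ ∈ Sec₀ F) : J δ ∈ H.Trivial :=
  mem_Trivial_of_pairing hS hpar (H.isLocal_J.mem_Sec₀ hδ) fun _ hξ => pairing_J_eq_zero hJ hδ hξ

/-- `Ω [ψ] = [J ψ₊]` for every decomposition of `ψ` into a retarded part `ψ₊` and an advanced part.
-/
theorem RepresentsSymplecticForm.apply {Ω : H.Tangent →ₗ[ℝ] H.Cotangent}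
    (hΩ : H.RepresentsSymplecticForm V φ S Ω) (ψ : H.Sol) {ψp : Sec F} (hp : ψp ∈ SecRet C F)
    (hm : ψ - ψp ∈ SecAdv C F) (α : H.GaugeInv) (hα : (α : Sec F.dual) = J ψp) :
    Ω (Submodule.Quotient.mk ψ) = Submodule.Quotient.mk α := by
  obtain ⟨α', hα'⟩ := Submodule.Quotient.mk_surjective _ (Ω (Submodule.Quotient.mk ψ))
  rw [← hα', mk_cotangent_eq]
  have h0 : (α : Sec F.dual) ∈ Sec₀ F.dual := α.2.1
  have h0' : (α' : Sec F.dual) ∈ Sec₀ F.dual := α'.2.1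
  refine mem_Trivial_of_pairing hS hpar (sub_mem h0' h0) fun ξ hξ => ?_
  have h1 := (hasFlux_current_iff hS hJ hξ ψ.2 hp hm).1 (hΩ ⟨ξ, hξ⟩ ψ α' hα'.symm)
  rw [pairing_sub_right (isCompact_overlap_right _ h0') (isCompact_overlap_right _ h0), hα, ← h1]
  exact sub_self _

/-- The reduced presymplectic form is the map `[ψ] ↦ [J ψ₊]`. It is well defined on gauge classes as
`J g = 0`, and does not depend on the decomposition as `J` maps compactly supported sections to
trivial densities. -/
theorem existsUnique_symplecticForm :
    ∃! Ω : H.Tangent →ₗ[ℝ] H.Cotangent, H.RepresentsSymplecticForm V φ S Ω := by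
  let R : H.Tangent → H.Cotangent → Prop := fun a b =>
    ∃ (ψ : H.Sol) (α : H.GaugeInv) (ψp : Sec F), ψp ∈ SecRet C F ∧ (ψ : Sec F) - ψp ∈ SecAdv C F ∧
      (α : Sec F.dual) = J ψp ∧ Submodule.Quotient.mk ψ = a ∧ Submodule.Quotient.mk α = b
  have hR : ∃ Ω : H.Tangent →ₗ[ℝ] H.Cotangent, ∀ a b, R a b → Ω a = b := by
    refine exists_linearMap_of_rel R ?_ ?_ ?_ ?_
    · intro a
      obtain ⟨ψ, rfl⟩ := Submodule.Quotient.mk_surjective _ a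
      obtain ⟨ψp, hp, hm, -⟩ := hS.exists_split ψ.2.1.1
      exact ⟨_, ψ, ⟨J ψp, J_mem_GaugeInv hS hJ ψ.2 hp hm⟩, ψp, hp, hm, rfl, rfl, rfl⟩
    · rintro _ _ _ _ ⟨ψ, α, ψp, hp, hm, hα, rfl, rfl⟩ ⟨ψ', α', ψp', hp', hm', hα', rfl, rfl⟩
      refine ⟨ψ + ψ', α + α', ψp + ψp', add_mem hp hp', ?_, ?_, rfl, rfl⟩
      · have := add_mem hm hm'
        rwa [sub_add_sub_comm] at this
      · rw [map_add, ← hα, ← hα']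
        rfl
    · rintro c _ _ ⟨ψ, α, ψp, hp, hm, hα, rfl, rfl⟩
      refine ⟨c • ψ, c • α, c • ψp, Submodule.smul_mem _ c hp, ?_, ?_, rfl, rfl⟩
      · have := Submodule.smul_mem _ c hm
        rwa [smul_sub] at this
      · rw [map_smul, ← hα]
        rfl
    · rintro _ _ _ ⟨ψ, α, ψp, hp, hm, hα, rfl, rfl⟩ ⟨ψ', α', ψp', hp', hm', hα', heq, rfl⟩
      rw [mk_tangent_eq] at heq
      obtain ⟨ε, hε, hεψ⟩ := heq
      obtain ⟨εp, hεp, hεm, -⟩ := hS.exists_split hε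
      rw [mk_cotangent_eq, hα, hα', ← map_sub]
      have hδ : ψp - ψp' + H.gauge.a.op εp ∈ Sec₀ F := by
        refine hS.mem_Sec₀ (add_mem (sub_mem hp hp') (H.gauge.a.isLocal.mem_SecRet hεp)) ?_
        have h1 := neg_mem (add_mem (sub_mem hm hm') (H.gauge.a.isLocal.mem_SecAdv hεm))
        rw [map_sub, hεψ] at h1
        convert h1 using 1
        abel
      have h0 : J (H.gauge.a.op εp) = 0 := LinearMap.congr_fun H.gauge_invariance εp
      have h2 := J_mem_Trivial hS hJ hpar hδ
      rwa [map_add, h0, add_zero] at h2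
  obtain ⟨Ω, hΩ⟩ := hR
  refine ⟨Ω, fun ξ ψ α h => ?_, fun Ω' hΩ' => ?_⟩
  · obtain ⟨ψp, hp, hm, -⟩ := hS.exists_split ψ.2.1.1
    have hJp := J_mem_GaugeInv hS hJ ψ.2 hp hm
    have h1 := hΩ _ _ ⟨ψ, ⟨J ψp, hJp⟩, ψp, hp, hm, rfl, rfl, rfl⟩
    rw [h, mk_cotangent_eq] at h1
    rw [hasFlux_current_iff hS hJ ξ.2 ψ.2 hp hm]
    have h2 := pairing_eq_zero_of_mem_Trivial ξ.2.1.2 ξ.2.2 h1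
    rw [pairing_sub_right (isCompact_overlap_right _ α.2.1) (isCompact_overlap_right _ hJp.1)] at h2
    exact sub_eq_zero.1 h2
  · refine LinearMap.ext fun a => ?_
    obtain ⟨ψ, rfl⟩ := Submodule.Quotient.mk_surjective _ a
    obtain ⟨ψp, hp, hm, -⟩ := hS.exists_split ψ.2.1.1
    have hJp := J_mem_GaugeInv hS hJ ψ.2 hp hm
    rw [hΩ _ _ ⟨ψ, ⟨J ψp, hJp⟩, ψp, hp, hm, rfl, rfl, rfl⟩]
    exact hΩ'.apply hS hJ hpar ψ hp hm ⟨J ψp, hJp⟩ rfl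
end

/-! ### The Peierls bivector -/

/-- Each cotangent vector is represented by a dual density annihilated by `g^*`. -/
theorem exists_adj_eq_zero (a : H.Cotangent) :
    ∃ α : H.GaugeInv, H.gauge.a.adj α = 0 ∧ Submodule.Quotient.mk α = a := by
  obtain ⟨α, rfl⟩ := Submodule.Quotient.mk_surjective _ a
  obtain ⟨τ, hτ, hτα⟩ := α.2.2
  have h0 : (α : Sec F.dual) - τ ∈ Sec₀ F.dual := sub_mem α.2.1 (Trivial_le_Sec₀ hτ)
  have h1 : H.gauge.a.adj ((α : Sec F.dual) - τ) = 0 := by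
    rw [map_sub, hτα]
    exact sub_self _
  refine ⟨⟨_, mem_GaugeInv_of_adj_eq_zero h0 h1⟩, h1, ?_⟩
  rw [mk_cotangent_eq]
  have : (α : Sec F.dual) - τ - α = -τ := by abel
  rw [this]
  exact neg_mem hτ

section
variable {α : Sec F.dual} (hα : α ∈ Sec₀ F.dual) (hg : H.gauge.a.adj α = 0)
include hα

theorem rbar_mem : H.rbar α ∈ Sec₀ F.dual := H.rbar_diffOp.isLocal.mem_Sec₀ hα

include hg

/-- The inhomogeneities are consistent with `h c = q f`. -/
theorem l_rbarJ : H.constr.l.op (H.rbarJ α) = H.constr.t.op (H.rbar α) := by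
  have h := LinearMap.congr_fun H.consistency α
  have h' : H.constr.t.op (H.rbar α) - H.constr.l.op (H.rbarJ α) = H.qJ (H.gauge.a.adj α) := h
  rw [hg, map_zero, sub_eq_zero] at h'
  exact h'.symm

/-- Solutions of `f χ = r̄ α` which satisfy the constraint `c χ = r̄_J α` solve the Jacobi equation
`J χ = α`. -/
theorem J_eq_of_f_eq {χ : Sec F} (hf : H.f.op χ = H.rbar α)
    (hc : H.constr.b.op χ = H.rbarJ α) : J χ = α := by
  have h := LinearMap.congr_fun H.inverse α
  have h' : H.r (H.rbar α) + H.rc (H.rbarJ α) = α + H.pJ (H.gauge.a.adj α) := h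
  have hJχ : J χ = H.r (H.f.op χ) + H.rc (H.constr.b.op χ) := LinearMap.congr_fun H.J_eq χ
  rw [hJχ, hf, hc, h', hg, map_zero, add_zero]

/-- The retarded and advanced solutions of `f χ = r̄ α` satisfy the constraint `c χ = r̄_J α` and
therefore solve the Jacobi equation `J χ = α`. -/
theorem exists_peierls_parts :
    ∃ χp ∈ SecRet C F, ∃ χm ∈ SecAdv C F, H.f.op χp = H.rbar α ∧ H.f.op χm = H.rbar α ∧
      J χp = α ∧ J χm = α ∧ H.peierls α = χp - χm ∧ H.peierls α ∈ H.Sol := by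
  have hβ := rbar_mem (H := H) hα
  obtain ⟨hp, hpβ⟩ := H.f.green.ret_spec (Sec₀_le_SecRet C _ hβ)
  obtain ⟨hm, hmβ⟩ := H.f.green.adv_spec (Sec₀_le_SecAdv C _ hβ)
  set χp := solveIn H.f.op (SecRet C F) (H.rbar α)
  set χm := solveIn H.f.op (SecAdv C F) (H.rbar α)
  have hrJ := H.rbarJ_diffOp.isLocal.mem_Sec₀ hα
  have hcomm : ∀ χ, H.constr.l.op (H.constr.b.op χ) = H.constr.t.op (H.f.op χ) :=
    fun χ => LinearMap.congr_fun H.constr.comm_right χ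
  have hcp : H.constr.b.op χp = H.rbarJ α := by
    refine H.constr.l.green.eq_of_ret (H.constr.b.isLocal.mem_SecRet hp)
      (Sec₀_le_SecRet C _ hrJ) ?_
    rw [hcomm, hpβ, l_rbarJ hα hg]
  have hcm : H.constr.b.op χm = H.rbarJ α := by
    refine H.constr.l.green.eq_of_adv (H.constr.b.isLocal.mem_SecAdv hm)
      (Sec₀_le_SecAdv C _ hrJ) ?_
    rw [hcomm, hmβ, l_rbarJ hα hg]
  refine ⟨χp, hp, χm, hm, hpβ, hmβ, J_eq_of_f_eq hα hg hpβ hcp, J_eq_of_f_eq hα hg hmβ hcm, rfl,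
    ⟨⟨sub_mem (SecRet_le_SecSC C _ hp) (SecAdv_le_SecSC C _ hm), ?_⟩, ?_⟩⟩
  · change H.f.op (χp - χm) = 0
    rw [map_sub, hpβ, hmβ, sub_self]
  · change H.constr.b.op (χp - χm) = 0
    rw [map_sub, hcp, hcm, sub_self]
end

theorem peierls_add {α α' : Sec F.dual} (hα : α ∈ Sec₀ F.dual) (hα' : α' ∈ Sec₀ F.dual) :
    H.peierls (α + α') = H.peierls α + H.peierls α' := by
  have hβ := rbar_mem (H := H) hα
  have hβ' := rbar_mem (H := H) hα'
  obtain ⟨hp, hpβ⟩ := H.f.green.ret_spec (Sec₀_le_SecRet C _ hβ)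
  obtain ⟨hm, hmβ⟩ := H.f.green.adv_spec (Sec₀_le_SecAdv C _ hβ)
  obtain ⟨hp', hpβ'⟩ := H.f.green.ret_spec (Sec₀_le_SecRet C _ hβ')
  obtain ⟨hm', hmβ'⟩ := H.f.green.adv_spec (Sec₀_le_SecAdv C _ hβ')
  unfold peierls
  rw [map_add, H.f.green.causalGreen_eq (add_mem hp hp') (add_mem hm hm')
    (by rw [map_add, hpβ, hpβ']) (by rw [map_add, hmβ, hmβ'])
    (Sec₀_le_SecRet C _ (add_mem hβ hβ')) (Sec₀_le_SecAdv C _ (add_mem hβ hβ'))]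
  unfold causalGreen
  abel

theorem peierls_smul (c : ℝ) {α : Sec F.dual} (hα : α ∈ Sec₀ F.dual) :
    H.peierls (c • α) = c • H.peierls α := by
  have hβ := rbar_mem (H := H) hα
  obtain ⟨hp, hpβ⟩ := H.f.green.ret_spec (Sec₀_le_SecRet C _ hβ)
  obtain ⟨hm, hmβ⟩ := H.f.green.adv_spec (Sec₀_le_SecAdv C _ hβ)
  unfold peierls
  rw [map_smul, H.f.green.causalGreen_eq (Submodule.smul_mem _ c hp) (Submodule.smul_mem _ c hm)
    (by rw [map_smul, hpβ]) (by rw [map_smul, hmβ])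
    (Sec₀_le_SecRet C _ (Submodule.smul_mem _ c hβ))
    (Sec₀_le_SecAdv C _ (Submodule.smul_mem _ c hβ))]
  unfold causalGreen
  rw [smul_sub]

section
variable (hS : IsCauchySurface C S) (hJ : V.IsJacobi φ J)
include hS hJ

/-- The Peierls bracket is antisymmetric. -/
theorem pairing_peierls {α α' : Sec F.dual} (hα : α ∈ Sec₀ F.dual) (hg : H.gauge.a.adj α = 0)
    (hα' : α' ∈ Sec₀ F.dual) (hg' : H.gauge.a.adj α' = 0) :
    pairing μ (H.peierls α) α' = -pairing μ (H.peierls α') α := by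
  obtain ⟨χp, hp, χm, hm, -, -, hJp, hJm, hE, -⟩ := exists_peierls_parts hα hg
  obtain ⟨χp', hp', χm', hm', -, -, hJp', hJm', hE', -⟩ := exists_peierls_parts hα' hg'
  have e1 := hJ.pairing_eq H.isLocal_J (hS.isCompact_overlap hp hm')
  have e2 := hJ.pairing_eq H.isLocal_J (hS.isCompact_overlap' hm hp')
  rw [hJm', hJp] at e1
  rw [hJp', hJm] at e2
  rw [hE, hE', pairing_sub_left (isCompact_overlap_right _ hα') (isCompact_overlap_right _ hα'),
    pairing_sub_left (isCompact_overlap_right _ hα) (isCompact_overlap_right _ hα), e1, e2]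
  ring

variable (hrec : H.GloballyRecognizable)
include hrec

/-- `E α` is pure gauge if `α` is trivial. It is annihilated by `g'`, because the image of `g'^*`
lies in the kernel of `g^*`, so that recognizability applies. -/
theorem peierls_mem_PureGauge {α : Sec F.dual} (hα : α ∈ H.Trivial) (hg : H.gauge.a.adj α = 0) :
    H.peierls α ∈ H.PureGauge := by
  have h0 := Trivial_le_Sec₀ hα
  have hpair : ∀ α' ∈ Sec₀ F.dual, H.gauge.a.adj α' = 0 → pairing μ (H.peierls α) α' = 0 := by
    intro α' hα' hg'
    obtain ⟨-, -, -, -, -, -, -, -, -, hsol⟩ := exists_peierls_parts hα' hg'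
    rw [pairing_peierls hS hJ h0 hg hα' hg', pairing_eq_zero_of_mem_Trivial hsol.1.2 hsol.2 hα,
      neg_zero]
  obtain ⟨-, -, -, -, -, -, -, -, -, hsol⟩ := exists_peierls_parts h0 hg
  have hg' : H.gauge.b.op (H.peierls α) = 0 := by
    refine eq_zero_of_integral_ev_right (μ := μ) fun β hβ => ?_
    change pairing μ _ β = 0
    rw [H.gauge.b.pairing_eq (isCompact_overlap_right _ hβ)]
    exact hpair _ (H.gauge.b.isLocal_adj.mem_Sec₀ hβ)
      (LinearMap.congr_fun H.gauge.exact_field_adj.1 β)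
  obtain ⟨ε, hε, h⟩ := hrec.1 _ hsol.1.1 hg' hpair
  exact ⟨ε, hε, h.symm⟩

/-- The Peierls bivector is the map `[α] ↦ [E α]` on representatives with `g^* α = 0`. -/
theorem existsUnique_peierlsBivector :
    ∃! Pb : H.Cotangent →ₗ[ℝ] H.Tangent, H.IsPeierlsBivector Pb := by
  let R : H.Cotangent → H.Tangent → Prop := fun a b =>
    ∃ (α : H.GaugeInv) (_ : H.gauge.a.adj α = 0) (h : H.peierls α ∈ H.Sol),
      Submodule.Quotient.mk α = a ∧ Submodule.Quotient.mk ⟨H.peierls α, h⟩ = b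
  have hmem : ∀ α : H.GaugeInv, H.gauge.a.adj α = 0 → H.peierls α ∈ H.Sol := fun α hg => by
    obtain ⟨-, -, -, -, -, -, -, -, -, hsol⟩ := exists_peierls_parts α.2.1 hg
    exact hsol
  have hR : ∃ Pb : H.Cotangent →ₗ[ℝ] H.Tangent, ∀ a b, R a b → Pb a = b := by
    refine exists_linearMap_of_rel R ?_ ?_ ?_ ?_
    · intro a
      obtain ⟨α, hg, rfl⟩ := exists_adj_eq_zero a
      exact ⟨_, α, hg, hmem α hg, rfl, rfl⟩
    · rintro _ _ _ _ ⟨α, hg, h, rfl, rfl⟩ ⟨α', hg', h', rfl, rfl⟩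
      have hgg : H.gauge.a.adj ((α + α' : H.GaugeInv) : Sec F.dual) = 0 := by
        rw [Submodule.coe_add, map_add, hg, hg', add_zero]
      refine ⟨α + α', hgg, hmem _ hgg, rfl, ?_⟩
      rw [← Submodule.Quotient.mk_add]
      congr 1
      exact Subtype.ext (peierls_add α.2.1 α'.2.1)
    · rintro c _ _ ⟨α, hg, h, rfl, rfl⟩
      have hgg : H.gauge.a.adj ((c • α : H.GaugeInv) : Sec F.dual) = 0 := by
        rw [Submodule.coe_smul, map_smul, hg]
        exact smul_zero (A := Sec H.P.dual) c
      refine ⟨c • α, hgg, hmem _ hgg, rfl, ?_⟩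
      rw [← Submodule.Quotient.mk_smul]
      congr 1
      exact Subtype.ext (peierls_smul c α.2.1)
    · rintro _ _ _ ⟨α, hg, h, rfl, rfl⟩ ⟨α', hg', h', heq, rfl⟩
      rw [mk_cotangent_eq] at heq
      rw [eq_comm, mk_tangent_eq]
      have h1 := peierls_mem_PureGauge hS hJ hrec heq (by rw [map_sub, hg, hg', sub_zero])
      have h2 : H.peierls ((α' : Sec F.dual) - α) + H.peierls α = H.peierls α' := by
        rw [← peierls_add (sub_mem α'.2.1 α.2.1) α.2.1, sub_add_cancel]
      have h3 : H.peierls (α' : Sec F.dual) - H.peierls α ∈ H.PureGauge := by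
        rwa [← h2, add_sub_cancel_right]
      exact h3
  obtain ⟨Pb, hPb⟩ := hR
  refine ⟨Pb, fun α hg => ⟨hmem α hg, hPb _ _ ⟨α, hg, hmem α hg, rfl, rfl⟩⟩, fun P' hP' => ?_⟩
  refine LinearMap.ext fun a => ?_
  obtain ⟨α, hg, rfl⟩ := exists_adj_eq_zero a
  obtain ⟨h, hP⟩ := hP' α hg
  rw [hP, hPb _ _ ⟨α, hg, h, rfl, rfl⟩]

/-- Up to gauge, a linearized solution `ψ` with retarded part `ψ₊` is `E J ψ₊`. -/
theorem sub_peierls_mem_PureGauge {ψ ψp : Sec F} (hψ : ψ ∈ H.Sol) (hp : ψp ∈ SecRet C F)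
    (hm : ψ - ψp ∈ SecAdv C F) : ψ - H.peierls (J ψp) ∈ H.PureGauge := by
  have hα := J_mem_Sec₀ hS hψ hp hm
  have hg := H.gauge_adj_J hJ ψp
  obtain ⟨χp, hχp, χm, hχm, hfp, hfm, hJp, hJm, hE, hsol⟩ := exists_peierls_parts hα hg
  have hfψ : H.f.op ψ = 0 := hψ.1.2
  have hcψ : H.constr.b.op ψ = 0 := hψ.2
  -- `f (ψ₊ - χ₊)` lies in the image of `r̄_c c_g`, which `s'` annihilates
  have hfeq : ∀ σ, H.f.op σ = H.rbar (J σ) + H.rbarc (H.cg σ) :=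
    fun σ => LinearMap.congr_fun H.f_eq σ
  have hcomp : ∀ σ, H.gauge.t.op (H.rbarc (H.cg σ)) = 0 :=
    fun σ => LinearMap.congr_fun H.compatibility σ
  have hcomm : ∀ σ, H.gauge.l.op (H.gauge.b.op σ) = H.gauge.t.op (H.f.op σ) :=
    fun σ => LinearMap.congr_fun H.gauge.comm_right σ
  have hbp : H.gauge.b.op (ψp - χp) = 0 := by
    refine H.gauge.l.green.eq_zero_of_ret (H.gauge.b.isLocal.mem_SecRet (sub_mem hp hχp)) ?_
    rw [hcomm, map_sub, hfp, hfeq, add_sub_cancel_left, hcomp]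
  have hbm : H.gauge.b.op (ψ - ψp + χm) = 0 := by
    refine H.gauge.l.green.eq_zero_of_adv (H.gauge.b.isLocal.mem_SecAdv (add_mem hm hχm)) ?_
    have : H.f.op (ψ - ψp + χm) = -H.rbarc (H.cg ψp) := by
      rw [map_add, map_sub, hfψ, hfm, hfeq]
      abel
    rw [hcomm, this, map_neg, hcomp, neg_zero]
  have hb : H.gauge.b.op (ψ - H.peierls (J ψp)) = 0 := by
    have : ψ - H.peierls (J ψp) = (ψp - χp) + (ψ - ψp + χm) := by
      rw [hE]
      abel
    rw [this, map_add, hbp, hbm, add_zero]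
  suffices hpair : ∀ α' ∈ Sec₀ F.dual, H.gauge.a.adj α' = 0 →
      pairing μ (ψ - H.peierls (J ψp)) α' = 0 by
    obtain ⟨ε, hε, h⟩ := hrec.1 (ψ - H.peierls (J ψp)) (sub_mem hψ.1.1 hsol.1.1) hb hpair
    exact ⟨ε, hε, h.symm⟩
  intro α' hα' hg'
  obtain ⟨χp', hχp', χm', hχm', -, -, hJp', hJm', hE', -⟩ := exists_peierls_parts hα' hg'
  have e1 := hJ.pairing_eq H.isLocal_J (hS.isCompact_overlap hχp' hm)
  have e2 := hJ.pairing_eq H.isLocal_J (hS.isCompact_overlap' hχm' hp)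
  rw [map_sub, J_eq_zero H hψ, zero_sub, pairing_neg_right, hJp',
    pairing_sub_left (isCompact_overlap_right _ hα') (isCompact_overlap_right _ hα')] at e1
  rw [hJm'] at e2
  rw [pairing_sub_left (isCompact_overlap_right _ hα') (isCompact_overlap_right _ hα'),
    pairing_peierls hS hJ hα hg hα' hg', hE',
    pairing_sub_left (isCompact_overlap_right _ hα) (isCompact_overlap_right _ hα), e2]
  linarith

end
end Hyperbolization
end

end Peierls

theorem mainTheorem1 {d : ℕ} {M : Type u} [TopologicalSpace M] [ChartedSpace (Model d) M]
    [IsManifold 𝓘(ℝ, Model d) ∞ M] [T2Space M] [SecondCountableTopology M]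
    [MeasurableSpace M] [BorelSpace M]
    (μ : SmoothDensity d M) (C : ChronalCone d M) (S : Set M) (hS : IsCauchySurface C S)
    {F : VB.{u, v} d M} (V : VariationalSystem μ F) (φ : Sec F) (hφ : V.EL φ = 0)
    (J : Sec F →ₗ[ℝ] Sec F.dual) (hJ : V.IsJacobi φ J)
    (H : Hyperbolization μ C J)
    (hpar : H.GloballyParametrizable S) (hrec : H.GloballyRecognizable) :
    (∃! Ω : H.Tangent →ₗ[ℝ] H.Cotangent, H.RepresentsSymplecticForm V φ S Ω) ∧
    (∃! Pb : H.Cotangent →ₗ[ℝ] H.Tangent, H.IsPeierlsBivector Pb) ∧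
    ∀ (Ω : H.Tangent →ₗ[ℝ] H.Cotangent) (Pb : H.Cotangent →ₗ[ℝ] H.Tangent),
      H.RepresentsSymplecticForm V φ S Ω → H.IsPeierlsBivector Pb →
        Ω ∘ₗ Pb = LinearMap.id ∧ Pb ∘ₗ Ω = LinearMap.id := by
  have : LocallyCompactSpace M := ChartedSpace.locallyCompactSpace (Model d) M
  have : SigmaCompactSpace M := sigmaCompactSpace_of_locallyCompact_secondCountable
  refine ⟨Hyperbolization.existsUnique_symplecticForm hS hJ hpar,
    Hyperbolization.existsUnique_peierlsBivector hS hJ hrec, fun Ω Pb hΩ hPb => ⟨?_, ?_⟩⟩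
  · refine LinearMap.ext fun a => ?_
    obtain ⟨α, hg, rfl⟩ := Hyperbolization.exists_adj_eq_zero a
    obtain ⟨h, hPα⟩ := hPb α hg
    obtain ⟨χp, hp, χm, hm, -, -, hJp, -, hE, -⟩ := Hyperbolization.exists_peierls_parts α.2.1 hg
    have hm' : H.peierls α - χp ∈ SecAdv C F := by
      rw [hE, sub_sub_cancel_left]
      exact neg_mem hm
    rw [LinearMap.comp_apply, hPα]
    exact hΩ.apply hS hJ hpar ⟨_, h⟩ hp hm' α hJp.symm
  · refine LinearMap.ext fun a => ?_
    obtain ⟨ψ, rfl⟩ := Submodule.Quotient.mk_surjective _ a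
    obtain ⟨ψp, hp, hm, -⟩ := hS.exists_split ψ.2.1.1
    have hg := H.gauge_adj_J hJ ψp
    have hJp := Hyperbolization.J_mem_GaugeInv hS hJ ψ.2 hp hm
    obtain ⟨h, hPα⟩ := hPb ⟨J ψp, hJp⟩ hg
    rw [LinearMap.comp_apply, hΩ.apply hS hJ hpar ψ hp hm ⟨J ψp, hJp⟩ rfl, hPα, eq_comm,
      LinearMap.id_apply, Hyperbolization.mk_tangent_eq]
    exact Hyperbolization.sub_peierls_mem_PureGauge hS hJ hrec ψ.2 hp hm
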